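/- Let $S^1=\mathbb R/2\pi\mathbb Z$, with coordinates $(\theta,t)$ and flat metric $d\theta^2+dt^2$ on $S^1\times\mathbb R$. For an open $U\subset S^1\times\mathbb R$, $p>1$ and $R>0$, let $\mathcal F^p(U,R)$ be the set of (continuous representatives of) maps $f\in W^{2,p}_{loc}(U,\mathbb R^n)$ with $|f|\le R$ on $U$ for which there is a nonnegative measurable function $\beta$ with $|\Delta f|\le\beta|\nabla f|^2$ a.e. on $U$ and $\int_U\beta^2|\nabla f|^2<\infty$. Let $\mathcal F^p_{conf}(U,R)$ be the set of $f\in\mathcal F^p(U,R)$ that are weakly conformal, i.e. $|f_\theta|=|f_t|$ and $f_\theta\cdot f_t=0$ a.e. on $U$. Put $H(f)=2\Delta f/|\nabla f|^2$ where $\nabla f\neq0$ and $H(f)=0$ elsewhere, and $$E(f,S)=\int_S|\nabla f|^2,\qquad W(f,S)=\frac14\int_S|H(f)|^2|\nabla f|^2,$$ where $S=U$ if $S$ is omitted. If $\epsilon>0$ and $g_k$ are maps on open sets $U_k$, which eventually contain any given compact subset of $S^1\times\mathbb R$, their blowup set at threshold $\epsilon^2$ is $\mathcal C(\{g_k\})=\{z:\lim_{r\to0}\liminf_{k\to\infty}W(g_k,D_r(z))>\epsilon^2\}$.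 A bubble (at threshold $\epsilon^2$) of a sequence $f_k$ of maps on $S^1\times(-T_k,T_k)$ is a map $g_0$ with $E(g_0)>0$ for which there are $t_k$ with $T_k-t_k\to\infty$ and $t_k+T_k\to\infty$ such that some subsequence of the translates $(\theta,t)\mapsto f_k(\theta,t+t_k)$ converges to $g_0$ weakly in $W^{2,p}_{loc}$ on the complement of the blowup set of this subsequence. **Proposition.** For every $n$ and every $p>1$ there is a constant $\epsilon_2>0$, depending only on $n$ and $p$, such that the following holds. Let $R>0$, $T_k\to+\infty$, and let $f_k\in\mathcal F^p_{conf}(S^1\times(-T_k,T_k),R)$ with $$\sup_k\{E(f_k)+W(f_k)\}<\infty .$$ Suppose that $$\lim_{T\to+\infty}\liminf_{k\to+\infty}\sup_{t\in[-T_k+T,\,T_k-T]}W(f_k,S^1\times[t,t+1])<\epsilon_2^2 .$$ Then, after passing to a subsequence, again denoted by $f_k$: 1. $\{f_k\}$ has no bubble (at threshold $\epsilon_2^2$); 2. there is no energy loss: $\lim_{k\to\infty}\int_{S^1\times[-T_k+T,T_k-T]}|\nabla f_k|^2$ exists for all large $T$, and $$\lim_{T\to+\infty}\lim_{k\to+\infty}\int_{S^1\times[-T_k+T,T_k-T]}|\nabla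 f_k|^2=0;$$ 3. there is no neck: for all large $t$ the limits $\lim_{k\to\infty}f_k(\theta,-T_k+t)$ and $\lim_{k\to\infty}f_k(\theta,T_k-t)$ exist uniformly in $\theta$, and there is one point $P\in\mathbb R^n$, independent of $\theta$, with $$\lim_{t\to+\infty}\lim_{k\to+\infty}f_k(\theta,-T_k+t)=P=\lim_{t\to+\infty}\lim_{k\to+\infty}f_k(\theta,T_k-t)$$ uniformly in $\theta$. -/

import Mathlib

open Filter Topology MeasureTheory Set
open scoped ENNReal ContDiff

noncomputable section

namespace WillmoreNeck

instance factTwoPiPos : Fact ((0 : ℝ) < 2 * Real.pi) := ⟨Real.two_pi_pos⟩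

/-- The infinite flat cylinder `S¹ × ℝ`, with points `(θ, t)`, where `S¹ = ℝ / 2πℤ`.
Its `volume` is `dθ dt` (the circle has total length `2π`). -/
abbrev Cylinder : Type := AddCircle (2 * Real.pi) × ℝ

/-- The target space `ℝⁿ`. -/
abbrev Target (n : ℕ) : Type := EuclideanSpace ℝ (Fin n)

/-- The open cylinder `S¹ × (a, b)`. -/
def openCyl (a b : ℝ) : Set Cylinder := {z | z.2 ∈ Ioo a b}

/-- The closed cylinder `S¹ × [a, b]`. -/
def closedCyl (a b : ℝ) : Set Cylinder := {z | z.2 ∈ Icc a b}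

/-- The point of the cylinder with coordinates `(θ, t) = (s, 0)` for `i = 0` and `(0, s)` for
`i = 1`: translation by it moves a point by `s` in the `i`-th coordinate direction. -/
def step (i : Fin 2) (s : ℝ) : Cylinder :=
  if i = 0 then ((s : AddCircle (2 * Real.pi)), 0) else (0, s)

/-- Classical partial derivative: `∂/∂θ` for `i = 0`, `∂/∂t` for `i = 1`. -/
def classicalPartial (i : Fin 2) (φ : Cylinder → ℝ) (z : Cylinder) : ℝ :=
  deriv (fun s : ℝ => φ (z + step i s)) 0

/-- `φ ∈ C_c^∞(U)`; smoothness is read in the coordinates `(θ, t) ∈ ℝ × ℝ`. -/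
structure IsTestFunction (U : Set Cylinder) (φ : Cylinder → ℝ) : Prop where
  smooth : ContDiff ℝ ∞ (fun x : ℝ × ℝ => φ ((x.1 : AddCircle (2 * Real.pi)), x.2))
  compact : HasCompactSupport φ
  support_subset : tsupport φ ⊆ U

variable {n : ℕ}

/-- `v` is a weak `i`-th partial derivative of `u` on `U`. -/
structure HasWeakPartial (U : Set Cylinder) (i : Fin 2) (u v : Cylinder → Target n) : Prop where
  locInt_left : LocallyIntegrableOn u U
  locInt_right : LocallyIntegrableOn v U
  integral_eq : ∀ φ : Cylinder → ℝ, IsTestFunction U φ →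
    ∫ z, classicalPartial i φ z • u z = - ∫ z, φ z • v z

open Classical in
/-- The weak `i`-th partial derivative of `u` on `U`, well defined almost everywhere on the open
set `U` whenever it exists. -/
def weakPartial (U : Set Cylinder) (i : Fin 2) (u : Cylinder → Target n) :
    Cylinder → Target n :=
  if h : ∃ v, HasWeakPartial U i u v then h.choose else 0

/-- `u ∈ L^p_loc(U)`. -/
def MemLpLoc (U : Set Cylinder) (p : ℝ) (u : Cylinder → Target n) : Prop :=
  ∀ K : Set Cylinder, IsCompact K → K ⊆ U → MemLp u (ENNReal.ofReal p) (volume.restrict K)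

/-- `u ∈ W^{2,p}_loc(U)`. -/
def MemW2pLoc (U : Set Cylinder) (p : ℝ) (u : Cylinder → Target n) : Prop :=
  MemLpLoc U p u ∧
    ∀ i, ∃ v, HasWeakPartial U i u v ∧ MemLpLoc U p v ∧
      ∀ j, ∃ w, HasWeakPartial U j v w ∧ MemLpLoc U p w

/-- `|∇f|²`. -/
def gradSq (U : Set Cylinder) (f : Cylinder → Target n) (z : Cylinder) : ℝ :=
  ∑ i : Fin 2, ‖weakPartial U i f z‖ ^ 2

/-- `Δf` for the flat metric `dθ² + dt²`. -/
def laplacian (U : Set Cylinder) (f : Cylinder → Target n) (z : Cylinder) : Target n :=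
  ∑ i : Fin 2, weakPartial U i (weakPartial U i f) z

/-- `H(f) = 2 Δf / |∇f|²` where `∇f ≠ 0`, and `0` elsewhere. -/
def meanCurv (U : Set Cylinder) (f : Cylinder → Target n) (z : Cylinder) : Target n :=
  if gradSq U f z = 0 then 0 else (2 / gradSq U f z) • laplacian U f z

/-- `E(f, S) = ∫_S |∇f|²` for a map `f` defined on `U` (the integral is over `S ∩ U`). -/
def energy (U : Set Cylinder) (f : Cylinder → Target n) (S : Set Cylinder) : ℝ≥0∞ :=
  ∫⁻ z in S ∩ U, ENNReal.ofReal (gradSq U f z)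

/-- `W(f, S) = ¼ ∫_S |H(f)|² |∇f|²` for a map `f` defined on `U` (integral over `S ∩ U`). -/
def willmore (U : Set Cylinder) (f : Cylinder → Target n) (S : Set Cylinder) : ℝ≥0∞ :=
  (1 / 4) * ∫⁻ z in S ∩ U, ENNReal.ofReal (‖meanCurv U f z‖ ^ 2 * gradSq U f z)

/-- The class `F^p(U, R)`. Elements of `W^{2,p}_loc`, `p > 1`, on a surface have a continuous
representative; `f` is this representative. Only the values of `f` on `U` matter. -/
structure MemFp (U : Set Cylinder) (p R : ℝ) (f : Cylinder → Target n) : Prop where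
  memW2pLoc : MemW2pLoc U p f
  continuousOn : ContinuousOn f U
  bounded : ∀ z ∈ U, ‖f z‖ ≤ R
  laplacian_bound : ∃ β : Cylinder → ℝ, Measurable β ∧ (∀ z, 0 ≤ β z) ∧
    (∀ᵐ z ∂volume.restrict U, ‖laplacian U f z‖ ≤ β z * gradSq U f z) ∧
    ∫⁻ z in U, ENNReal.ofReal (β z ^ 2 * gradSq U f z) < ⊤

/-- The class `F^p_conf(U, R)`: maps in `F^p(U, R)` that are weakly conformal almost everywhere,
i.e. `⟨∂f/∂z, ∂f/∂z⟩ = 0`: the real part of this equation is `|f_θ| = |f_t|` and its imaginary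
part is `⟨f_θ, f_t⟩ = 0`. -/
structure MemFpConf (U : Set Cylinder) (p R : ℝ) (f : Cylinder → Target n) : Prop
    extends MemFp U p R f where
  conformal : ∀ᵐ z ∂volume.restrict U,
    ‖weakPartial U 0 f z‖ = ‖weakPartial U 1 f z‖ ∧
      inner ℝ (weakPartial U 0 f z) (weakPartial U 1 f z) = 0

/-- The open disk `D_r(z)` in the cylinder. -/
def disk (z : Cylinder) (r : ℝ) : Set Cylinder :=
  {w | ∃ a b : ℝ, a ^ 2 + b ^ 2 < r ^ 2 ∧ w = z + ((a : AddCircle (2 * Real.pi)), b)}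

/-- The blowup set of maps `g k` defined on `U k`, at the threshold `ε²`: the points `z` with
`lim_{r → 0} liminf_k W(g k, D_r(z)) > ε²`. The limit in `r` is monotone, hence an infimum. -/
def blowupSet (ε : ℝ) (U : ℕ → Set Cylinder) (g : ℕ → Cylinder → Target n) : Set Cylinder :=
  {z | ENNReal.ofReal (ε ^ 2) <
    ⨅ (r : ℝ) (_ : 0 < r), liminf (fun k => willmore (U k) (g k) (disk z r)) atTop}

/-- The maps `g k`, defined on domains `U k` that eventually contain every compact subset of `V`,
converge to `g₀` weakly in `W^{2,p}_loc(V)`: on every compact `K ⊆ V`, all derivatives of order at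
most two converge weakly in `L^p(K)`, i.e. against every `η ∈ L^{p/(p-1)}` supported in `K`. -/
structure WeakConvW2pLoc (p : ℝ) (V : Set Cylinder) (U : ℕ → Set Cylinder)
    (g : ℕ → Cylinder → Target n) (g₀ : Cylinder → Target n) : Prop where
  exhaust : ∀ K : Set Cylinder, IsCompact K → K ⊆ V → ∀ᶠ k in atTop, K ⊆ U k
  mem : ∀ k, MemW2pLoc (U k) p (g k)
  mem_limit : MemW2pLoc V p g₀
  conv : ∀ K : Set Cylinder, IsCompact K → K ⊆ V → ∀ η : Cylinder → Target n,
    MemLp η (ENNReal.ofReal (p / (p - 1))) volume → Function.support η ⊆ K →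
    Tendsto (fun k => ∫ z, inner ℝ (g k z) (η z)) atTop (𝓝 (∫ z, inner ℝ (g₀ z) (η z))) ∧
    (∀ i, Tendsto (fun k => ∫ z, inner ℝ (weakPartial (U k) i (g k) z) (η z)) atTop
      (𝓝 (∫ z, inner ℝ (weakPartial V i g₀ z) (η z)))) ∧
    (∀ i j, Tendsto
      (fun k => ∫ z, inner ℝ (weakPartial (U k) j (weakPartial (U k) i (g k)) z) (η z)) atTop
      (𝓝 (∫ z, inner ℝ (weakPartial V j (weakPartial V i g₀) z) (η z))))

/-- The domain `S¹ × (-T_k, T_k)` translated by `-s` in the axial direction. -/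
def shiftedDomain (T s : ℝ) : Set Cylinder := openCyl (-T - s) (T - s)

/-- The translated map `(θ, t) ↦ f(θ, t + s)`. -/
def shiftedMap (f : Cylinder → Target n) (s : ℝ) : Cylinder → Target n :=
  fun z => f (z.1, z.2 + s)

/-- `g₀` is a bubble of the maps `f k` on `S¹ × (-T_k, T_k)`: there are `t_k` with
`T_k - t_k → ∞` and `t_k + T_k → ∞`, such that a subsequence of the translates `f_k(θ, t + t_k)`
converges to `g₀` weakly in `W^{2,p}_loc` away from its blowup set, and `E(g₀) > 0`. -/
def IsBubble (p ε : ℝ) (T : ℕ → ℝ) (f : ℕ → Cylinder → Target n)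
    (g₀ : Cylinder → Target n) : Prop :=
  ∃ (t : ℕ → ℝ) (ψ : ℕ → ℕ), StrictMono ψ ∧
    Tendsto (fun k => T k - t k) atTop atTop ∧ Tendsto (fun k => t k - (-T k)) atTop atTop ∧
    let U : ℕ → Set Cylinder := fun k => shiftedDomain (T (ψ k)) (t (ψ k))
    let g : ℕ → Cylinder → Target n := fun k => shiftedMap (f (ψ k)) (t (ψ k))
    let V : Set Cylinder := (blowupSet ε U g)ᶜ
    WeakConvW2pLoc p V U g g₀ ∧ 0 < energy V g₀ univ

/-- There is no energy loss:
`lim_{S → ∞} lim_{k → ∞} ∫_{S¹ × [-T_k + S, T_k - S]} |∇f_k|² = 0`, where the inner limit exists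
for all large `S`. -/
def NoEnergyLoss (T : ℕ → ℝ) (f : ℕ → Cylinder → Target n) : Prop :=
  ∃ e : ℝ → ℝ≥0∞,
    (∀ᶠ S in atTop, Tendsto
      (fun k => energy (openCyl (-T k) (T k)) (f k) (closedCyl (-T k + S) (T k - S)))
      atTop (𝓝 (e S))) ∧
    Tendsto e atTop (𝓝 0)

/-- There is no neck: for all large `t` the limits `lim_k f_k(θ, -T_k + t)` and
`lim_k f_k(θ, T_k - t)` exist, uniformly in `θ`, and as `t → ∞` both tend, uniformly in `θ`, to
one and the same point. -/
def NoNeck (T : ℕ → ℝ) (f : ℕ → Cylinder → Target n) : Prop :=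
  ∃ (fPlus fMinus : ℝ → AddCircle (2 * Real.pi) → Target n) (P : Target n),
    (∀ᶠ t in atTop, TendstoUniformly (fun k θ => f k (θ, -T k + t)) (fPlus t) atTop) ∧
    (∀ᶠ t in atTop, TendstoUniformly (fun k θ => f k (θ, T k - t)) (fMinus t) atTop) ∧
    TendstoUniformly fPlus (fun _ => P) atTop ∧
    TendstoUniformly fMinus (fun _ => P) atTop

end WillmoreNeck

end

noncomputable section
namespace WillmoreNeck

/-! ### One-dimensional kernels -/

/-! The map is expanded in the angle. Its coefficient `u_m` on the circle at height `t` solves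
`u_m'' - m² u_m = (Δf)_m`, so a mode `m ≠ 0` is controlled by the Green kernel `exp (-|m||t - s|) /
(2|m|)` and decays away from the ends unless the source sustains it. Conformality gives `|∇f|² =
2|f_θ|²`, so the whole energy is visible in the modes `m ≠ 0`, and `|f_t| = |f_θ|`, so the drift of
the zero mode is controlled by the same energy.

On the circle at height `t` let `F`, `H`, `γ` be the integrals of `|f_θ|²`, of the Willmore density
and of `|Δf|`. Cauchy–Schwarz gives `γ ≤ 2 H^{1/2} F^{1/2}`. Squaring the Green bounds and summing
over `m ≠ 0`, Parseval gives, up to cutoffs, `F ≤ (kerP * γ)(kerQ * γ)`. The two kernels have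
product of size `1/|x|` near `0`, which is scale critical, so smallness of `H` has to be used. The
system closes in the norm `X = sup (kerP * γ) / wt` through two facts: `kerP²` is `exp (-|x|/8)`
times `kerN`, and convolving `kerQ` with `kerN` (after giving up part of its exponential rate)
returns a multiple of `kerP`. If `H` has small integral over unit intervals, then `X ≤ X/2 + C
B^{1/2}`, where `B` is bounded by the energy in the cutoff layers at the two ends. The a priori
finiteness of `X` comes from `Δf ∈ L^p_loc`, provided the exponent `α` is small depending on `p`.
This is `exists_decay_of_integral_inequality`, applied to maps in `exists_slice_decay`.

The result is exponential decay of the modes, with the summable factor `|m|^{-(1+α)}`, and of the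
energy (`exists_neckBounds`). Energy decay excludes energy loss; it also forces weak limits of
translates to be constant, hence no bubbles. Summing the modes shows that `f` is uniformly close to
its mean over the middle circle, which gives one point for both ends. The existence of the inner
limits follows from Hölder bounds in the height and a diagonal subsequence. -/

theorem lintegral_comp_abs (g : ℝ → ℝ≥0∞) : ∫⁻ x, g |x| = 2 * ∫⁻ x in Ioi 0, g x := by
  have h1 : ∫⁻ x in Iic (0 : ℝ), g |x| = ∫⁻ x in Ioi (0 : ℝ), g x := by
    have h2 : ∫⁻ x in Iio (0 : ℝ), g |x| = ∫⁻ x in Ioi (0 : ℝ), g x := by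
      have hm : MeasurePreserving (fun x : ℝ => -x) volume volume :=
        Measure.measurePreserving_neg volume
      have h3 := hm.setLIntegral_comp_preimage_emb (MeasurableEquiv.neg ℝ).measurableEmbedding
        (fun x => g |x|) (Iio 0)
      rw [← h3]
      have h4 : (fun x : ℝ => -x) ⁻¹' Iio 0 = Ioi 0 := by ext x; simp
      rw [h4]
      refine setLIntegral_congr_fun measurableSet_Ioi fun x hx => ?_
      simp only [abs_neg]
      rw [abs_of_pos hx]
    rw [← h2]
    exact setLIntegral_congr Iio_ae_eq_Iic.symm
  have h5 : ∫⁻ x in Ioi (0 : ℝ), g |x| = ∫⁻ x in Ioi (0 : ℝ), g x :=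
    setLIntegral_congr_fun measurableSet_Ioi fun x hx => by rw [abs_of_pos hx]
  rw [← lintegral_add_compl _ (measurableSet_Ioi (a := (0 : ℝ))), compl_Ioi, h1, h5, two_mul]

theorem lintegral_abs_rpow_mul_exp_lt_top {b c : ℝ} (hb : -1 < b) (hc : 0 < c) :
    ∫⁻ x : ℝ, ENNReal.ofReal (|x| ^ b * Real.exp (-c * |x|)) < ⊤ := by
  rw [lintegral_comp_abs (fun x => ENNReal.ofReal (x ^ b * Real.exp (-c * x)))]
  have h := integrableOn_rpow_mul_exp_neg_mul_rpow (p := 1) (s := b) (b := c) hb one_pos hc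
  simp only [Real.rpow_one] at h
  exact ENNReal.mul_lt_top (by simp) h.lintegral_lt_top

theorem lintegral_comp_affine (g : ℝ → ℝ≥0∞) (a : ℝ) {c : ℝ} (hc : c ≠ 0) :
    ∫⁻ t, g t = ENNReal.ofReal |c| * ∫⁻ x, g (a + c * x) := by
  have h1 : ∫⁻ x, g (a + c * x) = ∫⁻ x, (fun y => g (a + y)) x ∂(Measure.map (fun x => c * x) volume) :=
    ((Homeomorph.mulLeft₀ c hc).measurableEmbedding.lintegral_map (fun y => g (a + y))).symm
  rw [h1, Real.map_volume_mul_left hc, lintegral_smul_measure, lintegral_add_left_eq_self, smul_eq_mul,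
    ← mul_assoc, ← ENNReal.ofReal_mul (abs_nonneg _), ← abs_mul, mul_inv_cancel₀ hc]
  simp

/-- The singularities at `0` and `1` are integrable, and the total power at infinity is `-(1 + α) <
-1`. Of the points `0` and `1`, the farther one is at distance at least `1/2` and at least the
distance to the nearer one; hence the factor `max (1/2) y` in `φ₁` (nearer to `0`) and `φ₂` (nearer
to `1`). -/
theorem lintegral_abs_sub_one_rpow_mul_lt_top {α : ℝ} (h0 : 0 < α) (h1 : α ≤ 1 / 4) :
    ∫⁻ x : ℝ, ENNReal.ofReal (|x - 1| ^ (α - 1) * |x| ^ (-(2 * α))) < ⊤ := by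
  let φ₁ : ℝ → ℝ := fun y => y ^ (-(2 * α)) * max (1 / 2) y ^ (α - 1)
  let φ₂ : ℝ → ℝ := fun y => y ^ (α - 1) * max (1 / 2) y ^ (-(2 * α))
  have key : ∀ b c : ℝ, -1 < b → c ≤ 0 → b + c < -1 →
      ∫⁻ y in Ioi (0 : ℝ), ENNReal.ofReal (y ^ b * max (1 / 2) y ^ c) < ⊤ := by
    intro b c hb hc hbc
    have hi : IntegrableOn (fun y : ℝ => y ^ b * max (1 / 2) y ^ c) (Ioi 0) := by
      rw [← Ioc_union_Ioi_eq_Ioi (zero_le_one' ℝ)]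
      refine IntegrableOn.union ?_ ?_
      · have h2 : IntegrableOn (fun y : ℝ => y ^ b * (1 / 2 : ℝ) ^ c) (Ioc 0 1) :=
          (((intervalIntegral.intervalIntegrable_rpow' hb).1).mul_const _)
        refine Integrable.mono' h2 (by fun_prop) ?_
        refine (ae_restrict_iff' measurableSet_Ioc).2 (ae_of_all _ fun y hy => ?_)
        rw [Real.norm_of_nonneg (mul_nonneg (Real.rpow_nonneg hy.1.le _)
          (Real.rpow_nonneg (by positivity) _))]
        refine mul_le_mul_of_nonneg_left ?_ (Real.rpow_nonneg hy.1.le _)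
        exact Real.rpow_le_rpow_of_nonpos (by norm_num) (le_max_left _ _) hc
      · refine (integrableOn_Ioi_rpow_of_lt hbc one_pos).congr_fun (fun y hy => ?_) measurableSet_Ioi
        have hy' : (1 : ℝ) < y := hy
        dsimp only
        rw [max_eq_right (by linarith), Real.rpow_add (by linarith)]
    exact hi.lintegral_lt_top
  have k1 := key (-(2 * α)) (α - 1) (by linarith) (by linarith) (by linarith)
  have k2 := key (α - 1) (-(2 * α)) (by linarith) (by linarith) (by linarith)
  have hle : ∀ x : ℝ, ENNReal.ofReal (|x - 1| ^ (α - 1) * |x| ^ (-(2 * α))) ≤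
      ENNReal.ofReal (φ₁ |x|) + ENNReal.ofReal (φ₂ |x - 1|) := by
    intro x
    have hx1 : 1 ≤ |x| + |x - 1| := by
      have := abs_sub x (x - 1)
      simpa using this
    rcases le_total |x| |x - 1| with h | h
    · refine le_trans (ENNReal.ofReal_le_ofReal ?_) le_self_add
      dsimp only [φ₁]
      rw [mul_comm]
      refine mul_le_mul_of_nonneg_left ?_ (Real.rpow_nonneg (abs_nonneg _) _)
      refine Real.rpow_le_rpow_of_nonpos (by positivity) (max_le (by linarith) h) (by linarith)
    · refine le_trans (ENNReal.ofReal_le_ofReal ?_) le_add_self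
      dsimp only [φ₂]
      refine mul_le_mul_of_nonneg_left ?_ (Real.rpow_nonneg (abs_nonneg _) _)
      refine Real.rpow_le_rpow_of_nonpos (by positivity) (max_le (by linarith) h) (by linarith)
  refine (lintegral_mono hle).trans_lt ?_
  rw [lintegral_add_left (by dsimp only [φ₁]; fun_prop)]
  refine ENNReal.add_lt_top.2 ⟨?_, ?_⟩
  · rw [lintegral_comp_abs (fun y => ENNReal.ofReal (φ₁ y))]
    exact ENNReal.mul_lt_top (by simp) k1
  · rw [lintegral_sub_right_eq_self (fun y => ENNReal.ofReal (φ₂ |y|)) 1,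
      lintegral_comp_abs (fun y => ENNReal.ofReal (φ₂ y))]
    exact ENNReal.mul_lt_top (by simp) k2

/-- Convolution of two homogeneous kernels. -/
theorem exists_lintegral_rpow_conv_le {α : ℝ} (h0 : 0 < α) (h1 : α ≤ 1 / 4) :
    ∃ C : ℝ, 0 < C ∧ ∀ s r : ℝ, s ≠ r →
      ∫⁻ t : ℝ, ENNReal.ofReal (|t - s| ^ (α - 1) * |t - r| ^ (-(2 * α))) ≤
        ENNReal.ofReal (C * |s - r| ^ (-α)) := by
  have hJ := lintegral_abs_sub_one_rpow_mul_lt_top h0 h1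
  set J := ∫⁻ x : ℝ, ENNReal.ofReal (|x - 1| ^ (α - 1) * |x| ^ (-(2 * α))) with hJd
  refine ⟨J.toReal + 1, by positivity, fun s r hsr => ?_⟩
  have hc : s - r ≠ 0 := sub_ne_zero.2 hsr
  have hc' : 0 < |s - r| := abs_pos.2 hc
  -- Substituting `t = r + (s - r) x` leaves the fixed integral `J` and the power `1 + (α - 1) - 2α
  -- = -α` of `|s - r|`.
  rw [lintegral_comp_affine _ r hc]
  have h2 : ∀ x : ℝ, ENNReal.ofReal (|r + (s - r) * x - s| ^ (α - 1) *
      |r + (s - r) * x - r| ^ (-(2 * α))) = ENNReal.ofReal (|s - r| ^ (-α - 1)) *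
        ENNReal.ofReal (|x - 1| ^ (α - 1) * |x| ^ (-(2 * α))) := by
    intro x
    rw [← ENNReal.ofReal_mul (Real.rpow_nonneg hc'.le _)]
    congr 1
    have e1 : r + (s - r) * x - s = (s - r) * (x - 1) := by ring
    have e2 : r + (s - r) * x - r = (s - r) * x := by ring
    rw [e1, e2, abs_mul, abs_mul, Real.mul_rpow hc'.le (abs_nonneg _),
      Real.mul_rpow hc'.le (abs_nonneg _)]
    have e3 : |s - r| ^ (-α - 1) = |s - r| ^ (α - 1) * |s - r| ^ (-(2 * α)) := by
      rw [← Real.rpow_add hc']; congr 1; ring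
    rw [e3]; ring
  simp_rw [h2]
  rw [lintegral_const_mul' _ _ ENNReal.ofReal_ne_top, ← hJd, ← mul_assoc,
    ← ENNReal.ofReal_mul (abs_nonneg _)]
  have e4 : |s - r| * |s - r| ^ (-α - 1) = |s - r| ^ (-α) := by
    nth_rewrite 1 [← Real.rpow_one |s - r|]
    rw [← Real.rpow_add hc']; congr 1; ring
  rw [e4, mul_comm]
  have e5 : J = ENNReal.ofReal J.toReal := (ENNReal.ofReal_toReal hJ.ne).symm
  nth_rewrite 1 [e5]
  rw [← ENNReal.ofReal_mul ENNReal.toReal_nonneg]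
  refine ENNReal.ofReal_le_ofReal (mul_le_mul_of_nonneg_right ?_ (Real.rpow_nonneg hc'.le _))
  linarith

theorem lintegral_mul_le_sqrt {X : Type*} [MeasurableSpace X] {μ : Measure X} {f g : X → ℝ≥0∞}
    (hf : AEMeasurable f μ) (hg : AEMeasurable g μ) :
    ∫⁻ x, f x * g x ∂μ ≤ (∫⁻ x, f x ^ 2 ∂μ) ^ (1 / 2 : ℝ) * (∫⁻ x, g x ^ 2 ∂μ) ^ (1 / 2 : ℝ) := by
  have h := ENNReal.lintegral_mul_le_Lp_mul_Lq μ Real.HolderConjugate.two_two hf hg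
  simpa [Pi.mul_apply] using h

theorem ENNReal_sqrt_mul_self (x : ℝ≥0∞) : x ^ (1 / 2 : ℝ) * x ^ (1 / 2 : ℝ) = x := by
  rw [← ENNReal.rpow_add_of_nonneg _ _ (by norm_num) (by norm_num)]; norm_num

theorem ENNReal_sqrt_sq (x : ℝ≥0∞) : (x ^ (1 / 2 : ℝ)) ^ 2 = x := by
  rw [sq, ENNReal_sqrt_mul_self]

theorem ENNReal_sq_sqrt (x : ℝ≥0∞) : (x ^ 2) ^ (1 / 2 : ℝ) = x := by
  rw [sq, ENNReal.mul_rpow_of_nonneg _ _ (by norm_num), ENNReal_sqrt_mul_self]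

theorem sq_lintegral_mul_le {X : Type*} [MeasurableSpace X] {μ : Measure X} {f g : X → ℝ≥0∞}
    (hf : AEMeasurable f μ) (hg : AEMeasurable g μ) :
    (∫⁻ x, f x * g x ∂μ) ^ 2 ≤ (∫⁻ x, f x ^ 2 ∂μ) * (∫⁻ x, g x ^ 2 ∂μ) := by
  calc (∫⁻ x, f x * g x ∂μ) ^ 2 ≤ _ := pow_le_pow_left' (lintegral_mul_le_sqrt hf hg) 2
    _ = _ := by rw [mul_pow, ENNReal_sqrt_sq, ENNReal_sqrt_sq]

/-- Write `g s * w s` as its average over `v ∈ [s - 1, s]` and exchange the integrals. This turns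
bounds on the integrals of `g` over unit intervals into weighted bounds on the line. -/
theorem lintegral_mul_le_lintegral_unit {g w w' : ℝ → ℝ≥0∞} (hg : Measurable g)
    (hw' : Measurable w') (h : ∀ s v, s - 1 ≤ v → v ≤ s → w s ≤ w' v) :
    ∫⁻ s, g s * w s ≤ ∫⁻ v, (∫⁻ s in Icc v (v + 1), g s) * w' v := by
  have hS : MeasurableSet {x : ℝ × ℝ | x.1 ≤ x.2 ∧ x.2 ≤ x.1 + 1} :=
    (measurableSet_le measurable_fst measurable_snd).inter
      (measurableSet_le measurable_snd (measurable_fst.add_const 1))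
  have e1 : ∀ v, (∫⁻ s in Icc v (v + 1), g s) * w' v = ∫⁻ s,
      {x : ℝ × ℝ | x.1 ≤ x.2 ∧ x.2 ≤ x.1 + 1}.indicator (fun x => g x.2 * w' x.1) (v, s) := by
    intro v
    rw [← lintegral_mul_const _ hg, ← lintegral_indicator measurableSet_Icc]
    refine lintegral_congr fun s => ?_
    simp only [indicator, mem_Icc, mem_ofPred_eq]
  simp_rw [e1]
  rw [lintegral_lintegral_swap]
  · refine lintegral_mono fun s => ?_
    have e2 : g s * w s = ∫⁻ v, (Icc (s - 1) s).indicator (fun _ => g s * w s) v := by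
      rw [lintegral_indicator measurableSet_Icc]; simp
    rw [e2]
    refine lintegral_mono fun v => ?_
    simp only [indicator, mem_Icc, mem_ofPred_eq]
    by_cases hv : s - 1 ≤ v ∧ v ≤ s
    · have hv' : v ≤ s ∧ s ≤ v + 1 := ⟨hv.2, by linarith [hv.1]⟩
      rw [if_pos hv, if_pos hv']
      exact mul_le_mul_right (h s v hv.1 hv.2) _
    · rw [if_neg hv]; exact zero_le
  · exact (((hg.comp measurable_snd).mul (hw'.comp measurable_fst)).indicator hS).aemeasurable

/-! ### The one-dimensional integral inequality -/

/-- The kernel measuring the source term. -/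
def kerP (α x : ℝ) : ℝ := |x| ^ (-α) * Real.exp (-(1 / 4) * |x|)

/-- The kernel dual to `kerP` in the splitting of the half-order potential. -/
def kerQ (α x : ℝ) : ℝ := |x| ^ (α - 1) * Real.exp (-(1 / 4) * |x|)

/-- The kernel measuring the energy density. -/
def kerN (α x : ℝ) : ℝ := |x| ^ (-(2 * α)) * Real.exp (-(3 / 8) * |x|)

/-- The weight that decays exponentially away from the two ends of `[-T, T]`. -/
def wt (T t : ℝ) : ℝ := Real.exp (-(1 / 8) * (T - |t|))

theorem measurable_kerP (α : ℝ) : Measurable (kerP α) := by unfold kerP; fun_prop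
theorem measurable_kerQ (α : ℝ) : Measurable (kerQ α) := by unfold kerQ; fun_prop
theorem measurable_kerN (α : ℝ) : Measurable (kerN α) := by unfold kerN; fun_prop
theorem kerP_nonneg (α x : ℝ) : 0 ≤ kerP α x := by unfold kerP; positivity
theorem kerN_nonneg (α x : ℝ) : 0 ≤ kerN α x := by unfold kerN; positivity
theorem wt_pos (T t : ℝ) : 0 < wt T t := Real.exp_pos _

/-- The logarithm of the weight is `1/8`-Lipschitz. A rate below those of the kernels lets the
weight be moved from one point to another at the expense of part of the kernel decay. -/
theorem wt_le (T t r : ℝ) : wt T t ≤ wt T r * Real.exp ((1 / 8) * |t - r|) := by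
  unfold wt
  rw [← Real.exp_add, Real.exp_le_exp]
  have := abs_sub_abs_le_abs_sub t r
  linarith

/-- The potential of `g` with kernel `k`. -/
def pot (k : ℝ → ℝ) (g : ℝ → ℝ≥0∞) (t : ℝ) : ℝ≥0∞ := ∫⁻ s, ENNReal.ofReal (k (t - s)) * g s

theorem measurable_pot {k : ℝ → ℝ} {g : ℝ → ℝ≥0∞} (hk : Measurable k) (hg : Measurable g) :
    Measurable (pot k g) := by
  unfold pot
  exact Measurable.lintegral_prod_right'
    (f := fun x : ℝ × ℝ => ENNReal.ofReal (k (x.1 - x.2)) * g x.2) (by fun_prop)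

/-- The powers compose by scaling, and the exponential factors combine by the triangle inequality.
The rate `1/4` in the first factor is the rate `3/8` of `kerN` minus the `1/8` spent on moving the
weight. -/
theorem kerQ_conv_le {α : ℝ} (h0 : 0 < α) (h1 : α ≤ 1 / 4) :
    ∃ C : ℝ, 0 < C ∧ ∀ s r : ℝ, s ≠ r →
      ∫⁻ t : ℝ, ENNReal.ofReal (|t - r| ^ (-(2 * α)) * Real.exp (-(1 / 4) * |t - r|)) *
        ENNReal.ofReal (kerQ α (t - s)) ≤ ENNReal.ofReal (C * kerP α (r - s)) := by
  obtain ⟨C, hC, h⟩ := exists_lintegral_rpow_conv_le h0 h1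
  refine ⟨C, hC, fun s r hsr => ?_⟩
  have hle : ∀ t, ENNReal.ofReal (|t - r| ^ (-(2 * α)) * Real.exp (-(1 / 4) * |t - r|)) *
        ENNReal.ofReal (kerQ α (t - s)) ≤ ENNReal.ofReal (Real.exp (-(1 / 4) * |r - s|)) *
          ENNReal.ofReal (|t - s| ^ (α - 1) * |t - r| ^ (-(2 * α))) := by
    intro t
    rw [← ENNReal.ofReal_mul (by positivity), ← ENNReal.ofReal_mul (by positivity)]
    refine ENNReal.ofReal_le_ofReal ?_
    have e1 : |t - r| ^ (-(2 * α)) * Real.exp (-(1 / 4) * |t - r|) * kerQ α (t - s) =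
        Real.exp (-(1 / 4) * |t - r| + -(1 / 4) * |t - s|) *
          (|t - s| ^ (α - 1) * |t - r| ^ (-(2 * α))) := by
      unfold kerQ; rw [Real.exp_add]; ring
    rw [e1]
    refine mul_le_mul_of_nonneg_right (Real.exp_le_exp.2 ?_) (by positivity)
    have h3 : |r - s| ≤ |t - r| + |t - s| := by
      rw [abs_sub_comm t r]
      calc |r - s| = |(r - t) + (t - s)| := by ring_nf
        _ ≤ _ := abs_add_le _ _
    linarith
  refine (lintegral_mono hle).trans ?_
  rw [lintegral_const_mul' _ _ ENNReal.ofReal_ne_top]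
  refine (mul_le_mul_right (h s r hsr) _).trans ?_
  rw [← ENNReal.ofReal_mul (by positivity)]
  refine le_of_eq (congrArg _ ?_)
  unfold kerP
  rw [abs_sub_comm s r]; ring

/-- In the constant, `16` is the integral of `exp (-|x|/8)` and `exp (1/8)` bounds the change of the
weight over a unit step. -/
theorem lintegral_exp_weight_le {H : ℝ → ℝ≥0∞} (hH : Measurable H) {e : ℝ≥0∞}
    (h : ∀ v, ∫⁻ s in Icc v (v + 1), H s ≤ e) (t : ℝ) :
    ∫⁻ s, H s * ENNReal.ofReal (Real.exp (-(1 / 8) * |t - s|)) ≤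
      e * ENNReal.ofReal (16 * Real.exp (1 / 8)) := by
  have h1 := lintegral_mul_le_lintegral_unit (g := H)
    (w := fun s => ENNReal.ofReal (Real.exp (-(1 / 8) * |t - s|)))
    (w' := fun v => ENNReal.ofReal (Real.exp (1 / 8) * Real.exp (-(1 / 8) * |t - v|))) hH
    (by fun_prop) (fun s v h1 h2 => by
      refine ENNReal.ofReal_le_ofReal ?_
      rw [← Real.exp_add, Real.exp_le_exp]
      have h3 : |t - v| ≤ |t - s| + 1 := by
        calc |t - v| = |(t - s) + (s - v)| := by ring_nf
          _ ≤ |t - s| + |s - v| := abs_add_le _ _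
          _ ≤ |t - s| + 1 := by gcongr; rw [abs_le]; constructor <;> linarith
      linarith)
  refine h1.trans ?_
  refine (lintegral_mono fun v => mul_le_mul_left (h v) _).trans ?_
  rw [lintegral_const_mul _ (by fun_prop)]
  refine mul_le_mul_right (le_of_eq ?_) _
  simp_rw [ENNReal.ofReal_mul (Real.exp_pos (1 / 8)).le]
  rw [lintegral_const_mul _ (by fun_prop),
    lintegral_sub_left_eq_self (fun v => ENNReal.ofReal (Real.exp (-(1 / 8) * |v|))) t,
    lintegral_comp_abs (fun v => ENNReal.ofReal (Real.exp (-(1 / 8) * v)))]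
  rw [← ofReal_integral_eq_lintegral_ofReal
    (integrableOn_exp_mul_Ioi (by norm_num) 0) (ae_of_all _ fun x => by positivity),
    integral_exp_mul_Ioi (by norm_num)]
  rw [mul_comm (16 : ℝ), ENNReal.ofReal_mul (by positivity)]
  congr 1
  rw [show (2 : ℝ≥0∞) = ENNReal.ofReal 2 by simp, ← ENNReal.ofReal_mul (by norm_num)]
  norm_num

/-- Since `1/2 = 1/8 + 3/8`, this square is `exp (-|x|/8) * kerN α x`, the splitting used in
Cauchy–Schwarz below. -/
theorem kerP_sq (α x : ℝ) :
    kerP α x ^ 2 = |x| ^ (-(2 * α)) * Real.exp (-(1 / 2) * |x|) := by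
  unfold kerP
  rw [mul_pow, ← Real.rpow_natCast (|x| ^ (-α)) 2, ← Real.rpow_mul (abs_nonneg x), ← Real.exp_nat_mul]
  congr 2 <;> push_cast <;> ring

/-- Contribution to the potential of a source supported near the two ends. -/
theorem exists_pot_layer_le {α : ℝ} (h1 : α ≤ 1 / 4) :
    ∃ C : ℝ, 0 < C ∧ ∀ (T : ℝ) (b : ℝ → ℝ≥0∞) (B : ℝ≥0∞), Measurable b →
      (∀ s, |s| < T - 1 → b s = 0) → ∫⁻ s, b s ^ 2 ≤ B →
      ∀ t, pot (kerP α) b t ≤ ENNReal.ofReal (C * wt T t) * B ^ (1 / 2 : ℝ) := by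
  have hJ := lintegral_abs_rpow_mul_exp_lt_top (b := -(2 * α)) (c := 1 / 4) (by linarith)
    (by norm_num)
  set J := ∫⁻ x : ℝ, ENNReal.ofReal (|x| ^ (-(2 * α)) * Real.exp (-(1 / 4) * |x|)) with hJd
  refine ⟨(Real.exp (1 / 4) * J.toReal) ^ (1 / 2 : ℝ) + 1, by positivity, ?_⟩
  intro T b B hb hs hB t
  let k : ℝ → ℝ≥0∞ := fun s => ENNReal.ofReal (if T - 1 ≤ |s| then kerP α (t - s) else 0)
  have hk : Measurable k :=
    ENNReal.measurable_ofReal.comp (Measurable.ite (measurableSet_le (by fun_prop) (by fun_prop))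
      ((measurable_kerP α).comp (by fun_prop)) measurable_const)
  have e1 : pot (kerP α) b t = ∫⁻ s, k s * b s := by
    unfold pot
    refine lintegral_congr fun s => ?_
    by_cases h : T - 1 ≤ |s|
    · dsimp only [k]; rw [if_pos h]
    · rw [hs s (not_le.1 h)]; simp
  rw [e1]
  refine (lintegral_mul_le_sqrt hk.aemeasurable hb.aemeasurable).trans ?_
  refine mul_le_mul' ?_ (ENNReal.rpow_le_rpow hB (by norm_num))
  have h2 : ∫⁻ s, k s ^ 2 ≤ ENNReal.ofReal (wt T t ^ 2 * (Real.exp (1 / 4) * J.toReal)) := by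
    have hle : ∀ s, k s ^ 2 ≤ ENNReal.ofReal (wt T t ^ 2 * Real.exp (1 / 4)) *
        ENNReal.ofReal (|t - s| ^ (-(2 * α)) * Real.exp (-(1 / 4) * |t - s|)) := by
      intro s
      rw [← ENNReal.ofReal_mul (by positivity)]
      dsimp only [k]
      by_cases h : T - 1 ≤ |s|
      · rw [if_pos h, ← ENNReal.ofReal_pow (kerP_nonneg _ _), kerP_sq]
        refine ENNReal.ofReal_le_ofReal ?_
        have e2 : wt T t ^ 2 * Real.exp (1 / 4) *
            (|t - s| ^ (-(2 * α)) * Real.exp (-(1 / 4) * |t - s|)) = |t - s| ^ (-(2 * α)) *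
              Real.exp (2 * (-(1 / 8) * (T - |t|)) + 1 / 4 + -(1 / 4) * |t - s|) := by
          unfold wt
          rw [← Real.exp_nat_mul, Real.exp_add, Real.exp_add]; push_cast; ring
        rw [e2]
        -- Half of the decay `exp (-|t - s|/2)` is traded for the squared weight, because `|t - s| ≥
        -- |s| - |t| ≥ T - 1 - |t|`; the `1` accounts for `exp (1/4)`. The other half is kept for
        -- integrability.
        refine mul_le_mul_of_nonneg_left (Real.exp_le_exp.2 ?_) (by positivity)
        have := abs_sub_abs_le_abs_sub s t
        rw [abs_sub_comm s t] at this
        linarith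
      · rw [if_neg h]; simp
    refine (lintegral_mono hle).trans ?_
    rw [lintegral_const_mul' _ _ ENNReal.ofReal_ne_top, lintegral_sub_left_eq_self
      (fun x => ENNReal.ofReal (|x| ^ (-(2 * α)) * Real.exp (-(1 / 4) * |x|))) t, ← hJd]
    nth_rewrite 1 [← ENNReal.ofReal_toReal hJ.ne]
    rw [← ENNReal.ofReal_mul (by positivity), mul_assoc]
  refine (ENNReal.rpow_le_rpow h2 (by norm_num)).trans ?_
  have hw := (wt_pos T t).le
  rw [ENNReal.ofReal_rpow_of_nonneg (by positivity) (by norm_num)]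
  refine ENNReal.ofReal_le_ofReal ?_
  rw [Real.mul_rpow (by positivity) (by positivity), ← Real.sqrt_eq_rpow (wt T t ^ 2),
    Real.sqrt_sq hw, mul_comm]
  refine mul_le_mul_of_nonneg_right ?_ hw
  linarith

/-- Absorption of half of the left side. Finiteness is essential, since `x = ⊤` always satisfies the
inequality. -/
theorem ENNReal_le_two_mul_of_le_half_add {x y : ℝ≥0∞} (hx : x ≠ ⊤) (h : x ≤ 2⁻¹ * x + y) :
    x ≤ 2 * y := by
  have h1 : x = 2⁻¹ * x + 2⁻¹ * x := by rw [← add_mul, ENNReal.inv_two_add_inv_two, one_mul]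
  have h2 : 2⁻¹ * x + 2⁻¹ * x ≤ 2⁻¹ * x + y := h1 ▸ h
  have h3 : 2⁻¹ * x ≤ y := (ENNReal.add_le_add_iff_left (ENNReal.mul_ne_top (by simp) hx)).1 h2
  calc x = 2 * (2⁻¹ * x) := by
        rw [← mul_assoc, ENNReal.mul_inv_cancel (by simp) (by simp), one_mul]
    _ ≤ 2 * y := by gcongr

/-- Of the two potentials bounding `A`, the first contributes `X * wt T t`, and its weight is moved
from `t` to `r`, lowering the rate of `kerN` from `3/8` to `1/4`. Fubini and `hconv` turn the second
potential into `pot (kerP α) γ r`, which contributes another `X * wt T r`. -/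
theorem lintegral_energy_le {α C₁ C₂ : ℝ} (hC₁ : 0 < C₁) (hC₂ : 0 < C₂)
    (hconv : ∀ s r : ℝ, s ≠ r →
      ∫⁻ t : ℝ, ENNReal.ofReal (|t - r| ^ (-(2 * α)) * Real.exp (-(1 / 4) * |t - r|)) *
        ENNReal.ofReal (kerQ α (t - s)) ≤ ENNReal.ofReal (C₂ * kerP α (r - s)))
    {T : ℝ} {γ A : ℝ → ℝ≥0∞} (hγ : Measurable γ) (X : ℝ≥0∞)
    (hA : ∀ᵐ t, A t ≤ ENNReal.ofReal C₁ * (pot (kerP α) γ t * pot (kerQ α) γ t))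
    (hX : ∀ t, pot (kerP α) γ t ≤ X * ENNReal.ofReal (wt T t)) (r : ℝ) :
    ∫⁻ t, A t * ENNReal.ofReal (kerN α (t - r)) ≤
      ENNReal.ofReal (C₁ * C₂ * wt T r ^ 2) * X ^ 2 := by
  let m : ℝ → ℝ≥0∞ := fun t =>
    ENNReal.ofReal (|t - r| ^ (-(2 * α)) * Real.exp (-(1 / 4) * |t - r|))
  have hm : Measurable m := by dsimp only [m]; fun_prop
  have hw := (wt_pos T r).le
  have s1 : ∫⁻ t, A t * ENNReal.ofReal (kerN α (t - r)) ≤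
      ∫⁻ t, ENNReal.ofReal (C₁ * wt T r) * X * (m t * pot (kerQ α) γ t) := by
    refine lintegral_mono_ae ?_
    filter_upwards [hA] with t ht
    have h1 : ENNReal.ofReal (wt T t) * ENNReal.ofReal (kerN α (t - r)) ≤
        ENNReal.ofReal (wt T r) * m t := by
      dsimp only [m]
      rw [← ENNReal.ofReal_mul (wt_pos _ _).le, ← ENNReal.ofReal_mul (wt_pos _ _).le]
      refine ENNReal.ofReal_le_ofReal ?_
      calc wt T t * kerN α (t - r)
          ≤ wt T r * Real.exp ((1 / 8) * |t - r|) * kerN α (t - r) :=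
            mul_le_mul_of_nonneg_right (wt_le T t r) (kerN_nonneg _ _)
        _ = wt T r * (|t - r| ^ (-(2 * α)) *
              Real.exp ((1 / 8) * |t - r| + -(3 / 8) * |t - r|)) := by
            unfold kerN; rw [Real.exp_add]; ring
        _ = _ := by ring_nf
    calc A t * ENNReal.ofReal (kerN α (t - r))
        ≤ ENNReal.ofReal C₁ * (X * ENNReal.ofReal (wt T t) * pot (kerQ α) γ t) *
            ENNReal.ofReal (kerN α (t - r)) := by
          gcongr
          exact ht.trans (by gcongr; exact hX t)
      _ = ENNReal.ofReal C₁ * X * pot (kerQ α) γ t *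
            (ENNReal.ofReal (wt T t) * ENNReal.ofReal (kerN α (t - r))) := by ring
      _ ≤ ENNReal.ofReal C₁ * X * pot (kerQ α) γ t * (ENNReal.ofReal (wt T r) * m t) := by gcongr
      _ = _ := by rw [ENNReal.ofReal_mul hC₁.le]; ring
  refine s1.trans ?_
  have hpQ := measurable_pot (measurable_kerQ α) hγ
  rw [lintegral_const_mul _ (by fun_prop)]
  have s2 : ∫⁻ t, m t * pot (kerQ α) γ t ≤ ENNReal.ofReal C₂ * pot (kerP α) γ r := by
    have e1 : ∀ t, m t * pot (kerQ α) γ t =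
        ∫⁻ s, m t * ENNReal.ofReal (kerQ α (t - s)) * γ s := by
      intro t
      unfold pot
      have hk := measurable_kerQ α
      rw [← lintegral_const_mul _ (by fun_prop)]
      simp_rw [mul_assoc]
    simp_rw [e1]
    have hk := measurable_kerQ α
    rw [lintegral_lintegral_swap (by fun_prop)]
    unfold pot
    have hkP := measurable_kerP α
    rw [← lintegral_const_mul _ (by fun_prop)]
    refine lintegral_mono_ae ?_
    have hne : ∀ᵐ s : ℝ, s ≠ r := by simp [ae_iff]
    filter_upwards [hne] with s hs
    rw [lintegral_mul_const _ (by fun_prop), ← mul_assoc, ← ENNReal.ofReal_mul hC₂.le]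
    gcongr
    exact hconv s r hs
  calc ENNReal.ofReal (C₁ * wt T r) * X * ∫⁻ t, m t * pot (kerQ α) γ t
      ≤ ENNReal.ofReal (C₁ * wt T r) * X * (ENNReal.ofReal C₂ * (X * ENNReal.ofReal (wt T r))) := by
        gcongr
        exact s2.trans (by gcongr; exact hX r)
    _ = (ENNReal.ofReal (C₁ * wt T r) * ENNReal.ofReal C₂ * ENNReal.ofReal (wt T r)) * X ^ 2 := by
        ring
    _ = _ := by
        rw [← ENNReal.ofReal_mul (by positivity), ← ENNReal.ofReal_mul (by positivity)]
        congr 2; ring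

/-- A nonnegative solution of a critical half-order integral inequality with small coefficient
decays exponentially away from the ends of the interval. -/
theorem exists_decay_of_integral_inequality {α : ℝ} (h0 : 0 < α) (h1 : α ≤ 1 / 4) {C₁ : ℝ}
    (hC₁ : 0 < C₁) :
    ∃ ε C : ℝ, 0 < ε ∧ 0 < C ∧ ∀ (T : ℝ) (γ A H b : ℝ → ℝ≥0∞) (B : ℝ≥0∞),
      Measurable γ → Measurable A → Measurable H → Measurable b →
      (∀ᵐ t, A t ≤ ENNReal.ofReal C₁ * (pot (kerP α) γ t * pot (kerQ α) γ t)) →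
      (∀ᵐ s, γ s ≤ H s ^ (1 / 2 : ℝ) * A s ^ (1 / 2 : ℝ) + b s) →
      (∀ s, |s| < T - 1 → b s = 0) → ∫⁻ s, b s ^ 2 ≤ B →
      (∀ v, ∫⁻ s in Icc v (v + 1), H s ≤ ENNReal.ofReal ε) →
      (∃ K : ℝ≥0∞, K ≠ ⊤ ∧ ∀ t, pot (kerP α) γ t ≤ K) →
      (∀ t, pot (kerP α) γ t ≤ ENNReal.ofReal (C * wt T t) * B ^ (1 / 2 : ℝ)) ∧
      ∀ r, ∫⁻ t, A t * ENNReal.ofReal (kerN α (t - r)) ≤ ENNReal.ofReal (C * wt T r ^ 2) * B := by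
  obtain ⟨C₂, hC₂, hconv⟩ := kerQ_conv_le h0 h1
  obtain ⟨C₃, hC₃, hlayer⟩ := exists_pot_layer_le h1
  let c₄ : ℝ := 16 * Real.exp (1 / 8)
  have hc₄ : 0 < c₄ := by positivity
  -- Chosen to make the product of the constants equal to `1/4`; its square root is the absorbable
  -- coefficient `1/2` in `hP`.
  let ε : ℝ := (4 * c₄ * C₁ * C₂)⁻¹
  have hε : 0 < ε := by positivity
  have hεe : ε * c₄ * (C₁ * C₂) = 1 / 4 := by dsimp only [ε]; field_simp
  refine ⟨ε, 2 * C₃ + C₁ * C₂ * (2 * C₃) ^ 2, hε, by positivity, ?_⟩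
  intro T γ A H b B hγ hA hH hb hAPQ hγle hb0 hB hHε ⟨K, hK, hPK⟩
  -- The best constant in the weighted bound, to be estimated by itself.
  let X : ℝ≥0∞ := ⨆ t, pot (kerP α) γ t / ENNReal.ofReal (wt T t)
  have hwpos : ∀ t, ENNReal.ofReal (wt T t) ≠ 0 := fun t => by
    simpa using wt_pos T t
  have hX : ∀ t, pot (kerP α) γ t ≤ X * ENNReal.ofReal (wt T t) := fun t => by
    have : pot (kerP α) γ t / ENNReal.ofReal (wt T t) ≤ X := le_iSup (fun t =>
      pot (kerP α) γ t / ENNReal.ofReal (wt T t)) t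
    exact (ENNReal.div_le_iff (hwpos t) ENNReal.ofReal_ne_top).1 this
  -- The weight is smallest at `0`, so a bound without decay already makes `X` finite. The size of
  -- `K` does not enter the final constant.
  have hXtop : X ≠ ⊤ := by
    have hw0 : ∀ t, wt T 0 ≤ wt T t := fun t => by
      unfold wt
      rw [Real.exp_le_exp]
      have := abs_nonneg t
      simp only [abs_zero]; linarith
    refine ne_top_of_le_ne_top (ENNReal.div_ne_top hK (hwpos 0)) (iSup_le fun t => ?_)
    exact ENNReal.div_le_div (hPK t) (ENNReal.ofReal_le_ofReal (hw0 t))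
  have hN := lintegral_energy_le hC₁ hC₂ hconv hγ X hAPQ hX
  have hkP := measurable_kerP α
  have hkN := measurable_kerN α
  have hP : ∀ t, pot (kerP α) γ t ≤ 2⁻¹ * X * ENNReal.ofReal (wt T t) +
      ENNReal.ofReal (C₃ * wt T t) * B ^ (1 / 2 : ℝ) := by
    intro t
    have s1 : pot (kerP α) γ t ≤ (∫⁻ s, ENNReal.ofReal (kerP α (t - s)) *
        (H s ^ (1 / 2 : ℝ) * A s ^ (1 / 2 : ℝ))) + pot (kerP α) b t := by
      unfold pot
      rw [← lintegral_add_left (by fun_prop)]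
      refine lintegral_mono_ae ?_
      filter_upwards [hγle] with s hs
      rw [← mul_add]
      gcongr
    refine s1.trans (add_le_add ?_ (hlayer T b B hb hb0 hB t))
    -- Split `kerP` by `kerP² = exp (-|x|/8) * kerN`: the exponential goes with `H`, whose unit
    -- integrals are small, and `kerN` goes with `A`, where `hN` applies.
    have e1 : ∀ s, ENNReal.ofReal (kerP α (t - s)) * (H s ^ (1 / 2 : ℝ) * A s ^ (1 / 2 : ℝ)) =
        (H s * ENNReal.ofReal (Real.exp (-(1 / 8) * |t - s|))) ^ (1 / 2 : ℝ) *
          (A s * ENNReal.ofReal (kerN α (s - t))) ^ (1 / 2 : ℝ) := by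
      intro s
      rw [ENNReal.mul_rpow_of_nonneg _ _ (by norm_num), ENNReal.mul_rpow_of_nonneg _ _ (by norm_num)]
      have e2 : ENNReal.ofReal (kerP α (t - s)) =
          ENNReal.ofReal (Real.exp (-(1 / 8) * |t - s|)) ^ (1 / 2 : ℝ) *
            ENNReal.ofReal (kerN α (s - t)) ^ (1 / 2 : ℝ) := by
        rw [← ENNReal.mul_rpow_of_nonneg _ _ (by norm_num), ← ENNReal.ofReal_mul (by positivity)]
        have e3 : Real.exp (-(1 / 8) * |t - s|) * kerN α (s - t) = kerP α (t - s) ^ 2 := by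
          rw [kerP_sq]
          unfold kerN
          rw [abs_sub_comm s t, mul_left_comm, ← Real.exp_add]
          ring_nf
        rw [e3, ENNReal.ofReal_pow (kerP_nonneg _ _), ENNReal_sq_sqrt]
      rw [e2]; ring
    simp_rw [e1]
    refine (lintegral_mul_le_sqrt (by fun_prop) (by fun_prop)).trans ?_
    simp_rw [ENNReal_sqrt_sq]
    rw [← ENNReal.mul_rpow_of_nonneg _ _ (by norm_num)]
    have s2 := mul_le_mul' (lintegral_exp_weight_le hH hHε t) (hN t)
    refine (ENNReal.rpow_le_rpow s2 (by norm_num)).trans (le_of_eq ?_)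
    have e4 : ENNReal.ofReal ε * ENNReal.ofReal (16 * Real.exp (1 / 8)) *
        (ENNReal.ofReal (C₁ * C₂ * wt T t ^ 2) * X ^ 2) =
        (2⁻¹ * X * ENNReal.ofReal (wt T t)) ^ 2 := by
      rw [← ENNReal.ofReal_mul hε.le, ← mul_assoc, ← ENNReal.ofReal_mul (by positivity)]
      have e5 : ε * (16 * Real.exp (1 / 8)) * (C₁ * C₂ * wt T t ^ 2) =
          (1 / 2 * wt T t) ^ 2 := by
        calc _ = (ε * c₄ * (C₁ * C₂)) * wt T t ^ 2 := by dsimp only [c₄]; ring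
          _ = _ := by rw [hεe]; ring
      have hw := wt_pos T t
      rw [e5, ENNReal.ofReal_pow (by positivity), ENNReal.ofReal_mul (by norm_num), one_div,
        ENNReal.ofReal_inv_of_pos (by norm_num), ENNReal.ofReal_ofNat]
      ring
    rw [e4, ENNReal_sq_sqrt]
  have hXle : X ≤ 2 * (ENNReal.ofReal C₃ * B ^ (1 / 2 : ℝ)) := by
    refine ENNReal_le_two_mul_of_le_half_add hXtop (iSup_le fun t => ?_)
    rw [ENNReal.div_le_iff (hwpos t) ENNReal.ofReal_ne_top]
    refine (hP t).trans (le_of_eq ?_)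
    rw [ENNReal.ofReal_mul hC₃.le]; ring
  refine ⟨fun t => ?_, fun r => ?_⟩
  · refine (hX t).trans ?_
    calc X * ENNReal.ofReal (wt T t)
        ≤ 2 * (ENNReal.ofReal C₃ * B ^ (1 / 2 : ℝ)) * ENNReal.ofReal (wt T t) := by gcongr
      _ = ENNReal.ofReal (2 * C₃ * wt T t) * B ^ (1 / 2 : ℝ) := by
          rw [ENNReal.ofReal_mul (by positivity), ENNReal.ofReal_mul (by norm_num),
            ENNReal.ofReal_ofNat]; ring
      _ ≤ _ := by
          have hw := (wt_pos T t).le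
          gcongr
          have : 0 ≤ C₁ * C₂ * (2 * C₃) ^ 2 := by positivity
          linarith
  · refine (hN r).trans ?_
    calc ENNReal.ofReal (C₁ * C₂ * wt T r ^ 2) * X ^ 2
        ≤ ENNReal.ofReal (C₁ * C₂ * wt T r ^ 2) * (2 * (ENNReal.ofReal C₃ * B ^ (1 / 2 : ℝ))) ^ 2 := by
          gcongr
      _ = ENNReal.ofReal (C₁ * C₂ * (2 * C₃) ^ 2 * wt T r ^ 2) * B := by
          rw [mul_pow, mul_pow, ENNReal_sqrt_sq, ← mul_assoc, ← mul_assoc,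
            show (2 : ℝ≥0∞) = ENNReal.ofReal 2 by simp, ← ENNReal.ofReal_pow (by norm_num),
            ← ENNReal.ofReal_pow hC₃.le, ← ENNReal.ofReal_mul (by positivity),
            ← ENNReal.ofReal_mul (by positivity)]
          congr 2; ring
      _ ≤ _ := by
          gcongr
          linarith

end WillmoreNeck
end

noncomputable section
namespace WillmoreNeck

/-! ### The real trigonometric basis `cos (m θ) + sin (m θ)` -/

/-- The function `cos (m θ) + sin (m θ)` on the circle. -/
def cas (m : ℤ) (θ : AddCircle (2 * Real.pi)) : ℝ := (fourier m θ).re + (fourier m θ).im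

theorem fourier_coe_eq (m : ℤ) (x : ℝ) :
    fourier m (x : AddCircle (2 * Real.pi)) = Complex.exp ((m * x : ℝ) * Complex.I) := by
  rw [fourier_coe_apply]
  congr 1
  have : (Real.pi : ℂ) ≠ 0 := by exact_mod_cast Real.pi_ne_zero
  push_cast
  field_simp

theorem cas_coe (m : ℤ) (x : ℝ) :
    cas m (x : AddCircle (2 * Real.pi)) = Real.cos (m * x) + Real.sin (m * x) := by
  unfold cas
  rw [fourier_coe_eq, Complex.exp_ofReal_mul_I_re, Complex.exp_ofReal_mul_I_im]

theorem continuous_cas (m : ℤ) : Continuous (cas m) := by unfold cas; fun_prop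

theorem norm_fourier_apply (m : ℤ) (θ : AddCircle (2 * Real.pi)) : ‖fourier m θ‖ = 1 := by
  rw [fourier_apply, Circle.norm_coe]

theorem abs_cas_le (m : ℤ) (θ : AddCircle (2 * Real.pi)) : |cas m θ| ≤ 2 := by
  have h : ‖fourier m θ‖ = 1 := norm_fourier_apply m θ
  have h1 := Complex.abs_re_le_norm (fourier m θ)
  have h2 := Complex.abs_im_le_norm (fourier m θ)
  unfold cas
  exact (abs_add_le _ _).trans (by linarith)

theorem cas_neg (m : ℤ) (θ : AddCircle (2 * Real.pi)) :
    cas (-m) θ = (fourier m θ).re - (fourier m θ).im := by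
  unfold cas
  rw [fourier_neg]
  simp [sub_eq_add_neg]

theorem cas_zero (θ : AddCircle (2 * Real.pi)) : cas 0 θ = 1 := by
  simp [cas]

variable {n : ℕ}

/-- The coefficient of a map on the circle with respect to `cas m`. -/
def casCoeff (m : ℤ) (x : AddCircle (2 * Real.pi) → Target n) : Target n := ∫ θ, cas m θ • x θ

theorem integrable_cas_smul {E : Type*} [NormedAddCommGroup E] [NormedSpace ℝ E] (m : ℤ)
    {x : AddCircle (2 * Real.pi) → E} (hx : Integrable x) : Integrable fun θ => cas m θ • x θ :=
  hx.bdd_smul 2 (continuous_cas m).aestronglyMeasurable (ae_of_all _ fun θ => by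
    rw [Real.norm_eq_abs]; exact abs_cas_le m θ)

theorem casCoeff_apply (m : ℤ) {x : AddCircle (2 * Real.pi) → Target n} (hx : Integrable x)
    (j : Fin n) : casCoeff m x j = ∫ θ, cas m θ * x θ j := by
  unfold casCoeff
  have h := (EuclideanSpace.proj j : Target n →L[ℝ] ℝ).integral_comp_comm
    (integrable_cas_smul m hx)
  simpa using h.symm

theorem integrable_apply {X : Type*} [MeasurableSpace X] {μ : Measure X} {x : X → Target n}
    (hx : Integrable x μ) (j : Fin n) : Integrable (fun θ => x θ j) μ :=
  (EuclideanSpace.proj j : Target n →L[ℝ] ℝ).integrable_comp hx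

/-- The half sum of `cas m` and `cas (-m)` is the cosine and the half difference is the sine, which
transfers complex Fourier theory to the real system. -/
theorem fourierCoeff_ofReal (m : ℤ) {y : AddCircle (2 * Real.pi) → ℝ} (hy : Integrable y) :
    fourierCoeff (fun θ => (y θ : ℂ)) m = ((2 * Real.pi)⁻¹ * 2⁻¹ : ℝ) *
      (((∫ θ, cas m θ * y θ) + ∫ θ, cas (-m) θ * y θ : ℝ) +
        ((∫ θ, cas (-m) θ * y θ) - ∫ θ, cas m θ * y θ : ℝ) * Complex.I) := by
  unfold fourierCoeff
  rw [AddCircle.integral_haarAddCircle]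
  have h1 : ∀ k, Integrable fun θ => cas k θ * y θ := fun k => integrable_cas_smul k hy
  have h2 : ∀ θ, fourier (-m) θ • (y θ : ℂ) = (2⁻¹ : ℝ) •
      ((cas m θ * y θ + cas (-m) θ * y θ : ℝ) +
        (cas (-m) θ * y θ - cas m θ * y θ : ℝ) * Complex.I) := by
    intro θ
    rw [fourier_neg, cas_neg]
    unfold cas
    apply Complex.ext <;> simp <;> ring
  simp_rw [h2]
  rw [integral_smul, integral_add ((h1 _).add (h1 _)).ofReal
    (((h1 _).sub (h1 _)).ofReal.mul_const _)]
  rw [integral_mul_const]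
  rw [← integral_add (h1 _) (h1 _), ← integral_sub (h1 _) (h1 _)]
  simp only [← integral_complex_ofReal]
  simp only [Complex.real_smul]
  push_cast
  ring

theorem norm_sq_fourierCoeff_ofReal (m : ℤ) {y : AddCircle (2 * Real.pi) → ℝ}
    (hy : Integrable y) :
    ‖fourierCoeff (fun θ => (y θ : ℂ)) m‖ ^ 2 = (2 * Real.pi)⁻¹ ^ 2 * 2⁻¹ *
      ((∫ θ, cas m θ * y θ) ^ 2 + (∫ θ, cas (-m) θ * y θ) ^ 2) := by
  rw [fourierCoeff_ofReal m hy, norm_mul, mul_pow, Complex.norm_real, Real.norm_eq_abs, sq_abs,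
    ← Complex.normSq_eq_norm_sq, Complex.normSq_add_mul_I]
  ring

theorem hasSum_sq_fourierCoeff_ofReal {y : AddCircle (2 * Real.pi) → ℝ} (hy : MemLp y 2) :
    HasSum (fun m => ‖fourierCoeff (fun θ => (y θ : ℂ)) m‖ ^ 2)
      ((2 * Real.pi)⁻¹ * ∫ θ, y θ ^ 2) := by
  have hY : MemLp (fun θ => (y θ : ℂ)) 2 AddCircle.haarAddCircle := hy.ofReal.haarAddCircle
  have h1 := hasSum_sq_fourierCoeff (MemLp.toLp _ hY)
  rw [fourierCoeff_congr_ae hY.coeFn_toLp] at h1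
  have h2 : ∫ t, ‖(MemLp.toLp _ hY : AddCircle (2 * Real.pi) → ℂ) t‖ ^ 2 ∂AddCircle.haarAddCircle =
      (2 * Real.pi)⁻¹ * ∫ θ, y θ ^ 2 := by
    refine Eq.trans ?_ (AddCircle.integral_haarAddCircle (f := fun θ => y θ ^ 2))
    refine integral_congr_ae ?_
    filter_upwards [hY.coeFn_toLp] with θ hθ
    rw [hθ, Complex.norm_real, Real.norm_eq_abs, sq_abs]
  rwa [h2] at h1

/-- In complex Parseval the squares for `m` and `-m` occur together, so each is counted twice and
the factor `2⁻¹` cancels. -/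
theorem lintegral_sq_eq_tsum_cas {y : AddCircle (2 * Real.pi) → ℝ} (hy : MemLp y 2) :
    ∫⁻ θ, ENNReal.ofReal (y θ ^ 2) =
      ENNReal.ofReal (2 * Real.pi)⁻¹ * ∑' m : ℤ, ENNReal.ofReal ((∫ θ, cas m θ * y θ) ^ 2) := by
  have hyi : Integrable y := hy.integrable (by norm_num)
  have h1 := hasSum_sq_fourierCoeff_ofReal hy
  simp_rw [norm_sq_fourierCoeff_ofReal _ hyi] at h1
  obtain ⟨a, ha⟩ : ∃ a : ℤ → ℝ, ∀ m, (∫ θ, cas m θ * y θ) = a m := ⟨_, fun m => rfl⟩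
  obtain ⟨I, hI⟩ : ∃ I : ℝ, ∫ θ, y θ ^ 2 = I := ⟨_, rfl⟩
  rw [← ofReal_integral_eq_lintegral_ofReal hy.integrable_sq (ae_of_all _ fun θ => sq_nonneg _), hI]
  simp_rw [ha, hI] at h1 ⊢
  have hpi : (2 * Real.pi)⁻¹ ^ 2 * 2⁻¹ ≠ 0 := by positivity
  have hs0 : Summable fun m : ℤ => a m ^ 2 + a (-m) ^ 2 := by
    have := h1.summable.mul_left ((2 * Real.pi)⁻¹ ^ 2 * 2⁻¹)⁻¹
    refine this.congr fun m => ?_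
    rw [inv_mul_cancel_left₀ hpi]
  have hs : Summable fun m => a m ^ 2 := Summable.of_nonneg_of_le (fun m => sq_nonneg _)
    (fun m => by nlinarith [sq_nonneg (a (-m))]) hs0
  have hs' : HasSum (fun m : ℤ => a (-m) ^ 2) (∑' m, a m ^ 2) :=
    (Equiv.neg ℤ).hasSum_iff (f := fun m => a m ^ 2) |>.2 hs.hasSum
  have h3 := (hs.hasSum.add hs').mul_left ((2 * Real.pi)⁻¹ ^ 2 * 2⁻¹)
  have h4 := h1.unique h3
  rw [← ENNReal.ofReal_tsum_of_nonneg (fun m => sq_nonneg _) hs, ← ENNReal.ofReal_mul (by positivity)]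
  congr 1
  have hp := Real.pi_pos
  generalize (∑' m, a m ^ 2) = S at h4
  field_simp at h4 ⊢
  linarith

theorem enorm_sq_eq_sum (v : Target n) : ‖v‖ₑ ^ 2 = ∑ j, ENNReal.ofReal (v j ^ 2) := by
  rw [← ofReal_norm, ← ENNReal.ofReal_pow (norm_nonneg _), EuclideanSpace.real_norm_sq_eq,
    ENNReal.ofReal_sum_of_nonneg fun j _ => sq_nonneg _]

/-- Parseval's identity in the basis `cas`. -/
theorem lintegral_enorm_sq_eq_tsum_casCoeff {x : AddCircle (2 * Real.pi) → Target n}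
    (hx : MemLp x 2) :
    ∫⁻ θ, ‖x θ‖ₑ ^ 2 = ENNReal.ofReal (2 * Real.pi)⁻¹ * ∑' m : ℤ, ‖casCoeff m x‖ₑ ^ 2 := by
  have hxi : Integrable x := hx.integrable (by norm_num)
  have hj : ∀ j, MemLp (fun θ => x θ j) 2 := fun j =>
    (EuclideanSpace.proj j : Target n →L[ℝ] ℝ).comp_memLp' hx
  simp_rw [enorm_sq_eq_sum, casCoeff_apply _ hxi]
  rw [lintegral_finsetSum' _ fun j _ => ?_]
  · simp_rw [lintegral_sq_eq_tsum_cas (hj _)]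
    rw [← Finset.mul_sum, Summable.tsum_finsetSum fun j _ => ENNReal.summable]
  · exact ((hj j).aestronglyMeasurable.aemeasurable.pow_const 2).ennreal_ofReal

theorem enorm_le_sum (v : Target n) : ‖v‖ₑ ≤ ∑ j, ‖v j‖ₑ := by
  have h : v = ∑ j, v j • EuclideanSpace.single j (1 : ℝ) := by
    ext i; simp [Finset.sum_apply, Pi.single_apply]
  calc ‖v‖ₑ = ‖∑ j, v j • EuclideanSpace.single j (1 : ℝ)‖ₑ := by rw [← h]
    _ ≤ ∑ j, ‖v j • EuclideanSpace.single j (1 : ℝ)‖ₑ := enorm_sum_le _ _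
    _ = _ := by
        refine Finset.sum_congr rfl fun j _ => ?_
        rw [enorm_smul, ← ofReal_norm (EuclideanSpace.single j (1 : ℝ)), PiLp.norm_single]
        simp

/-- A continuous map on the circle is bounded by the sum of its coefficients. -/
theorem enorm_le_tsum_casCoeff {x : AddCircle (2 * Real.pi) → Target n} (hx : Continuous x)
    (θ : AddCircle (2 * Real.pi)) : ‖x θ‖ₑ ≤ n * ∑' m : ℤ, ‖casCoeff m x‖ₑ := by
  have hxi : Integrable x := hx.integrable_of_hasCompactSupport (HasCompactSupport.of_compactSpace x)
  suffices h : ∀ j, ‖x θ j‖ₑ ≤ ∑' m : ℤ, ‖casCoeff m x‖ₑ by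
    refine (enorm_le_sum _).trans ((Finset.sum_le_sum fun j _ => h j).trans (le_of_eq ?_))
    simp
  intro j
  by_cases htop : ∑' m : ℤ, ‖casCoeff m x‖ₑ = ⊤
  · rw [htop]; exact le_top
  have hc : Continuous fun θ => (x θ j : ℂ) := by fun_prop
  let Y : C(AddCircle (2 * Real.pi), ℂ) := ⟨fun θ => (x θ j : ℂ), hc⟩
  have hyj : Integrable fun θ => x θ j := integrable_apply hxi j
  have hbd : ∀ m, ‖fourierCoeff Y m‖ ≤ 2⁻¹ * (‖casCoeff m x‖ + ‖casCoeff (-m) x‖) := by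
    intro m
    have e := norm_sq_fourierCoeff_ofReal m hyj
    rw [← casCoeff_apply m hxi, ← casCoeff_apply (-m) hxi] at e
    have h1 : (casCoeff m x j) ^ 2 ≤ ‖casCoeff m x‖ ^ 2 := by
      rw [← sq_abs, ← Real.norm_eq_abs]
      exact pow_le_pow_left₀ (norm_nonneg _) (PiLp.norm_apply_le _ j) 2
    have h2 : (casCoeff (-m) x j) ^ 2 ≤ ‖casCoeff (-m) x‖ ^ 2 := by
      rw [← sq_abs, ← Real.norm_eq_abs]
      exact pow_le_pow_left₀ (norm_nonneg _) (PiLp.norm_apply_le _ j) 2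
    have h3 : (2 * Real.pi)⁻¹ ^ 2 ≤ (2⁻¹ : ℝ) ^ 2 := by
      have := Real.pi_gt_three
      gcongr
      linarith
    have h4 : ‖fourierCoeff Y m‖ ^ 2 ≤ (2⁻¹ * (‖casCoeff m x‖ + ‖casCoeff (-m) x‖)) ^ 2 := by
      refine e.le.trans ?_
      have hA := norm_nonneg (casCoeff m x)
      have hB := norm_nonneg (casCoeff (-m) x)
      have h5 : (2 * Real.pi)⁻¹ ^ 2 * 2⁻¹ * (casCoeff m x j ^ 2 + casCoeff (-m) x j ^ 2) ≤
          2⁻¹ ^ 2 * 2⁻¹ * (‖casCoeff m x‖ ^ 2 + ‖casCoeff (-m) x‖ ^ 2) := by gcongr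
      nlinarith [mul_nonneg hA hB]
    exact le_of_sq_le_sq h4 (by positivity)
  have hsum : Summable fun m : ℤ => ‖casCoeff m x‖ := by
    have h6 : Summable fun m : ℤ => (‖casCoeff m x‖ₑ).toReal := ENNReal.summable_toReal htop
    simpa using h6
  have hsum' : Summable fun m : ℤ => ‖casCoeff (-m) x‖ := (Equiv.neg ℤ).summable_iff.2 hsum
  -- Summable coefficients of a continuous function make its Fourier series converge to it at every
  -- point, not just almost everywhere.
  have hF : Summable (fourierCoeff Y) :=
    Summable.of_norm_bounded ((hsum.add hsum').mul_left 2⁻¹) hbd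
  have hps := has_pointwise_sum_fourier_series_of_summable hF θ
  have h7 : ‖Y θ‖ ≤ ∑' m, ‖casCoeff m x‖ := by
    rw [← hps.tsum_eq]
    have hn : ∀ m, ‖fourierCoeff Y m • fourier m θ‖ = ‖fourierCoeff Y m‖ := fun m => by
      rw [norm_smul, norm_fourier_apply, mul_one]
    have hns : Summable fun m => ‖fourierCoeff Y m • fourier m θ‖ := by
      simp_rw [hn]; exact hF.norm
    refine (norm_tsum_le_tsum_norm hns).trans ?_
    simp_rw [hn]
    refine (hF.norm.tsum_le_tsum hbd ((hsum.add hsum').mul_left 2⁻¹)).trans (le_of_eq ?_)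
    rw [tsum_mul_left, hsum.tsum_add hsum']
    have : ∑' m : ℤ, ‖casCoeff (-m) x‖ = ∑' m : ℤ, ‖casCoeff m x‖ :=
      (Equiv.neg ℤ).tsum_eq fun m => ‖casCoeff m x‖
    rw [this]; ring
  have h8 : ‖x θ j‖ = ‖Y θ‖ := by simp [Y]
  rw [← ofReal_norm, h8]
  refine (ENNReal.ofReal_le_ofReal h7).trans (le_of_eq ?_)
  rw [ENNReal.ofReal_tsum_of_nonneg (fun m => norm_nonneg _) hsum]
  simp

/-- For merely integrable `y` Parseval is not available. Instead, the functional `ψ ↦ ∫ ψ y` on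
continuous functions is bounded and vanishes on trigonometric polynomials, hence everywhere by
density. The finite measures with densities `y⁺` and `y⁻` then have equal integrals of all bounded
continuous functions, so they agree. -/
theorem ae_eq_zero_of_integral_cas_eq_zero {y : AddCircle (2 * Real.pi) → ℝ} (hy : Integrable y)
    (h : ∀ m, ∫ θ, cas m θ * y θ = 0) : y =ᵐ[volume] 0 := by
  let Λ : C(AddCircle (2 * Real.pi), ℂ) →ₗ[ℂ] ℂ :=
    { toFun := fun ψ => ∫ θ, ψ θ * (y θ : ℂ)
      map_add' := fun ψ φ => by
        simp only [ContinuousMap.add_apply, add_mul]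
        exact integral_add (hy.ofReal.bdd_mul (c := ‖ψ‖) ψ.continuous.aestronglyMeasurable
          (ae_of_all _ ψ.norm_coe_le_norm)) (hy.ofReal.bdd_mul (c := ‖φ‖)
          φ.continuous.aestronglyMeasurable (ae_of_all _ φ.norm_coe_le_norm))
      map_smul' := fun c ψ => by
        simp only [ContinuousMap.smul_apply, smul_eq_mul, mul_assoc, RingHom.id_apply]
        exact integral_const_mul _ _ }
  have hΛ : ∀ ψ, ‖Λ ψ‖ ≤ (∫ θ, ‖y θ‖) * ‖ψ‖ := fun ψ => by
    calc ‖Λ ψ‖ ≤ ∫ θ, ‖ψ‖ * ‖y θ‖ := by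
          refine norm_integral_le_of_norm_le (hy.norm.const_mul _) (ae_of_all _ fun θ => ?_)
          rw [norm_mul, Complex.norm_real]
          exact mul_le_mul_of_nonneg_right (ψ.norm_coe_le_norm θ) (norm_nonneg _)
      _ = _ := by rw [integral_const_mul, mul_comm]
  let Λc := Λ.mkContinuous _ hΛ
  have hker : ∀ m, Λc (fourier m) = 0 := by
    intro m
    have h1 := fourierCoeff_ofReal (-m) hy
    rw [h, h] at h1
    unfold fourierCoeff at h1
    rw [AddCircle.integral_haarAddCircle] at h1
    simp only [neg_neg, smul_eq_mul] at h1
    have hp := Real.pi_pos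
    have h2 : ((2 * Real.pi)⁻¹ : ℝ) ≠ 0 := by positivity
    have h3 : (2 * Real.pi)⁻¹ • ∫ θ, fourier m θ * (y θ : ℂ) = 0 := by
      rw [h1]; simp
    exact (smul_eq_zero.1 h3).resolve_left h2
  have hall : ∀ ψ, Λc ψ = 0 := by
    have hcl : IsClosed {ψ | Λc ψ = 0} := isClosed_eq Λc.continuous continuous_const
    have hsub : Submodule.span ℂ (range (fourier (T := 2 * Real.pi))) ≤ LinearMap.ker Λc.toLinearMap := by
      rw [Submodule.span_le]
      rintro _ ⟨m, rfl⟩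
      exact hker m
    intro ψ
    have hmem : ψ ∈ (Submodule.span ℂ (range (fourier (T := 2 * Real.pi)))).topologicalClosure := by
      rw [span_fourier_closure_eq_top]; trivial
    exact closure_minimal (fun φ hφ => hsub hφ) hcl hmem
  have hreal : ∀ g : BoundedContinuousFunction (AddCircle (2 * Real.pi)) ℝ, ∫ θ, g θ * y θ = 0 := by
    intro g
    have h1 := hall ⟨fun θ => (g θ : ℂ), by fun_prop⟩
    have h2 : ∫ θ, ((g θ * y θ : ℝ) : ℂ) = 0 := by
      simpa [Λc, Λ] using h1
    rw [integral_complex_ofReal] at h2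
    exact_mod_cast h2
  have hpos : Integrable fun θ => max (y θ) 0 := hy.pos_part
  have hneg : Integrable fun θ => max (-y θ) 0 := hy.neg_part
  have hm1 : AEMeasurable (fun θ => ENNReal.ofReal (y θ)) := hy.aemeasurable.ennreal_ofReal
  have hm2 : AEMeasurable (fun θ => ENNReal.ofReal (-y θ)) := hy.aemeasurable.neg.ennreal_ofReal
  have hf1 : ∫⁻ θ, ENNReal.ofReal (y θ) ≠ ⊤ := hy.lintegral_lt_top.ne
  have hf2 : ∫⁻ θ, ENNReal.ofReal (-y θ) ≠ ⊤ := hy.neg.lintegral_lt_top.ne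
  have := isFiniteMeasure_withDensity (μ := (volume : Measure (AddCircle (2 * Real.pi)))) hf1
  have := isFiniteMeasure_withDensity (μ := (volume : Measure (AddCircle (2 * Real.pi)))) hf2
  have heq : volume.withDensity (fun θ => ENNReal.ofReal (y θ)) =
      volume.withDensity (fun θ => ENNReal.ofReal (-y θ)) := by
    refine ext_of_forall_integral_eq_of_IsFiniteMeasure fun g => ?_
    rw [integral_withDensity_eq_integral_toReal_smul₀ hm1 (ae_of_all _ fun θ => ENNReal.ofReal_lt_top),
      integral_withDensity_eq_integral_toReal_smul₀ hm2 (ae_of_all _ fun θ => ENNReal.ofReal_lt_top)]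
    simp only [ENNReal.toReal_ofReal', smul_eq_mul]
    have hb : ∀ z : AddCircle (2 * Real.pi) → ℝ, Integrable z → Integrable fun θ => z θ * g θ :=
      fun z hz => hz.mul_bdd (c := ‖g‖) g.continuous.aestronglyMeasurable
        (ae_of_all _ g.norm_coe_le_norm)
    rw [← sub_eq_zero, ← integral_sub (hb _ hpos) (hb _ hneg)]
    refine Eq.trans ?_ (hreal g)
    refine integral_congr_ae (ae_of_all _ fun θ => ?_)
    dsimp only
    rcases le_total 0 (y θ) with h | h
    · rw [max_eq_left h, max_eq_right (by linarith)]; ring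
    · rw [max_eq_right h, max_eq_left (by linarith)]; ring
  have h9 := (withDensity_eq_iff hm1 hm2 hf1).1 heq
  filter_upwards [h9] with θ hθ
  rcases le_total 0 (y θ) with h | h
  · rw [ENNReal.ofReal_of_nonpos (by linarith : -y θ ≤ 0), ENNReal.ofReal_eq_zero] at hθ
    exact le_antisymm hθ h
  · rw [ENNReal.ofReal_of_nonpos h, eq_comm, ENNReal.ofReal_eq_zero] at hθ
    exact le_antisymm h (neg_nonpos.1 hθ)

theorem ae_eq_zero_of_casCoeff_eq_zero {x : AddCircle (2 * Real.pi) → Target n}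
    (hx : Integrable x) (h : ∀ m, casCoeff m x = 0) : x =ᵐ[volume] 0 := by
  have hj : ∀ j, ∀ᵐ θ, x θ j = 0 := fun j =>
    ae_eq_zero_of_integral_cas_eq_zero (integrable_apply hx j) fun m => by
      rw [← casCoeff_apply m hx, h m]; rfl
  filter_upwards [ae_all_iff.2 hj] with θ hθ
  ext j
  exact hθ j

end WillmoreNeck
end

noncomputable section
namespace WillmoreNeck
variable {n : ℕ}

/-! ### Weak derivatives on cylinders -/

theorem isOpen_openCyl (a b : ℝ) : IsOpen (openCyl a b) := isOpen_Ioo.preimage continuous_snd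

theorem isCompact_closedCyl (a b : ℝ) : IsCompact (closedCyl a b) := by
  have h : closedCyl a b = univ ×ˢ Icc a b := by ext z; simp [closedCyl]
  rw [h]
  exact isCompact_univ.prod isCompact_Icc

theorem measurableSet_closedCyl (a b : ℝ) : MeasurableSet (closedCyl a b) :=
  (isCompact_closedCyl a b).measurableSet

theorem closedCyl_subset_openCyl {a b a' b' : ℝ} (ha : a < a') (hb : b' < b) :
    closedCyl a' b' ⊆ openCyl a b := fun _ hz => ⟨ha.trans_le hz.1, hz.2.trans_lt hb⟩

/-- Differentiation exchanges the indices `m` and `-m`, so a single family indexed by `ℤ` is closed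
under `∂/∂θ` and two derivatives give `-m²`. -/
theorem hasDerivAt_cas (m : ℤ) (θ : AddCircle (2 * Real.pi)) :
    HasDerivAt (fun s : ℝ => cas m (θ + (s : AddCircle (2 * Real.pi)))) (m * cas (-m) θ) 0 := by
  induction θ using QuotientAddGroup.induction_on with
  | H x =>
    have h1 : (fun s : ℝ => cas m (((x : ℝ) : AddCircle (2 * Real.pi)) + (s : AddCircle (2 * Real.pi))))
        = fun s : ℝ => Real.cos (m * (x + s)) + Real.sin (m * (x + s)) := by
      funext s
      rw [← AddCircle.coe_add, cas_coe]
    have h2 : cas (-m) ((x : ℝ) : AddCircle (2 * Real.pi)) = Real.cos (m * x) - Real.sin (m * x) := by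
      rw [cas_coe]; push_cast
      rw [neg_mul, Real.cos_neg, Real.sin_neg]; ring
    have h3 : HasDerivAt (fun s : ℝ => (m : ℝ) * (x + s)) (m * 1) 0 :=
      ((hasDerivAt_id (0 : ℝ)).const_add x).const_mul (m : ℝ)
    have h4 := h3.cos.add h3.sin
    change HasDerivAt (fun s : ℝ => cas m (((x : ℝ) : AddCircle (2 * Real.pi)) +
      (s : AddCircle (2 * Real.pi)))) (m * cas (-m) ((x : ℝ) : AddCircle (2 * Real.pi))) 0
    rw [h1, h2]
    refine h4.congr_deriv ?_
    simp; ring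

theorem tsupport_cas_mul_subset (m : ℤ) (ζ : ℝ → ℝ) :
    tsupport (fun z : Cylinder => cas m z.1 * ζ z.2) ⊆ univ ×ˢ tsupport ζ := by
  refine closure_minimal (fun z hz => ⟨mem_univ _, subset_tsupport _ ?_⟩)
    (isClosed_univ.prod (isClosed_tsupport ζ))
  exact right_ne_zero_of_mul hz

/-- Products of this form are the only test functions used on the cylinder: testing with them
reduces weak derivatives of a map to those of its coefficients on an interval. -/
theorem isTestFunction_cas_mul {a b : ℝ} (m : ℤ) {ζ : ℝ → ℝ} (hζ : ContDiff ℝ ∞ ζ)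
    (hc : HasCompactSupport ζ) (hs : tsupport ζ ⊆ Ioo a b) :
    IsTestFunction (openCyl a b) (fun z => cas m z.1 * ζ z.2) where
  smooth := by
    simp only [cas_coe]
    fun_prop
  compact := (isCompact_univ.prod hc).of_isClosed_subset (isClosed_tsupport _)
    (tsupport_cas_mul_subset m ζ)
  support_subset := fun z hz => hs (tsupport_cas_mul_subset m ζ hz).2

theorem classicalPartial_zero_cas_mul (m : ℤ) (ζ : ℝ → ℝ) (z : Cylinder) :
    classicalPartial 0 (fun z => cas m z.1 * ζ z.2) z = m * (cas (-m) z.1 * ζ z.2) := by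
  unfold classicalPartial step
  simp only [if_true, Prod.fst_add, Prod.snd_add, add_zero]
  rw [((hasDerivAt_cas m z.1).mul_const (ζ z.2)).deriv, mul_assoc]

theorem classicalPartial_one_cas_mul (m : ℤ) {ζ : ℝ → ℝ} (hζ : Differentiable ℝ ζ) (z : Cylinder) :
    classicalPartial 1 (fun z => cas m z.1 * ζ z.2) z = cas m z.1 * deriv ζ z.2 := by
  unfold classicalPartial step
  simp only [one_ne_zero, if_false, Prod.fst_add, Prod.snd_add, add_zero]
  have h : HasDerivAt (fun s : ℝ => ζ (z.2 + s)) (deriv ζ z.2) 0 := by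
    have h1 : HasDerivAt ζ (deriv ζ z.2) (z.2 + 0) := by rw [add_zero]; exact (hζ _).hasDerivAt
    simpa using h1.comp_const_add z.2 0
  rw [(h.const_mul (cas m z.1)).deriv]

/-- The `m`-th coefficient of `u` on the circle at height `t`. -/
def sliceCoeff (m : ℤ) (u : Cylinder → Target n) (t : ℝ) : Target n :=
  casCoeff m fun θ => u (θ, t)

theorem integrable_cas_mul_smul {a b : ℝ} (m : ℤ) {ζ : ℝ → ℝ} (hζ : Continuous ζ)
    (hc : HasCompactSupport ζ) (hs : tsupport ζ ⊆ Ioo a b) {u : Cylinder → Target n}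
    (hu : LocallyIntegrableOn u (openCyl a b)) :
    Integrable fun z : Cylinder => (cas m z.1 * ζ z.2) • u z := by
  have hK : IsCompact (univ ×ˢ tsupport ζ : Set Cylinder) := isCompact_univ.prod hc
  have hKU : (univ ×ˢ tsupport ζ : Set Cylinder) ⊆ openCyl a b := fun z hz => hs hz.2
  have h1 : IntegrableOn u (univ ×ˢ tsupport ζ) := hu.integrableOn_compact_subset hKU hK
  have hcont : Continuous fun z : Cylinder => cas m z.1 * ζ z.2 := by
    have := continuous_cas m
    fun_prop
  have h2 : IntegrableOn (fun z : Cylinder => (cas m z.1 * ζ z.2) • u z) (univ ×ˢ tsupport ζ) :=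
    h1.continuousOn_smul hcont.continuousOn hK
  refine (integrableOn_iff_integrable_of_support_subset fun z hz => ?_).1 h2
  refine ⟨mem_univ _, subset_tsupport _ ?_⟩
  exact right_ne_zero_of_mul (left_ne_zero_of_smul hz)

theorem integral_cas_mul_smul {a b : ℝ} (m : ℤ) {ζ : ℝ → ℝ} (hζ : Continuous ζ)
    (hc : HasCompactSupport ζ) (hs : tsupport ζ ⊆ Ioo a b) {u : Cylinder → Target n}
    (hu : LocallyIntegrableOn u (openCyl a b)) :
    Integrable (fun t => ζ t • sliceCoeff m u t) ∧
    ∫ z : Cylinder, (cas m z.1 * ζ z.2) • u z = ∫ t, ζ t • sliceCoeff m u t := by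
  have hi := integrable_cas_mul_smul m hζ hc hs hu
  have e : ∀ t, ∫ θ, (cas m θ * ζ t) • u (θ, t) = ζ t • sliceCoeff m u t := by
    intro t
    unfold sliceCoeff casCoeff
    rw [← integral_smul]
    refine integral_congr_ae (ae_of_all _ fun θ => ?_)
    dsimp only
    rw [smul_smul, mul_comm]
  rw [Measure.volume_eq_prod] at hi ⊢
  constructor
  · have := hi.integral_prod_right
    simpa only [e] using this
  · rw [integral_prod_symm _ hi]
    simp only [e]

theorem ae_integrable_slice {a b : ℝ} {u : Cylinder → Target n}
    (hu : LocallyIntegrableOn u (openCyl a b)) :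
    ∀ᵐ t, t ∈ Ioo a b → Integrable fun θ => u (θ, t) := by
  have h : ∀ k : ℕ, ∀ᵐ t, t ∈ Icc (a + 1 / (k + 1)) (b - 1 / (k + 1)) →
      Integrable fun θ => u (θ, t) := by
    intro k
    have hpos : (0 : ℝ) < 1 / (k + 1) := by positivity
    have h1 : IntegrableOn u (closedCyl (a + 1 / (k + 1)) (b - 1 / (k + 1))) :=
      hu.integrableOn_compact_subset (closedCyl_subset_openCyl (by linarith) (by linarith))
        (isCompact_closedCyl _ _)
    have h2 := h1.integrable_indicator (measurableSet_closedCyl _ _)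
    rw [Measure.volume_eq_prod] at h2
    filter_upwards [h2.prod_left_ae] with t ht htm
    refine ht.congr (ae_of_all _ fun θ => ?_)
    exact indicator_of_mem (show (θ, t) ∈ closedCyl _ _ from htm) u
  filter_upwards [ae_all_iff.2 h] with t ht htm
  obtain ⟨k, hk⟩ := exists_nat_one_div_lt (lt_min (sub_pos.2 htm.1) (sub_pos.2 htm.2))
  have h1 := hk.trans_le (min_le_left _ _)
  have h2 := hk.trans_le (min_le_right _ _)
  exact ht k ⟨by linarith, by linarith⟩

theorem locallyIntegrableOn_sliceCoeff {a b : ℝ} (m : ℤ) {u : Cylinder → Target n}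
    (hu : LocallyIntegrableOn u (openCyl a b)) :
    LocallyIntegrableOn (sliceCoeff m u) (Ioo a b) := by
  rw [locallyIntegrableOn_iff isOpen_Ioo.isLocallyClosed]
  intro K hK hKc
  have hKm : MeasurableSet K := hKc.measurableSet
  have hKK : IsCompact (univ ×ˢ K : Set Cylinder) := isCompact_univ.prod hKc
  have h1 : IntegrableOn u (univ ×ˢ K) :=
    hu.integrableOn_compact_subset (fun z hz => hK hz.2) hKK
  have hcont : Continuous fun z : Cylinder => cas m z.1 := by
    have := continuous_cas m
    fun_prop
  have h2 : IntegrableOn (fun z : Cylinder => cas m z.1 • u z) (univ ×ˢ K) :=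
    h1.continuousOn_smul hcont.continuousOn hKK
  unfold IntegrableOn at h2
  rw [Measure.volume_eq_prod, ← Measure.prod_restrict, Measure.restrict_univ] at h2
  exact h2.integral_prod_right

theorem HasWeakPartial.slice_one {a b : ℝ} {u v : Cylinder → Target n}
    (h : HasWeakPartial (openCyl a b) 1 u v) (m : ℤ) {ζ : ℝ → ℝ} (hζ : ContDiff ℝ ∞ ζ)
    (hc : HasCompactSupport ζ) (hs : tsupport ζ ⊆ Ioo a b) :
    ∫ t, deriv ζ t • sliceCoeff m u t = -∫ t, ζ t • sliceCoeff m v t := by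
  have h1 := h.integral_eq _ (isTestFunction_cas_mul m hζ hc hs)
  simp only [classicalPartial_one_cas_mul m (hζ.differentiable (by simp))] at h1
  rw [(integral_cas_mul_smul m hζ.continuous hc hs h.locInt_right).2,
    (integral_cas_mul_smul m (hζ.continuous_deriv (by simp)) hc.deriv
      ((tsupport_deriv_subset).trans hs) h.locInt_left).2] at h1
  exact h1

theorem HasWeakPartial.slice_zero {a b : ℝ} {u v : Cylinder → Target n}
    (h : HasWeakPartial (openCyl a b) 0 u v) (m : ℤ) {ζ : ℝ → ℝ} (hζ : ContDiff ℝ ∞ ζ)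
    (hc : HasCompactSupport ζ) (hs : tsupport ζ ⊆ Ioo a b) :
    (m : ℝ) • ∫ t, ζ t • sliceCoeff (-m) u t = -∫ t, ζ t • sliceCoeff m v t := by
  have h1 := h.integral_eq _ (isTestFunction_cas_mul m hζ hc hs)
  simp only [classicalPartial_zero_cas_mul] at h1
  simp_rw [mul_smul (m : ℝ)] at h1
  rw [integral_smul, (integral_cas_mul_smul m hζ.continuous hc hs h.locInt_right).2,
    (integral_cas_mul_smul (-m) hζ.continuous hc hs h.locInt_left).2] at h1
  exact h1

/-- The angular weak derivative on almost every circle. -/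
theorem HasWeakPartial.ae_sliceCoeff_zero {a b : ℝ} {u v : Cylinder → Target n}
    (h : HasWeakPartial (openCyl a b) 0 u v) :
    ∀ᵐ t, t ∈ Ioo a b → ∀ m : ℤ, sliceCoeff m v t = -((m : ℝ) • sliceCoeff (-m) u t) := by
  have h1 : ∀ m : ℤ, ∀ᵐ t, t ∈ Ioo a b →
      (sliceCoeff m v t + (m : ℝ) • sliceCoeff (-m) u t) = 0 := by
    intro m
    have hv := locallyIntegrableOn_sliceCoeff m h.locInt_right
    have hu := (locallyIntegrableOn_sliceCoeff (-m) h.locInt_left).smul (m : ℝ)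
    refine isOpen_Ioo.ae_eq_zero_of_integral_contDiff_smul_eq_zero (hv.add hu) ?_
    intro ζ hζ hc hs
    have e1 := (integral_cas_mul_smul m hζ.continuous hc hs h.locInt_right).1
    have e2 := (integral_cas_mul_smul (-m) hζ.continuous hc hs h.locInt_left).1
    have e2' : Integrable fun t => (m : ℝ) • (ζ t • sliceCoeff (-m) u t) := e2.smul (m : ℝ)
    have e3 : ∀ t, ζ t • (sliceCoeff m v t + (m : ℝ) • sliceCoeff (-m) u t) =
        ζ t • sliceCoeff m v t + (m : ℝ) • (ζ t • sliceCoeff (-m) u t) := by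
      intro t
      rw [smul_add, smul_comm]
    change ∫ t, ζ t • (sliceCoeff m v t + (m : ℝ) • sliceCoeff (-m) u t) = 0
    simp_rw [e3]
    rw [integral_add e1 e2', integral_smul, h.slice_zero m hζ hc hs]
    simp
  filter_upwards [ae_all_iff.2 h1] with t ht htm m
  exact eq_neg_of_add_eq_zero_left (ht m htm)

theorem ae_of_ae_slice {a b : ℝ} {d : Cylinder → Target n}
    (hd : AEStronglyMeasurable d (volume.restrict (openCyl a b)))
    (h : ∀ᵐ t, t ∈ Ioo a b → ∀ᵐ θ, d (θ, t) = 0) : ∀ᵐ z ∂volume.restrict (openCyl a b), d z = 0 := by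
  have hU : openCyl a b = univ ×ˢ Ioo a b := by ext z; simp [openCyl]
  have hm : (volume : Measure Cylinder).restrict (openCyl a b) =
      (volume : Measure (AddCircle (2 * Real.pi))).prod (volume.restrict (Ioo a b)) := by
    rw [hU, Measure.volume_eq_prod, ← Measure.prod_restrict, Measure.restrict_univ]
  rw [hm] at hd ⊢
  have h1 : ∫⁻ z, ‖d z‖ₑ ∂(volume : Measure (AddCircle (2 * Real.pi))).prod (volume.restrict (Ioo a b))
      = 0 := by
    rw [lintegral_prod_symm _ hd.enorm]
    have : ∀ᵐ t ∂(volume.restrict (Ioo a b)), ∫⁻ θ, ‖d (θ, t)‖ₑ = 0 := by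
      rw [ae_restrict_iff' measurableSet_Ioo]
      filter_upwards [h] with t ht htm
      rw [lintegral_congr_ae (g := fun _ => 0) (by
        filter_upwards [ht htm] with θ hθ
        rw [hθ, enorm_zero])]
      simp
    rw [lintegral_congr_ae this]
    simp
  rw [lintegral_eq_zero_iff' hd.enorm] at h1
  filter_upwards [h1] with z hz
  simpa using hz

/-- Product test functions show that every coefficient of `v - v'` vanishes for almost every `t`;
completeness on the circle and Fubini finish. Since `weakPartial` is an arbitrary choice, all later
identities for it depend on this. -/
theorem HasWeakPartial.ae_unique {a b : ℝ} {i : Fin 2} {u v v' : Cylinder → Target n}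
    (h : HasWeakPartial (openCyl a b) i u v) (h' : HasWeakPartial (openCyl a b) i u v') :
    v =ᵐ[volume.restrict (openCyl a b)] v' := by
  have hd : LocallyIntegrableOn (v - v') (openCyl a b) := h.locInt_right.sub h'.locInt_right
  have hz : ∀ m : ℤ, ∀ᵐ t, t ∈ Ioo a b → sliceCoeff m (v - v') t = 0 := by
    intro m
    refine isOpen_Ioo.ae_eq_zero_of_integral_contDiff_smul_eq_zero
      (locallyIntegrableOn_sliceCoeff m hd) ?_
    intro ζ hζ hc hs
    rw [← (integral_cas_mul_smul m hζ.continuous hc hs hd).2]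
    have e1 := h.integral_eq _ (isTestFunction_cas_mul m hζ hc hs)
    have e2 := h'.integral_eq _ (isTestFunction_cas_mul m hζ hc hs)
    simp only [Pi.sub_apply, smul_sub]
    rw [integral_sub (integrable_cas_mul_smul m hζ.continuous hc hs h.locInt_right)
      (integrable_cas_mul_smul m hζ.continuous hc hs h'.locInt_right), sub_eq_zero]
    exact neg_injective (e1.symm.trans e2)
  have h2 : ∀ᵐ z ∂volume.restrict (openCyl a b), (v - v') z = 0 := by
    refine ae_of_ae_slice hd.aestronglyMeasurable ?_
    filter_upwards [ae_all_iff.2 hz, ae_integrable_slice hd] with t ht hti htm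
    exact ae_eq_zero_of_casCoeff_eq_zero (hti htm) fun m => ht m htm
  filter_upwards [h2] with z hz
  exact sub_eq_zero.1 hz

theorem classicalPartial_eq_zero (i : Fin 2) {φ : Cylinder → ℝ} {z : Cylinder}
    (hz : z ∉ tsupport φ) : classicalPartial i φ z = 0 := by
  have hcont : Continuous fun s : ℝ => z + step i s := by
    unfold step
    split_ifs
    · exact continuous_const.add ((AddCircle.continuous_mk' _).prodMk continuous_const)
    · exact continuous_const.add (continuous_const.prodMk continuous_id)
  have h0 : z + step i 0 = z := by
    unfold step
    split_ifs <;> ext <;> simp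
  have hev : (fun s : ℝ => φ (z + step i s)) =ᶠ[𝓝 0] fun _ => (0 : ℝ) := by
    have h1 : ∀ᶠ w in 𝓝 (z + step i 0), φ w = 0 := by
      rw [h0]; exact notMem_tsupport_iff_eventuallyEq.1 hz
    exact hcont.continuousAt.eventually h1
  unfold classicalPartial
  rw [hev.deriv_eq, deriv_const]

theorem HasWeakPartial.congr {U : Set Cylinder} (hU : MeasurableSet U) {i : Fin 2}
    {u u' v v' : Cylinder → Target n} (h : HasWeakPartial U i u v)
    (hu : u =ᵐ[volume.restrict U] u') (hv : v =ᵐ[volume.restrict U] v') :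
    HasWeakPartial U i u' v' := by
  rw [Filter.EventuallyEq, ae_restrict_iff' hU] at hu hv
  have hloc : ∀ {w w' : Cylinder → Target n}, (∀ᵐ z, z ∈ U → w z = w' z) →
      LocallyIntegrableOn w U → LocallyIntegrableOn w' U := by
    intro w w' hw hl z hz
    obtain ⟨s, hs, hsi⟩ := hl z hz
    refine ⟨s ∩ U, inter_mem hs self_mem_nhdsWithin, ?_⟩
    refine (hsi.mono_set inter_subset_left).congr ?_
    have h1 : ∀ᵐ z ∂volume.restrict U, w z = w' z := (ae_restrict_iff' hU).2 hw
    exact ae_mono (Measure.restrict_mono inter_subset_right le_rfl) h1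
  refine ⟨hloc hu h.locInt_left, hloc hv h.locInt_right, fun φ hφ => ?_⟩
  have e1 : ∫ z, classicalPartial i φ z • u' z = ∫ z, classicalPartial i φ z • u z := by
    refine integral_congr_ae ?_
    filter_upwards [hu] with z hz
    by_cases hm : z ∈ tsupport φ
    · rw [hz (hφ.support_subset hm)]
    · rw [classicalPartial_eq_zero i hm]; simp
  have e2 : ∫ z, φ z • v' z = ∫ z, φ z • v z := by
    refine integral_congr_ae ?_
    filter_upwards [hv] with z hz
    by_cases hm : z ∈ tsupport φ
    · rw [hz (hφ.support_subset hm)]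
    · rw [image_eq_zero_of_notMem_tsupport hm]; simp
  rw [e1, e2]
  exact h.integral_eq φ hφ

theorem hasWeakPartial_weakPartial {U : Set Cylinder} {i : Fin 2} {u v : Cylinder → Target n}
    (h : HasWeakPartial U i u v) : HasWeakPartial U i u (weakPartial U i u) := by
  have hex : ∃ v, HasWeakPartial U i u v := ⟨v, h⟩
  unfold weakPartial
  rw [dif_pos hex]
  exact hex.choose_spec

theorem MemLpLoc.congr {U : Set Cylinder} {p : ℝ} {u v : Cylinder → Target n}
    (h : MemLpLoc U p u) (huv : u =ᵐ[volume.restrict U] v) : MemLpLoc U p v := fun K hK hKU =>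
  (memLp_congr_ae (ae_mono (Measure.restrict_mono hKU le_rfl) huv)).1 (h K hK hKU)

/-- The weak derivatives selected by `weakPartial` have the properties postulated in
`MemW2pLoc`. -/
theorem MemW2pLoc.weakPartial_spec {a b p : ℝ} {f : Cylinder → Target n}
    (h : MemW2pLoc (openCyl a b) p f) (i : Fin 2) :
    HasWeakPartial (openCyl a b) i f (weakPartial (openCyl a b) i f) ∧
    MemLpLoc (openCyl a b) p (weakPartial (openCyl a b) i f) ∧
    ∀ j, HasWeakPartial (openCyl a b) j (weakPartial (openCyl a b) i f)
        (weakPartial (openCyl a b) j (weakPartial (openCyl a b) i f)) ∧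
      MemLpLoc (openCyl a b) p (weakPartial (openCyl a b) j (weakPartial (openCyl a b) i f)) := by
  obtain ⟨v, hv, hvp, hw⟩ := h.2 i
  have hwp := hasWeakPartial_weakPartial hv
  have hae := hv.ae_unique hwp
  refine ⟨hwp, hvp.congr hae, fun j => ?_⟩
  obtain ⟨w, hw, hwlp⟩ := hw j
  have h1 := hw.congr (isOpen_openCyl a b).measurableSet hae (ae_eq_refl w)
  have h2 := hasWeakPartial_weakPartial h1
  exact ⟨h2, hwlp.congr (h1.ae_unique h2)⟩

theorem sliceCoeff_add {a b : ℝ} {u v : Cylinder → Target n}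
    (hu : LocallyIntegrableOn u (openCyl a b)) (hv : LocallyIntegrableOn v (openCyl a b)) :
    ∀ᵐ t, t ∈ Ioo a b → ∀ m, sliceCoeff m (fun z => u z + v z) t =
      sliceCoeff m u t + sliceCoeff m v t := by
  filter_upwards [ae_integrable_slice hu, ae_integrable_slice hv] with t h1 h2 ht m
  unfold sliceCoeff casCoeff
  simp only [smul_add]
  exact integral_add (integrable_cas_smul m (h1 ht)) (integrable_cas_smul m (h2 ht))

/-- The equation satisfied by the coefficients: `u_m'' - m² u_m` is the coefficient of `Δf`. -/
theorem integral_sliceCoeff_laplacian {a b p : ℝ} {f : Cylinder → Target n}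
    (h : MemW2pLoc (openCyl a b) p f) (m : ℤ) {ζ : ℝ → ℝ} (hζ : ContDiff ℝ ∞ ζ)
    (hc : HasCompactSupport ζ) (hs : tsupport ζ ⊆ Ioo a b) :
    ∫ t, (deriv (deriv ζ) t - m ^ 2 * ζ t) • sliceCoeff m f t =
      ∫ t, ζ t • sliceCoeff m (laplacian (openCyl a b) f) t := by
  obtain ⟨hv0, -, hw0⟩ := h.weakPartial_spec 0
  obtain ⟨hv1, -, hw1⟩ := h.weakPartial_spec 1
  have hζ' : ContDiff ℝ ∞ (deriv ζ) := (contDiff_infty_iff_deriv.1 hζ).2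
  have hs' : tsupport (deriv ζ) ⊆ Ioo a b := tsupport_deriv_subset.trans hs
  have hs'' : tsupport (deriv (deriv ζ)) ⊆ Ioo a b := tsupport_deriv_subset.trans hs'
  have hfloc := hv0.locInt_left
  have e1 := hv1.slice_one m hζ' hc.deriv hs'
  have e2 := (hw1 1).1.slice_one m hζ hc hs
  have e3 := (hw0 0).1.slice_zero m hζ hc hs
  have e4 := hv0.slice_zero (-m) hζ hc hs
  rw [neg_neg] at e4
  have i1 := (integral_cas_mul_smul m (hζ'.continuous_deriv (by simp)) hc.deriv.deriv hs'' hfloc).1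
  have i2 := (integral_cas_mul_smul m hζ.continuous hc hs hfloc).1
  have i3 := (integral_cas_mul_smul m hζ.continuous hc hs (hw0 0).1.locInt_right).1
  have i4 := (integral_cas_mul_smul m hζ.continuous hc hs (hw1 1).1.locInt_right).1
  have e5 : ∫ t, ζ t • sliceCoeff m (laplacian (openCyl a b) f) t =
      ∫ t, (ζ t • sliceCoeff m (weakPartial (openCyl a b) 0 (weakPartial (openCyl a b) 0 f)) t +
        ζ t • sliceCoeff m (weakPartial (openCyl a b) 1 (weakPartial (openCyl a b) 1 f)) t) := by
    refine integral_congr_ae ?_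
    filter_upwards [sliceCoeff_add (hw0 0).1.locInt_right (hw1 1).1.locInt_right] with t ht
    by_cases htm : t ∈ Ioo a b
    · rw [← smul_add, ← ht htm m]
      unfold laplacian
      simp only [Fin.sum_univ_two]
    · rw [image_eq_zero_of_notMem_tsupport fun hh => htm (hs hh)]; simp
  rw [e5, integral_add i3 i4]
  simp_rw [sub_smul, mul_smul]
  have i2' : Integrable fun t => (m : ℝ) ^ 2 • (ζ t • sliceCoeff m f t) := i2.smul ((m : ℝ) ^ 2)
  rw [integral_sub i1 i2', integral_smul, e1, e2]
  -- The two angular derivatives pass through the index `-m` and back; `e3` carries the factor `m`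
  -- and `e4` the factor `-m`.
  have e6 : ((m : ℝ) ^ 2) • ∫ t, ζ t • sliceCoeff m f t =
      -∫ t, ζ t • sliceCoeff m (weakPartial (openCyl a b) 0 (weakPartial (openCyl a b) 0 f)) t := by
    rw [← e3]
    have : ∫ t, ζ t • sliceCoeff (-m) (weakPartial (openCyl a b) 0 f) t =
        (m : ℝ) • ∫ t, ζ t • sliceCoeff m f t := by
      rw [← neg_injective.eq_iff, ← e4]; push_cast; rw [neg_smul]
    rw [this, smul_smul, sq]
  rw [e6]
  abel

end WillmoreNeck
end

noncomputable section
namespace WillmoreNeck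
variable {n : ℕ}

/-! ### A Green function estimate for `u'' - μ² u` -/

/-- A smooth approximation of the Green function of `-d²/dt² + μ²`. -/
def green (μ ε t : ℝ) : ℝ := Real.exp (-μ * √(t ^ 2 + ε ^ 2)) / (2 * μ)

/-- The derivative of `green`. -/
def greenDeriv (μ ε t : ℝ) : ℝ :=
  -(1 / 2) * (t / √(t ^ 2 + ε ^ 2)) * Real.exp (-μ * √(t ^ 2 + ε ^ 2))

/-- The approximation of the Dirac mass produced by `green`. -/
def greenDelta (μ ε t : ℝ) : ℝ :=
  1 / 2 * Real.exp (-μ * √(t ^ 2 + ε ^ 2)) *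
    (μ * (ε ^ 2 / (t ^ 2 + ε ^ 2)) + ε ^ 2 / ((t ^ 2 + ε ^ 2) * √(t ^ 2 + ε ^ 2)))

theorem hasDerivAt_sqrt_sq_add {ε : ℝ} (hε : 0 < ε) (t : ℝ) :
    HasDerivAt (fun t : ℝ => √(t ^ 2 + ε ^ 2)) (t / √(t ^ 2 + ε ^ 2)) t := by
  have hpos : 0 < t ^ 2 + ε ^ 2 := by positivity
  have h1 : HasDerivAt (fun t : ℝ => t ^ 2 + ε ^ 2) (2 * t) t := by
    simpa using (hasDerivAt_pow 2 t).add_const (ε ^ 2)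
  refine (h1.sqrt hpos.ne').congr_deriv ?_
  field_simp

theorem hasDerivAt_green {μ ε : ℝ} (hμ : 0 < μ) (hε : 0 < ε) (t : ℝ) :
    HasDerivAt (green μ ε) (greenDeriv μ ε t) t := by
  have h := (((hasDerivAt_sqrt_sq_add hε t).const_mul (-μ)).exp).div_const (2 * μ)
  refine h.congr_deriv ?_
  unfold greenDeriv
  field_simp

/-- Replacing `|t|` by `√(t² + ε²)` makes the Green function smooth, hence usable as a factor of a
test function. The price is that the Dirac mass becomes the explicit nonnegative bump `greenDelta`.
-/
theorem hasDerivAt_greenDeriv {μ ε : ℝ} (hε : 0 < ε) (t : ℝ) :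
    HasDerivAt (greenDeriv μ ε) (μ ^ 2 * green μ ε t - greenDelta μ ε t) t := by
  have hpos : 0 < t ^ 2 + ε ^ 2 := by positivity
  have hs : 0 < √(t ^ 2 + ε ^ 2) := Real.sqrt_pos.2 hpos
  have hsq : √(t ^ 2 + ε ^ 2) ^ 2 = t ^ 2 + ε ^ 2 := Real.sq_sqrt hpos.le
  have h0 := hasDerivAt_sqrt_sq_add hε t
  have h1 := ((hasDerivAt_id t).div h0 hs.ne').const_mul (-(1 / 2))
  have h2 := h1.mul ((h0.const_mul (-μ)).exp)
  refine h2.congr_deriv ?_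
  unfold green greenDelta
  simp only [id, Pi.div_apply]
  rw [← hsq]
  have hε2 : ε ^ 2 = √(t ^ 2 + ε ^ 2) ^ 2 - t ^ 2 := by rw [hsq]; ring
  generalize √(t ^ 2 + ε ^ 2) = s at *
  have hss : √(s ^ 2) = s := Real.sqrt_sq hs.le
  rw [hss, hε2]
  field_simp
  ring

theorem contDiff_green {μ ε : ℝ} (hε : 0 < ε) : ContDiff ℝ ∞ (green μ ε) := by
  unfold green
  have h : ContDiff ℝ ∞ fun t : ℝ => √(t ^ 2 + ε ^ 2) :=
    ContDiff.sqrt (by fun_prop) fun t => by positivity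
  fun_prop

theorem abs_le_sqrt_sq_add (ε t : ℝ) : |t| ≤ √(t ^ 2 + ε ^ 2) :=
  Real.abs_le_sqrt (by nlinarith [sq_nonneg ε])

theorem abs_green_le {μ : ℝ} (hμ : 0 < μ) (ε t : ℝ) :
    |green μ ε t| ≤ Real.exp (-μ * |t|) / (2 * μ) := by
  unfold green
  rw [abs_of_nonneg (by positivity)]
  have := abs_le_sqrt_sq_add ε t
  exact div_le_div_of_nonneg_right (Real.exp_le_exp.2 (by nlinarith)) (by positivity)

theorem abs_greenDeriv_le {μ : ℝ} (hμ : 0 < μ) {ε : ℝ} (hε : 0 < ε) (t : ℝ) :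
    |greenDeriv μ ε t| ≤ 1 / 2 * Real.exp (-μ * |t|) := by
  have hs : 0 < √(t ^ 2 + ε ^ 2) := Real.sqrt_pos.2 (by positivity)
  have h := abs_le_sqrt_sq_add ε t
  unfold greenDeriv
  rw [abs_mul, abs_mul, abs_of_pos (Real.exp_pos _), abs_neg, abs_of_pos (by norm_num : (0:ℝ) < 1 / 2),
    abs_div, abs_of_pos hs]
  have h1 : |t| / √(t ^ 2 + ε ^ 2) ≤ 1 := (div_le_one hs).2 h
  calc 1 / 2 * (|t| / √(t ^ 2 + ε ^ 2)) * Real.exp (-μ * √(t ^ 2 + ε ^ 2))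
      ≤ 1 / 2 * 1 * Real.exp (-μ * |t|) := by
        gcongr ?_ * ?_ * Real.exp ?_
        nlinarith
    _ = _ := by ring

theorem integrable_inv_mul_sqrt_inv :
    Integrable fun x : ℝ => (1 + x ^ 2)⁻¹ * (√(1 + x ^ 2))⁻¹ := by
  refine Integrable.mono' integrable_inv_one_add_sq ?_ (ae_of_all _ fun x => ?_)
  · have : Continuous fun x : ℝ => (1 + x ^ 2)⁻¹ * (√(1 + x ^ 2))⁻¹ := by
      refine Continuous.mul (Continuous.inv₀ (by fun_prop) fun x => by positivity)
        (Continuous.inv₀ (by fun_prop) fun x => (Real.sqrt_pos.2 (by positivity)).ne')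
    exact this.aestronglyMeasurable
  · rw [Real.norm_of_nonneg (by positivity)]
    refine mul_le_of_le_one_right (by positivity) (inv_le_one_of_one_le₀ ?_)
    rw [Real.one_le_sqrt]
    nlinarith [sq_nonneg x]

/-- The antiderivative is `sin ∘ arctan`. The value `2` matches the factor `1/2` in `greenDelta`,
giving unit mass in the limit. -/
theorem integral_inv_mul_sqrt_inv : ∫ x : ℝ, (1 + x ^ 2)⁻¹ * (√(1 + x ^ 2))⁻¹ = 2 := by
  have hd : ∀ x, HasDerivAt (fun x => Real.sin (Real.arctan x))
      ((1 + x ^ 2)⁻¹ * (√(1 + x ^ 2))⁻¹) x := by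
    intro x
    refine ((Real.hasDerivAt_arctan x).sin).congr_deriv ?_
    rw [Real.cos_arctan]; ring
  have h1 : Tendsto (fun x => Real.sin (Real.arctan x)) atBot (𝓝 (-1)) := by
    have := (Real.continuous_sin.tendsto _).comp
      (Real.tendsto_arctan_atBot.mono_right nhdsWithin_le_nhds)
    simpa [Function.comp_def] using this
  have h2 : Tendsto (fun x => Real.sin (Real.arctan x)) atTop (𝓝 1) := by
    have := (Real.continuous_sin.tendsto _).comp
      (Real.tendsto_arctan_atTop.mono_right nhdsWithin_le_nhds)
    simpa [Function.comp_def] using this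
  rw [integral_of_hasDerivAt_of_tendsto hd integrable_inv_mul_sqrt_inv h1 h2]
  norm_num

theorem greenDelta_mul {μ ε : ℝ} (hε : 0 < ε) (x : ℝ) :
    ε * greenDelta μ ε (ε * x) = 1 / 2 * Real.exp (-μ * (ε * √(1 + x ^ 2))) *
      (μ * ε * (1 + x ^ 2)⁻¹ + (1 + x ^ 2)⁻¹ * (√(1 + x ^ 2))⁻¹) := by
  have e : (ε * x) ^ 2 + ε ^ 2 = ε ^ 2 * (1 + x ^ 2) := by ring
  have hs : 0 < √(1 + x ^ 2) := Real.sqrt_pos.2 (by positivity)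
  unfold greenDelta
  rw [e, Real.sqrt_mul (by positivity), Real.sqrt_sq hε.le]
  have h1 : 0 < 1 + x ^ 2 := by positivity
  field_simp

/-- After `t = ε x` the second summand of `greenDelta` tends to a fixed density of mass one, while
the first keeps a factor `ε`. For `ε ≤ 1` both are dominated by a multiple of `(1 + x²)⁻¹`. -/
theorem tendsto_integral_greenDelta {μ : ℝ} (hμ : 0 < μ) {Φ : ℝ → Target n} (hΦ : Continuous Φ)
    {M : ℝ} (hM : ∀ t, ‖Φ t‖ ≤ M) :
    Tendsto (fun ε => ∫ t, greenDelta μ ε t • Φ t) (𝓝[>] 0) (𝓝 (Φ 0)) := by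
  have hM0 : 0 ≤ M := (norm_nonneg _).trans (hM 0)
  let F : ℝ → ℝ → Target n := fun ε x => (1 / 2 * Real.exp (-μ * (ε * √(1 + x ^ 2))) *
      (μ * ε * (1 + x ^ 2)⁻¹ + (1 + x ^ 2)⁻¹ * (√(1 + x ^ 2))⁻¹)) • Φ (ε * x)
  have e1 : ∀ᶠ ε in 𝓝[>] (0 : ℝ), ∫ x, F ε x = ∫ t, greenDelta μ ε t • Φ t := by
    filter_upwards [self_mem_nhdsWithin] with ε hε
    have hε' : 0 < ε := hε
    have h1 := Measure.integral_comp_mul_left (fun t => greenDelta μ ε t • Φ t) ε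
    have h2 : ∀ x, F ε x = ε • (greenDelta μ ε (ε * x) • Φ (ε * x)) := by
      intro x
      rw [smul_smul, greenDelta_mul hε']
    simp_rw [h2]
    rw [integral_smul, h1, abs_of_pos (inv_pos.2 hε'), smul_smul, mul_inv_cancel₀ hε'.ne', one_smul]
  refine Tendsto.congr' e1 ?_
  have e2 : Φ 0 = ∫ x : ℝ, ((1 / 2) * ((1 + x ^ 2)⁻¹ * (√(1 + x ^ 2))⁻¹)) • Φ 0 := by
    rw [integral_smul_const, integral_const_mul, integral_inv_mul_sqrt_inv]; norm_num
  rw [e2]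
  have hc1 : Continuous fun x : ℝ => (1 + x ^ 2)⁻¹ :=
    Continuous.inv₀ (by fun_prop) fun x => by positivity
  have hc2 : Continuous fun x : ℝ => (√(1 + x ^ 2))⁻¹ :=
    Continuous.inv₀ (by fun_prop) fun x => (Real.sqrt_pos.2 (by positivity)).ne'
  refine tendsto_integral_filter_of_dominated_convergence
    (fun x => (μ + 1) * M * (1 + x ^ 2)⁻¹) ?_ ?_ (integrable_inv_one_add_sq.const_mul _) ?_
  · refine Eventually.of_forall fun ε => Continuous.aestronglyMeasurable ?_
    dsimp only [F]
    fun_prop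
  · have h1 : ∀ᶠ ε in 𝓝[>] (0 : ℝ), ε ≤ 1 :=
      nhdsWithin_le_nhds (eventually_le_nhds zero_lt_one)
    filter_upwards [self_mem_nhdsWithin, h1] with ε hε hε1
    have hε' : 0 < ε := hε
    refine ae_of_all _ fun x => ?_
    dsimp only [F]
    have hs : 1 ≤ √(1 + x ^ 2) := by rw [Real.one_le_sqrt]; nlinarith [sq_nonneg x]
    have hr : (√(1 + x ^ 2))⁻¹ ≤ 1 := inv_le_one_of_one_le₀ hs
    have hE : Real.exp (-μ * (ε * √(1 + x ^ 2))) ≤ 1 := by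
      rw [Real.exp_le_one_iff]
      have : 0 ≤ μ * (ε * √(1 + x ^ 2)) := by positivity
      linarith
    have hp : 0 ≤ (1 + x ^ 2)⁻¹ := by positivity
    rw [norm_smul, Real.norm_of_nonneg (by positivity)]
    calc _ ≤ 1 / 2 * 1 * (μ * 1 * (1 + x ^ 2)⁻¹ + (1 + x ^ 2)⁻¹ * 1) * M := by
          gcongr
          exact hM _
      _ = 1 / 2 * ((μ + 1) * M * (1 + x ^ 2)⁻¹) := by ring
      _ ≤ (μ + 1) * M * (1 + x ^ 2)⁻¹ := by
          have : 0 ≤ (μ + 1) * M * (1 + x ^ 2)⁻¹ := by positivity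
          linarith
  · refine ae_of_all _ fun x => ?_
    have hcont : Continuous fun ε => F ε x := by dsimp only [F]; fun_prop
    have h := (hcont.tendsto 0).mono_left (nhdsWithin_le_nhds (s := Ioi 0))
    have h0 : F 0 x = ((1 / 2) * ((1 + x ^ 2)⁻¹ * (√(1 + x ^ 2))⁻¹)) • Φ 0 := by
      simp only [F, zero_mul, mul_zero, Real.exp_zero, mul_one, zero_add]
    rwa [h0] at h

theorem continuous_smul_of_tsupport {E : Type*} [NormedAddCommGroup E] [NormedSpace ℝ E]
    {a b : ℝ} {χ : ℝ → ℝ} {u : ℝ → E} (hχ : Continuous χ)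
    (hs : tsupport χ ⊆ Ioo a b) (hu : ContinuousOn u (Ioo a b)) : Continuous fun t => χ t • u t := by
  refine continuous_iff_continuousAt.2 fun t => ?_
  by_cases ht : t ∈ tsupport χ
  · exact hχ.continuousAt.smul (hu.continuousAt (isOpen_Ioo.mem_nhds (hs ht)))
  · have h : (fun t => χ t • u t) =ᶠ[𝓝 t] fun _ => 0 := by
      filter_upwards [notMem_tsupport_iff_eventuallyEq.1 ht] with s hs
      rw [hs]; simp
    exact (continuousAt_congr h).2 continuousAt_const

/-- Test the equation with `χ * green (· - t₀)`. The second derivative of the Green function yields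
the averaged value of `χ u`; what remains is the source and the terms with `χ'`, `χ''`, estimated by
`|G| ≤ exp (-μ|t|)/(2μ)` and `|G'| ≤ exp (-μ|t|)/2`. -/
theorem green_estimate_approx {a b μ : ℝ} (hμ : 0 < μ) {u g : ℝ → Target n}
    (hu : ContinuousOn u (Ioo a b))
    (heq : ∀ ζ : ℝ → ℝ, ContDiff ℝ ∞ ζ → HasCompactSupport ζ → tsupport ζ ⊆ Ioo a b →
      ∫ t, (deriv (deriv ζ) t - μ ^ 2 * ζ t) • u t = ∫ t, ζ t • g t)
    {χ : ℝ → ℝ} (hχ : ContDiff ℝ ∞ χ) (hc : HasCompactSupport χ) (hs : tsupport χ ⊆ Ioo a b)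
    (t₀ : ℝ) {ε : ℝ} (hε : 0 < ε) :
    ‖∫ t, greenDelta μ ε (t - t₀) • (χ t • u t)‖ₑ ≤
      ∫⁻ s, ENNReal.ofReal (Real.exp (-μ * |t₀ - s|) / μ) *
        (ENNReal.ofReal (|deriv χ s| * μ + |deriv (deriv χ) s|) * ‖u s‖ₑ +
          ENNReal.ofReal |χ s| * ‖g s‖ₑ) := by
  have hχ' : ContDiff ℝ ∞ (deriv χ) := (contDiff_infty_iff_deriv.1 hχ).2
  have hχ'' : ContDiff ℝ ∞ (deriv (deriv χ)) := (contDiff_infty_iff_deriv.1 hχ').2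
  have hG : ContDiff ℝ ∞ fun t => green μ ε (t - t₀) :=
    (contDiff_green hε).comp (contDiff_id.sub contDiff_const)
  have dG : ∀ t, HasDerivAt (fun t => green μ ε (t - t₀)) (greenDeriv μ ε (t - t₀)) t := fun t => by
    simpa using (hasDerivAt_green hμ hε (t - t₀)).comp_sub_const t t₀
  have dG' : ∀ t, HasDerivAt (fun t => greenDeriv μ ε (t - t₀))
      (μ ^ 2 * green μ ε (t - t₀) - greenDelta μ ε (t - t₀)) t := fun t => by
    simpa using (hasDerivAt_greenDeriv hε (t - t₀)).comp_sub_const t t₀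
  have dχ : ∀ t, HasDerivAt χ (deriv χ t) t := fun t =>
    (hχ.differentiable (by simp) t).hasDerivAt
  have dχ' : ∀ t, HasDerivAt (deriv χ) (deriv (deriv χ) t) t := fun t =>
    (hχ'.differentiable (by simp) t).hasDerivAt
  let ζ : ℝ → ℝ := fun t => χ t * green μ ε (t - t₀)
  have hζ : ContDiff ℝ ∞ ζ := hχ.mul hG
  have hζc : HasCompactSupport ζ := hc.mul_right
  have hζs : tsupport ζ ⊆ Ioo a b := (tsupport_mul_subset_left).trans hs
  have d1 : deriv ζ = fun t => deriv χ t * green μ ε (t - t₀) + χ t * greenDeriv μ ε (t - t₀) :=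
    funext fun t => ((dχ t).mul (dG t)).deriv
  have d2 : ∀ t, deriv (deriv ζ) t - μ ^ 2 * ζ t =
      (deriv (deriv χ) t * green μ ε (t - t₀) + 2 * (deriv χ t * greenDeriv μ ε (t - t₀))) -
        greenDelta μ ε (t - t₀) * χ t := by
    intro t
    rw [d1]
    have := (((dχ' t).mul (dG t)).add ((dχ t).mul (dG' t))).deriv
    simp only [Pi.add_def, Pi.mul_def] at this
    rw [this]
    simp only [ζ]; ring
  have hGc : Continuous fun t => green μ ε (t - t₀) := hG.continuous
  have hG'c : Continuous fun t => greenDeriv μ ε (t - t₀) :=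
    continuous_iff_continuousAt.2 fun t => (dG' t).continuousAt
  have hDc : Continuous fun t => greenDelta μ ε (t - t₀) := by
    have : Continuous (greenDelta μ ε) := by
      unfold greenDelta
      refine (by fun_prop : Continuous fun t : ℝ => 1 / 2 * Real.exp (-μ * √(t ^ 2 + ε ^ 2))).mul ?_
      refine (continuous_const.mul (continuous_const.div (by fun_prop) fun t => by positivity)).add
        (continuous_const.div (by fun_prop) fun t => ?_)
      have hs : 0 < √(t ^ 2 + ε ^ 2) := Real.sqrt_pos.2 (by positivity)
      positivity
    fun_prop
  have c0 := continuous_smul_of_tsupport hχ.continuous hs hu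
  have c1 := continuous_smul_of_tsupport hχ'.continuous (tsupport_deriv_subset.trans hs) hu
  have c2 := continuous_smul_of_tsupport hχ''.continuous
    (tsupport_deriv_subset.trans (tsupport_deriv_subset.trans hs)) hu
  have s0 : HasCompactSupport fun t => χ t • u t := hc.smul_right
  have s1 : HasCompactSupport fun t => deriv χ t • u t := hc.deriv.smul_right
  have s2 : HasCompactSupport fun t => deriv (deriv χ) t • u t := hc.deriv.deriv.smul_right
  have i0 : Integrable fun t => greenDelta μ ε (t - t₀) • (χ t • u t) :=
    (hDc.smul c0).integrable_of_hasCompactSupport s0.smul_left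
  let q : ℝ → Target n := fun t => green μ ε (t - t₀) • (deriv (deriv χ) t • u t) +
    (2 * greenDeriv μ ε (t - t₀)) • (deriv χ t • u t)
  have i1 : Integrable q :=
    ((hGc.smul c2).integrable_of_hasCompactSupport s2.smul_left).add
      (((continuous_const.mul hG'c).smul c1).integrable_of_hasCompactSupport s1.smul_left)
  have key : ∫ t, greenDelta μ ε (t - t₀) • (χ t • u t) = (∫ t, q t) - ∫ t, ζ t • g t := by
    rw [← heq ζ hζ hζc hζs]
    have e : ∀ t, (deriv (deriv ζ) t - μ ^ 2 * ζ t) • u t =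
        q t - greenDelta μ ε (t - t₀) • (χ t • u t) := by
      intro t
      rw [d2]
      simp only [q, smul_smul, ← add_smul, ← sub_smul]
      congr 1; ring
    simp_rw [e]
    rw [integral_sub i1 i0]
    abel
  rw [key]
  have hexp : Measurable fun s => ENNReal.ofReal (Real.exp (-μ * |t₀ - s|) / μ) := by fun_prop
  have b1 : ∀ t, ‖q t‖ₑ ≤ ENNReal.ofReal (Real.exp (-μ * |t₀ - t|) / μ) *
      (ENNReal.ofReal (|deriv χ t| * μ + |deriv (deriv χ) t|) * ‖u t‖ₑ) := by
    intro t
    have h1 : q t = (green μ ε (t - t₀) * deriv (deriv χ) t +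
        2 * greenDeriv μ ε (t - t₀) * deriv χ t) • u t := by
      simp only [q, smul_smul, ← add_smul]
    rw [h1, enorm_smul, ← mul_assoc, ← ENNReal.ofReal_mul (by positivity)]
    gcongr
    rw [← ofReal_norm, Real.norm_eq_abs]
    refine ENNReal.ofReal_le_ofReal ((abs_add_le _ _).trans ?_)
    have a1 := abs_green_le hμ ε (t - t₀)
    have a2 := abs_greenDeriv_le hμ hε (t - t₀)
    rw [abs_sub_comm t t₀] at a1 a2
    rw [abs_mul, abs_mul, abs_mul, abs_two]
    calc |green μ ε (t - t₀)| * |deriv (deriv χ) t| +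
          2 * |greenDeriv μ ε (t - t₀)| * |deriv χ t|
        ≤ Real.exp (-μ * |t₀ - t|) / (2 * μ) * |deriv (deriv χ) t| +
          2 * (1 / 2 * Real.exp (-μ * |t₀ - t|)) * |deriv χ t| := by gcongr
      _ ≤ Real.exp (-μ * |t₀ - t|) / μ * |deriv (deriv χ) t| +
          2 * (1 / 2 * Real.exp (-μ * |t₀ - t|)) * |deriv χ t| := by
          gcongr
          linarith
      _ = _ := by field_simp; ring
  have b2 : ∀ t, ‖ζ t • g t‖ₑ ≤ ENNReal.ofReal (Real.exp (-μ * |t₀ - t|) / μ) *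
      (ENNReal.ofReal |χ t| * ‖g t‖ₑ) := by
    intro t
    rw [enorm_smul, ← mul_assoc, ← ENNReal.ofReal_mul (by positivity)]
    gcongr
    rw [← ofReal_norm, Real.norm_eq_abs]
    refine ENNReal.ofReal_le_ofReal ?_
    simp only [ζ]
    rw [abs_mul, mul_comm]
    have a1 := abs_green_le hμ ε (t - t₀)
    rw [abs_sub_comm t t₀] at a1
    refine mul_le_mul_of_nonneg_right (a1.trans ?_) (abs_nonneg _)
    gcongr
    linarith
  calc ‖(∫ t, q t) - ∫ t, ζ t • g t‖ₑ ≤ ‖∫ t, q t‖ₑ + ‖∫ t, ζ t • g t‖ₑ := enorm_sub_le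
    _ ≤ (∫⁻ t, ‖q t‖ₑ) + ∫⁻ t, ‖ζ t • g t‖ₑ :=
        add_le_add (enorm_integral_le_lintegral_enorm _) (enorm_integral_le_lintegral_enorm _)
    _ = ∫⁻ t, (‖q t‖ₑ + ‖ζ t • g t‖ₑ) := by
        rw [lintegral_add_left' i1.aestronglyMeasurable.enorm]
    _ ≤ _ := lintegral_mono fun t => by
        rw [mul_add]
        exact add_le_add (b1 t) (b2 t)

/-- Pointwise bound for a solution of `u'' - μ² u = g`, localised by a cutoff. -/
theorem green_estimate {a b μ : ℝ} (hμ : 0 < μ) {u g : ℝ → Target n}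
    (hu : ContinuousOn u (Ioo a b))
    (heq : ∀ ζ : ℝ → ℝ, ContDiff ℝ ∞ ζ → HasCompactSupport ζ → tsupport ζ ⊆ Ioo a b →
      ∫ t, (deriv (deriv ζ) t - μ ^ 2 * ζ t) • u t = ∫ t, ζ t • g t)
    {χ : ℝ → ℝ} (hχ : ContDiff ℝ ∞ χ) (hc : HasCompactSupport χ) (hs : tsupport χ ⊆ Ioo a b)
    (t₀ : ℝ) :
    ‖χ t₀ • u t₀‖ₑ ≤
      ∫⁻ s, ENNReal.ofReal (Real.exp (-μ * |t₀ - s|) / μ) *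
        (ENNReal.ofReal (|deriv χ s| * μ + |deriv (deriv χ) s|) * ‖u s‖ₑ +
          ENNReal.ofReal |χ s| * ‖g s‖ₑ) := by
  have c0 := continuous_smul_of_tsupport hχ.continuous hs hu
  have s0 : HasCompactSupport fun t => χ t • u t := hc.smul_right
  obtain ⟨M, hM⟩ := c0.bounded_above_of_compact_support s0
  have h1 := tendsto_integral_greenDelta hμ (Φ := fun t => χ (t + t₀) • u (t + t₀))
    (c0.comp (continuous_id.add continuous_const)) (M := M) (fun t => hM _)
  simp only [zero_add] at h1
  refine le_of_tendsto h1.enorm ?_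
  filter_upwards [self_mem_nhdsWithin] with ε hε
  have h2 := green_estimate_approx hμ hu heq hχ hc hs t₀ hε
  rw [← integral_add_right_eq_self _ t₀] at h2
  simpa only [add_sub_cancel_right] using h2

/-! ### Increments of a function with a weak derivative -/

theorem contDiff_smoothTransition : ContDiff ℝ ∞ Real.smoothTransition :=
  Real.smoothTransition.contDiff

theorem deriv_smoothTransition_eq_zero {x : ℝ} (hx : x ∉ Icc (0 : ℝ) 1) :
    deriv Real.smoothTransition x = 0 := by
  rw [mem_Icc, not_and_or, not_le, not_le] at hx
  rcases hx with h | h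
  · have : Real.smoothTransition =ᶠ[𝓝 x] fun _ => 0 := by
      filter_upwards [Iio_mem_nhds h] with y hy
      exact Real.smoothTransition.zero_of_nonpos (le_of_lt hy)
    rw [this.deriv_eq, deriv_const]
  · have : Real.smoothTransition =ᶠ[𝓝 x] fun _ => 1 := by
      filter_upwards [Ioi_mem_nhds h] with y hy
      exact Real.smoothTransition.one_of_one_le (le_of_lt hy)
    rw [this.deriv_eq, deriv_const]

theorem continuous_deriv_smoothTransition : Continuous (deriv Real.smoothTransition) :=
  contDiff_smoothTransition.continuous_deriv (by simp)

theorem hasCompactSupport_deriv_smoothTransition :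
    HasCompactSupport (deriv Real.smoothTransition) :=
  HasCompactSupport.intro isCompact_Icc fun _ hx => deriv_smoothTransition_eq_zero hx

theorem integral_deriv_smoothTransition : ∫ x, deriv Real.smoothTransition x = 1 := by
  have h := integral_of_hasDerivAt_of_tendsto (f := Real.smoothTransition) (m := 0) (n := 1)
    (fun x => (contDiff_smoothTransition.differentiable (by simp) x).hasDerivAt)
    (continuous_deriv_smoothTransition.integrable_of_hasCompactSupport
      hasCompactSupport_deriv_smoothTransition)
    (tendsto_const_nhds.congr' (by
      filter_upwards [eventually_le_atBot 0] with x hx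
      exact (Real.smoothTransition.zero_of_nonpos hx).symm))
    (tendsto_const_nhds.congr' (by
      filter_upwards [eventually_ge_atTop 1] with x hx
      exact (Real.smoothTransition.one_of_one_le hx).symm))
  simpa using h

/-- An approximate identity at `c`. The offset `e` selects the side on which the mass sits: to the
right of `c` for `e = 0`, to the left for `e = 1`. -/
theorem tendsto_integral_smoothTransition {w : ℝ → Target n} (hw : Continuous w) {M : ℝ}
    (hM : ∀ t, ‖w t‖ ≤ M) (c e : ℝ) :
    Tendsto (fun ε => ∫ t, (ε⁻¹ * deriv Real.smoothTransition ((t - c) / ε + e)) • w t)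
      (𝓝[>] 0) (𝓝 (w c)) := by
  have e1 : ∀ᶠ ε in 𝓝[>] (0 : ℝ), ∫ x, deriv Real.smoothTransition x • w (c + ε * (x - e)) =
      ∫ t, (ε⁻¹ * deriv Real.smoothTransition ((t - c) / ε + e)) • w t := by
    filter_upwards [self_mem_nhdsWithin] with ε hε
    have hε' : 0 < ε := hε
    let G : ℝ → Target n := fun t => (ε⁻¹ * deriv Real.smoothTransition ((t - c) / ε + e)) • w t
    have h1 := Measure.integral_comp_mul_left (fun y => G (c + y)) ε
    have h2 : ∀ x, deriv Real.smoothTransition x • w (c + ε * (x - e)) =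
        ε • G (c + ε * (x - e)) := by
      intro x
      simp only [G, smul_smul]
      have h3 : (c + ε * (x - e) - c) / ε + e = x := by field_simp; ring
      rw [h3, mul_inv_cancel_left₀ hε'.ne']
    simp_rw [h2]
    rw [integral_smul, integral_sub_right_eq_self (fun x => G (c + ε * x)) e, h1,
      abs_of_pos (inv_pos.2 hε'), smul_smul, mul_inv_cancel₀ hε'.ne', one_smul,
      integral_add_left_eq_self]
  refine Tendsto.congr' e1 ?_
  have e2 : w c = ∫ x, deriv Real.smoothTransition x • w c := by
    rw [integral_smul_const, integral_deriv_smoothTransition, one_smul]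
  rw [e2]
  have hS := continuous_deriv_smoothTransition
  refine tendsto_integral_filter_of_dominated_convergence
    (fun x => ‖deriv Real.smoothTransition x‖ * M) ?_ ?_
    ((hS.integrable_of_hasCompactSupport hasCompactSupport_deriv_smoothTransition).norm.mul_const _) ?_
  · exact Eventually.of_forall fun ε => Continuous.aestronglyMeasurable (by fun_prop)
  · refine Eventually.of_forall fun ε => ae_of_all _ fun x => ?_
    rw [norm_smul]
    exact mul_le_mul_of_nonneg_left (hM _) (norm_nonneg _)
  · refine ae_of_all _ fun x => ?_
    have hcont : Continuous fun ε => deriv Real.smoothTransition x • w (c + ε * (x - e)) := by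
      fun_prop
    have h := (hcont.tendsto 0).mono_left (nhdsWithin_le_nhds (s := Ioi 0))
    simpa using h

/-- Test with a smoothed indicator of `[t₁, t₂]`: its derivative tends to the difference of the
Dirac masses at the two ends, and its absolute value is at most `1`. -/
theorem enorm_sub_le_lintegral_weakDeriv {a b : ℝ} {u d : ℝ → Target n}
    (hu : ContinuousOn u (Ioo a b))
    (heq : ∀ ζ : ℝ → ℝ, ContDiff ℝ ∞ ζ → HasCompactSupport ζ → tsupport ζ ⊆ Ioo a b →
      ∫ t, deriv ζ t • u t = -∫ t, ζ t • d t)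
    {t₁ t₂ : ℝ} (h1 : a < t₁) (h12 : t₁ ≤ t₂) (h2 : t₂ < b) :
    ‖u t₁ - u t₂‖ₑ ≤ ∫⁻ t in Icc t₁ t₂, ‖d t‖ₑ := by
  rcases h12.eq_or_lt with rfl | hlt
  · simp
  -- Constant extension beyond `[t₁, t₂]` gives a bounded continuous function on the line, as the
  -- approximate identity requires.
  let w : ℝ → Target n := IccExtend h12 ((Icc t₁ t₂).domRestrict u)
  have hsub : Icc t₁ t₂ ⊆ Ioo a b := fun x hx => ⟨h1.trans_le hx.1, hx.2.trans_lt h2⟩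
  have hw : Continuous w := (continuousOn_iff_continuous_domRestrict.1 (hu.mono hsub)).Icc_extend'
  have hwu : ∀ t ∈ Icc t₁ t₂, w t = u t := fun t ht => IccExtend_of_mem h12 _ ht
  obtain ⟨M, hM⟩ := (isCompact_Icc (a := t₁) (b := t₂)).exists_bound_of_continuousOn (hu.mono hsub)
  have hwM : ∀ t, ‖w t‖ ≤ M := fun t => hM _ (projIcc t₁ t₂ h12 t).2
  have lim := (tendsto_integral_smoothTransition hw hwM t₁ 0).sub
    (tendsto_integral_smoothTransition hw hwM t₂ 1)
  rw [hwu t₁ ⟨le_rfl, h12⟩, hwu t₂ ⟨h12, le_rfl⟩] at lim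
  refine le_of_tendsto lim.enorm ?_
  have hev : ∀ᶠ ε in 𝓝[>] (0 : ℝ), ε ≤ t₂ - t₁ :=
    nhdsWithin_le_nhds (eventually_le_nhds (sub_pos.2 hlt))
  filter_upwards [self_mem_nhdsWithin, hev] with ε hε hε1
  have hε' : 0 < ε := hε
  -- The rise takes place on `[t₁, t₁ + ε]` and the fall on `[t₂ - ε, t₂]`, so the support stays
  -- inside `[t₁, t₂]`.
  let ζ : ℝ → ℝ := fun t => Real.smoothTransition ((t - t₁) / ε + 0) -
    Real.smoothTransition ((t - t₂) / ε + 1)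
  have hS := contDiff_smoothTransition
  have hζ : ContDiff ℝ ∞ ζ := by
    dsimp only [ζ]
    fun_prop
  have hz : ∀ t, t ∉ Icc t₁ t₂ → ζ t = 0 := by
    intro t ht
    rw [mem_Icc, not_and_or, not_le, not_le] at ht
    simp only [ζ]
    rcases ht with h | h
    · rw [Real.smoothTransition.zero_of_nonpos, Real.smoothTransition.zero_of_nonpos, sub_zero]
      · have : (t - t₂) / ε ≤ -1 := by rw [div_le_iff₀ hε']; linarith
        linarith
      · rw [add_zero]; exact div_nonpos_of_nonpos_of_nonneg (by linarith) hε'.le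
    · rw [Real.smoothTransition.one_of_one_le, Real.smoothTransition.one_of_one_le, sub_self]
      · have : 0 ≤ (t - t₂) / ε := div_nonneg (by linarith) hε'.le
        linarith
      · rw [add_zero, le_div_iff₀ hε']; linarith
  have hζs : tsupport ζ ⊆ Icc t₁ t₂ := closure_minimal (fun t ht => by
    by_contra hh; exact ht (hz t hh)) isClosed_Icc
  have hζc : HasCompactSupport ζ := isCompact_Icc.of_isClosed_subset (isClosed_tsupport _) hζs
  have hd : ∀ t, deriv ζ t = ε⁻¹ * deriv Real.smoothTransition ((t - t₁) / ε + 0) -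
      ε⁻¹ * deriv Real.smoothTransition ((t - t₂) / ε + 1) := by
    intro t
    have hg : ∀ c e : ℝ, HasDerivAt (fun t => Real.smoothTransition ((t - c) / ε + e))
        (ε⁻¹ * deriv Real.smoothTransition ((t - c) / ε + e)) t := by
      intro c e
      have h3 : HasDerivAt (fun t : ℝ => (t - c) / ε + e) (1 / ε) t :=
        (((hasDerivAt_id t).sub_const c).div_const ε).add_const e
      have h4 := ((hS.differentiable (by simp) ((t - c) / ε + e)).hasDerivAt).comp t h3
      refine h4.congr_deriv ?_
      rw [one_div, mul_comm]
    exact ((hg t₁ 0).sub (hg t₂ 1)).deriv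
  have hcI : ∀ c e : ℝ, Integrable fun t =>
      (ε⁻¹ * deriv Real.smoothTransition ((t - c) / ε + e)) • w t := by
    intro c e
    have hc1 : Continuous fun t => (ε⁻¹ * deriv Real.smoothTransition ((t - c) / ε + e)) • w t := by
      have := continuous_deriv_smoothTransition
      fun_prop
    refine hc1.integrable_of_hasCompactSupport (HasCompactSupport.intro
      (isCompact_Icc (a := c - ε * e) (b := c + ε * (1 - e))) fun t ht => ?_)
    rw [deriv_smoothTransition_eq_zero, mul_zero, zero_smul]
    rintro ⟨q1, q2⟩
    refine ht ⟨?_, ?_⟩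
    · have : -e ≤ (t - c) / ε := by linarith
      rw [le_div_iff₀ hε'] at this
      linarith
    · have : (t - c) / ε ≤ 1 - e := by linarith
      rw [div_le_iff₀ hε'] at this
      linarith
  have key : (∫ t, (ε⁻¹ * deriv Real.smoothTransition ((t - t₁) / ε + 0)) • w t) -
      ∫ t, (ε⁻¹ * deriv Real.smoothTransition ((t - t₂) / ε + 1)) • w t =
      -∫ t, ζ t • d t := by
    rw [← heq ζ hζ hζc (hζs.trans hsub), ← integral_sub (hcI _ _) (hcI _ _)]
    refine integral_congr_ae (ae_of_all _ fun t => ?_)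
    dsimp only
    rw [← sub_smul, ← hd]
    by_cases ht : t ∈ Icc t₁ t₂
    · rw [hwu t ht]
    · have h5 : deriv ζ t = 0 := by
        have : t ∉ tsupport (deriv ζ) := fun h => ht (hζs (tsupport_deriv_subset h))
        exact image_eq_zero_of_notMem_tsupport this
      rw [h5, zero_smul, zero_smul]
  rw [key, enorm_neg]
  refine (enorm_integral_le_lintegral_enorm _).trans ?_
  rw [← lintegral_indicator measurableSet_Icc]
  refine lintegral_mono fun t => ?_
  by_cases ht : t ∈ Icc t₁ t₂
  · rw [indicator_of_mem ht, enorm_smul]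
    refine mul_le_of_le_one_left zero_le ?_
    rw [← ofReal_norm, Real.norm_eq_abs]
    rw [← ENNReal.ofReal_one]
    refine ENNReal.ofReal_le_ofReal ?_
    have a1 := Real.smoothTransition.nonneg ((t - t₁) / ε + 0)
    have a2 := Real.smoothTransition.le_one ((t - t₁) / ε + 0)
    have a3 := Real.smoothTransition.nonneg ((t - t₂) / ε + 1)
    have a4 := Real.smoothTransition.le_one ((t - t₂) / ε + 1)
    simp only [ζ]
    rw [abs_le]
    constructor <;> linarith
  · rw [hz t ht, indicator_of_notMem ht]; simp

end WillmoreNeck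
end

noncomputable section
namespace WillmoreNeck
variable {n : ℕ}

/-! ### Circle averages of a map of class `F^p_conf` -/

theorem restrict_openCyl (a b : ℝ) : (volume : Measure Cylinder).restrict (openCyl a b) =
    (volume : Measure (AddCircle (2 * Real.pi))).prod (volume.restrict (Ioo a b)) := by
  have hU : openCyl a b = univ ×ˢ Ioo a b := by ext z; simp [openCyl]
  rw [hU, Measure.volume_eq_prod, ← Measure.prod_restrict, Measure.restrict_univ]

theorem restrict_closedCyl_inter (c d a b : ℝ) :
    (volume : Measure Cylinder).restrict (closedCyl c d ∩ openCyl a b) =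
    (volume : Measure (AddCircle (2 * Real.pi))).prod (volume.restrict (Icc c d ∩ Ioo a b)) := by
  have hU : closedCyl c d ∩ openCyl a b = univ ×ˢ (Icc c d ∩ Ioo a b) := by
    ext z; simp [openCyl, closedCyl]
  rw [hU, Measure.volume_eq_prod, ← Measure.prod_restrict, Measure.restrict_univ]

theorem ae_slice_of_ae {a b : ℝ} {P : Cylinder → Prop}
    (h : ∀ᵐ z ∂volume.restrict (openCyl a b), P z) :
    ∀ᵐ t, t ∈ Ioo a b → ∀ᵐ θ, P (θ, t) := by
  rw [restrict_openCyl] at h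
  have h1 : ∀ᵐ w ∂(volume.restrict (Ioo a b)).prod (volume : Measure (AddCircle (2 * Real.pi))),
      P w.swap := by
    rw [← Measure.prod_swap] at h
    exact ae_of_ae_map measurable_swap.aemeasurable h
  have h2 := Measure.ae_ae_of_ae_prod h1
  rw [ae_restrict_iff' measurableSet_Ioo] at h2
  exact h2

/-- A perfect square above `2π`, so that the Cauchy–Schwarz constant on the circle is the integer
`4`. -/
theorem volume_circle_le : (volume : Measure (AddCircle (2 * Real.pi))) univ ≤ 16 := by
  rw [AddCircle.measure_univ]
  have h : 2 * Real.pi ≤ 16 := by linarith [Real.pi_lt_four]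
  calc ENNReal.ofReal (2 * Real.pi) ≤ ENNReal.ofReal 16 := ENNReal.ofReal_le_ofReal h
    _ = 16 := by simp

theorem lintegral_circle_le_sqrt {g : AddCircle (2 * Real.pi) → ℝ≥0∞} (hg : AEMeasurable g) :
    ∫⁻ θ, g θ ≤ 4 * (∫⁻ θ, g θ ^ 2) ^ (1 / 2 : ℝ) := by
  have h := lintegral_mul_le_sqrt (μ := (volume : Measure (AddCircle (2 * Real.pi))))
    (f := fun _ => 1) (g := g) aemeasurable_const hg
  simp only [one_mul, one_pow, lintegral_const] at h
  refine h.trans ?_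
  gcongr
  calc (volume : Measure (AddCircle (2 * Real.pi))) univ ^ (1 / 2 : ℝ)
      ≤ (4 ^ 2 : ℝ≥0∞) ^ (1 / 2 : ℝ) := by
        refine ENNReal.rpow_le_rpow (volume_circle_le.trans ?_) (by norm_num)
        norm_num
    _ = 4 := ENNReal_sq_sqrt 4

theorem enorm_casCoeff_le (m : ℤ) (x : AddCircle (2 * Real.pi) → Target n) :
    ‖casCoeff m x‖ₑ ≤ 2 * ∫⁻ θ, ‖x θ‖ₑ := by
  unfold casCoeff
  refine (enorm_integral_le_lintegral_enorm _).trans ?_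
  rw [← lintegral_const_mul' _ _ (by simp)]
  refine lintegral_mono fun θ => ?_
  rw [enorm_smul]
  gcongr
  rw [← ofReal_norm, Real.norm_eq_abs]
  calc ENNReal.ofReal |cas m θ| ≤ ENNReal.ofReal 2 := ENNReal.ofReal_le_ofReal (abs_cas_le m θ)
    _ = 2 := by simp

theorem continuousOn_sliceCoeff {a b R : ℝ} {f : Cylinder → Target n}
    (hf : ContinuousOn f (openCyl a b)) (hR : ∀ z ∈ openCyl a b, ‖f z‖ ≤ R) (m : ℤ) :
    ContinuousOn (sliceCoeff m f) (Ioo a b) := by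
  unfold sliceCoeff casCoeff
  refine continuousOn_of_dominated (bound := fun _ => 2 * R) ?_ ?_ (integrable_const _) ?_
  · intro t ht
    refine Continuous.aestronglyMeasurable ((continuous_cas m).smul ?_)
    exact hf.comp_continuous (by fun_prop) fun θ => ht
  · intro t ht
    refine ae_of_all _ fun θ => ?_
    rw [norm_smul, Real.norm_eq_abs]
    exact mul_le_mul (abs_cas_le m θ) (hR _ ht) (norm_nonneg _) (by norm_num)
  · refine ae_of_all _ fun θ => ?_
    have h : ContinuousOn (fun t => f (θ, t)) (Ioo a b) :=
      hf.comp (t := openCyl a b) (by fun_prop) fun t ht => ht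
    exact h.const_smul (cas m θ)

/-- Where the gradient vanishes, the convention `H = 0` and division by zero give the same value, so
no case distinction survives. -/
theorem willmore_density_eq (U : Set Cylinder) (f : Cylinder → Target n) (z : Cylinder) :
    ‖meanCurv U f z‖ ^ 2 * gradSq U f z = 4 * (‖laplacian U f z‖ ^ 2 / gradSq U f z) := by
  unfold meanCurv
  split_ifs with h
  · rw [h]; simp
  · rw [norm_smul, mul_pow, Real.norm_eq_abs, sq_abs]
    field_simp
    ring

/-- Measurable majorants and the identities for circle integrals of a conformal map:
`F` is the circle integral of `|f_θ|²`, `H` that of the Willmore density and `γ` that of `|Δf|`. -/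
structure SliceData (T p : ℝ) (f : Cylinder → Target n) (F H γ : ℝ → ℝ≥0∞) : Prop where
  measurable_F : Measurable F
  measurable_H : Measurable H
  measurable_γ : Measurable γ
  coeff_le : ∀ᵐ t, t ∈ Ioo (-T) T → ∀ m : ℤ,
    ENNReal.ofReal |(m : ℝ)| * ‖sliceCoeff m f t‖ₑ ≤ 8 * F t ^ (1 / 2 : ℝ)
  le_tsum : ∀ᵐ t, t ∈ Ioo (-T) T →
    F t ≤ ∑' m : ℤ, (ENNReal.ofReal |(m : ℝ)| * ‖sliceCoeff m f t‖ₑ) ^ 2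
  γ_le : ∀ᵐ t, t ∈ Ioo (-T) T → γ t ≤ 2 * (H t ^ (1 / 2 : ℝ) * F t ^ (1 / 2 : ℝ))
  energy_eq : ∀ a b, energy (openCyl (-T) T) f (closedCyl a b) =
    2 * ∫⁻ t in Icc a b ∩ Ioo (-T) T, F t
  willmore_eq : ∀ a b, willmore (openCyl (-T) T) f (closedCyl a b) =
    ∫⁻ t in Icc a b ∩ Ioo (-T) T, H t
  laplacian_le : ∀ᵐ t, t ∈ Ioo (-T) T → ∀ m : ℤ,
    ‖sliceCoeff m (laplacian (openCyl (-T) T) f) t‖ₑ ≤ 2 * γ t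
  deriv_le : ∀ᵐ t, t ∈ Ioo (-T) T → ∀ m : ℤ,
    ‖sliceCoeff m (weakPartial (openCyl (-T) T) 1 f) t‖ₑ ≤ 8 * F t ^ (1 / 2 : ℝ)
  γ_rpow : ∀ a b, -T < a → b < T → ∫⁻ t in Icc a b, γ t ^ p < ⊤

/-- All quantities are written with Borel representatives `V` of `f_θ` and `L` of `Δf`; conformality
replaces `|∇f|²` by `2|V|²`. Parseval is applied to `V`, whose coefficients are those of `f`
multiplied by the frequency, so the zero mode does not contribute to `F`. -/
theorem exists_sliceData {T p R : ℝ} (hp : 1 < p) {f : Cylinder → Target n}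
    (h : MemFpConf (openCyl (-T) T) p R f) (hE : energy (openCyl (-T) T) f univ ≠ ⊤) :
    ∃ F H γ : ℝ → ℝ≥0∞, SliceData T p f F H γ := by
  set U := openCyl (-T) T with hU
  obtain ⟨hv0, -, hw0⟩ := h.memW2pLoc.weakPartial_spec 0
  obtain ⟨hv1, -, hw1⟩ := h.memW2pLoc.weakPartial_spec 1
  have m0 : AEStronglyMeasurable (weakPartial U 0 f) (volume.restrict U) :=
    hv0.locInt_right.aestronglyMeasurable
  have lapEq : laplacian U f = fun z => weakPartial U 0 (weakPartial U 0 f) z +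
      weakPartial U 1 (weakPartial U 1 f) z := by
    funext z; unfold laplacian; simp only [Fin.sum_univ_two]
  have mL : AEStronglyMeasurable (laplacian U f) (volume.restrict U) := by
    rw [lapEq]
    exact (hw0 0).1.locInt_right.aestronglyMeasurable.add
      (hw1 1).1.locInt_right.aestronglyMeasurable
  obtain ⟨V, hV, hVeq⟩ : ∃ V, Measurable V ∧ weakPartial U 0 f =ᵐ[volume.restrict U] V :=
    ⟨m0.mk _, m0.stronglyMeasurable_mk.measurable, m0.ae_eq_mk⟩
  obtain ⟨L, hL, hLeq⟩ : ∃ L, Measurable L ∧ laplacian U f =ᵐ[volume.restrict U] L :=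
    ⟨mL.mk _, mL.stronglyMeasurable_mk.measurable, mL.ae_eq_mk⟩
  have hgrad : ∀ᵐ z ∂volume.restrict U, gradSq U f z = 2 * ‖V z‖ ^ 2 := by
    filter_upwards [hVeq, h.conformal] with z hz hc
    unfold gradSq
    simp only [Fin.sum_univ_two]
    rw [← hc.1, hz]; ring
  let F : ℝ → ℝ≥0∞ := fun t => ∫⁻ θ, ‖V (θ, t)‖ₑ ^ 2
  let H : ℝ → ℝ≥0∞ := fun t => ∫⁻ θ, ENNReal.ofReal (‖L (θ, t)‖ ^ 2 / (2 * ‖V (θ, t)‖ ^ 2))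
  let γ : ℝ → ℝ≥0∞ := fun t => ∫⁻ θ, ‖L (θ, t)‖ₑ
  have hF : Measurable F :=
    Measurable.lintegral_prod_left' (f := fun z : Cylinder => ‖V z‖ₑ ^ 2) (by fun_prop)
  have hH : Measurable H := Measurable.lintegral_prod_left'
    (f := fun z : Cylinder => ENNReal.ofReal (‖L z‖ ^ 2 / (2 * ‖V z‖ ^ 2))) (by fun_prop)
  have hγ : Measurable γ :=
    Measurable.lintegral_prod_left' (f := fun z : Cylinder => ‖L z‖ₑ) (by fun_prop)
  have hVs : ∀ t, Measurable fun θ => V (θ, t) := fun t => hV.comp (by fun_prop)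
  have hLs : ∀ t, Measurable fun θ => L (θ, t) := fun t => hL.comp (by fun_prop)
  have energyEq : ∀ a b, energy U f (closedCyl a b) = 2 * ∫⁻ t in Icc a b ∩ Ioo (-T) T, F t := by
    intro a b
    unfold energy
    have h1 : ∀ᵐ z ∂volume.restrict (closedCyl a b ∩ U), ENNReal.ofReal (gradSq U f z) =
        2 * ‖V z‖ₑ ^ 2 := by
      filter_upwards [ae_mono (Measure.restrict_mono inter_subset_right le_rfl) hgrad] with z hz
      rw [hz, ENNReal.ofReal_mul (by norm_num), ENNReal.ofReal_pow (norm_nonneg _), ofReal_norm]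
      simp
    rw [lintegral_congr_ae h1, lintegral_const_mul _ (by fun_prop), hU, restrict_closedCyl_inter,
      lintegral_prod_symm _ (by fun_prop)]
  have Vmem : ∀ᵐ t, t ∈ Ioo (-T) T → F t ≠ ⊤ := by
    have h1 : ∫⁻ t in Icc (-T) T ∩ Ioo (-T) T, F t ≠ ⊤ := by
      have h2 : energy U f (closedCyl (-T) T) ≤ energy U f univ :=
        lintegral_mono' (Measure.restrict_mono (inter_subset_inter_left _ (subset_univ _)) le_rfl)
          le_rfl
      rw [energyEq] at h2
      intro h3
      rw [h3] at h2
      exact hE (top_le_iff.1 (by simpa using h2))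
    rw [inter_eq_right.2 Ioo_subset_Icc_self] at h1
    have h4 := ae_lt_top hF h1
    rw [ae_restrict_iff' measurableSet_Ioo] at h4
    filter_upwards [h4] with t ht htm using (ht htm).ne
  have sV : ∀ᵐ t, t ∈ Ioo (-T) T → ∀ᵐ θ, weakPartial U 0 f (θ, t) = V (θ, t) :=
    ae_slice_of_ae (P := fun z => weakPartial U 0 f z = V z) hVeq
  have sL : ∀ᵐ t, t ∈ Ioo (-T) T → ∀ᵐ θ, laplacian U f (θ, t) = L (θ, t) :=
    ae_slice_of_ae (P := fun z => laplacian U f z = L z) hLeq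
  have sC : ∀ᵐ t, t ∈ Ioo (-T) T → ∀ᵐ θ, ‖weakPartial U 0 f (θ, t)‖ = ‖weakPartial U 1 f (θ, t)‖ :=
    ae_slice_of_ae (P := fun z => ‖weakPartial U 0 f z‖ = ‖weakPartial U 1 f z‖)
      (h.conformal.mono fun z hz => hz.1)
  have coeffV : ∀ t, 2 * ∫⁻ θ, ‖V (θ, t)‖ₑ ≤ 8 * F t ^ (1 / 2 : ℝ) := by
    intro t
    have h1 := lintegral_circle_le_sqrt (g := fun θ => ‖V (θ, t)‖ₑ)
      ((hVs t).enorm).aemeasurable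
    calc 2 * ∫⁻ θ, ‖V (θ, t)‖ₑ ≤ 2 * (4 * F t ^ (1 / 2 : ℝ)) := by gcongr
      _ = _ := by rw [← mul_assoc]; norm_num
  refine ⟨F, H, γ, hF, hH, hγ, ?_, ?_, ?_, energyEq, ?_, ?_, ?_, ?_⟩
  · filter_upwards [hv0.ae_sliceCoeff_zero, sV] with t h1 h2 ht m
    have h3 := h1 ht (-m)
    rw [neg_neg] at h3
    have h4 : ENNReal.ofReal |(m : ℝ)| * ‖sliceCoeff m f t‖ₑ =
        ‖sliceCoeff (-m) (weakPartial U 0 f) t‖ₑ := by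
      rw [h3, enorm_neg, enorm_smul, ← ofReal_norm ((-m : ℤ) : ℝ), Real.norm_eq_abs]
      push_cast
      rw [abs_neg]
    rw [h4]
    refine (enorm_casCoeff_le _ _).trans ?_
    refine le_trans (le_of_eq ?_) (coeffV t)
    congr 1
    refine lintegral_congr_ae ?_
    filter_upwards [h2 ht] with θ hθ
    rw [hθ]
  · filter_upwards [hv0.ae_sliceCoeff_zero, sV, Vmem] with t h1 h2 h3 ht
    have hmem : MemLp (fun θ => V (θ, t)) 2 := by
      refine ⟨(hVs t).aestronglyMeasurable, ?_⟩
      rw [eLpNorm_lt_top_iff_lintegral_rpow_enorm_lt_top (by norm_num) (by norm_num)]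
      simpa using (h3 ht).lt_top
    have h4 := lintegral_enorm_sq_eq_tsum_casCoeff hmem
    change F t ≤ _
    change F t = _ at h4
    rw [h4]
    have h5 : ENNReal.ofReal (2 * Real.pi)⁻¹ ≤ 1 := by
      rw [← ENNReal.ofReal_one]
      refine ENNReal.ofReal_le_ofReal (inv_le_one_of_one_le₀ ?_)
      linarith [Real.pi_gt_three]
    refine (mul_le_of_le_one_left zero_le h5).trans (le_of_eq ?_)
    rw [← (Equiv.neg ℤ).tsum_eq]
    refine tsum_congr fun m => ?_
    congr 1
    have h6 : casCoeff (-m) (fun θ => V (θ, t)) = sliceCoeff (-m) (weakPartial U 0 f) t := by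
      unfold sliceCoeff casCoeff
      refine integral_congr_ae ?_
      filter_upwards [h2 ht] with θ hθ
      rw [hθ]
    have h7 := h1 ht (-m)
    rw [neg_neg] at h7
    rw [Equiv.neg_apply, h6, h7, enorm_neg, enorm_smul, ← ofReal_norm ((-m : ℤ) : ℝ),
      Real.norm_eq_abs]
    push_cast
    rw [abs_neg]
  · obtain ⟨β, -, -, hβ, -⟩ := h.laplacian_bound
    have h1 : ∀ᵐ z ∂volume.restrict U, ‖L z‖ₑ ≤
        ENNReal.ofReal (‖L z‖ ^ 2 / (2 * ‖V z‖ ^ 2)) ^ (1 / 2 : ℝ) *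
          ((2 : ℝ≥0∞) ^ (1 / 2 : ℝ) * ‖V z‖ₑ) := by
      filter_upwards [hgrad, hLeq, hβ] with z hz hzL hb
      rw [hzL, hz] at hb
      have e1 : (2 : ℝ≥0∞) ^ (1 / 2 : ℝ) * ‖V z‖ₑ = ENNReal.ofReal (2 * ‖V z‖ ^ 2) ^ (1 / 2 : ℝ) := by
        rw [ENNReal.ofReal_mul (by norm_num), ENNReal.mul_rpow_of_nonneg _ _ (by norm_num),
          ENNReal.ofReal_pow (norm_nonneg _), ofReal_norm, ENNReal_sq_sqrt]
        simp
      rw [e1, ← ENNReal.mul_rpow_of_nonneg _ _ (by norm_num), ← ENNReal.ofReal_mul (by positivity)]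
      -- At zeros of the gradient the pointwise bound `|Δf| ≤ β|∇f|²` forces `Δf = 0`; without it
      -- the Willmore density would not control the Laplacian there.
      by_cases h0 : ‖V z‖ = 0
      · rw [h0] at hb
        have hL0 : ‖L z‖ ≤ 0 := by simpa using hb
        rw [← ofReal_norm, le_antisymm hL0 (norm_nonneg _)]
        simp
      · have e2 : ‖L z‖ ^ 2 / (2 * ‖V z‖ ^ 2) * (2 * ‖V z‖ ^ 2) = ‖L z‖ ^ 2 := by
          field_simp
        rw [e2, ENNReal.ofReal_pow (norm_nonneg _), ofReal_norm, ENNReal_sq_sqrt]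
    filter_upwards [ae_slice_of_ae h1] with t ht htm
    have hm1 : Measurable fun θ => ENNReal.ofReal (‖L (θ, t)‖ ^ 2 / (2 * ‖V (θ, t)‖ ^ 2)) := by
      have := hVs t
      have := hLs t
      fun_prop
    have hm2 : Measurable fun θ => ‖V (θ, t)‖ₑ := (hVs t).enorm
    calc γ t ≤ ∫⁻ θ, ENNReal.ofReal (‖L (θ, t)‖ ^ 2 / (2 * ‖V (θ, t)‖ ^ 2)) ^ (1 / 2 : ℝ) *
          ((2 : ℝ≥0∞) ^ (1 / 2 : ℝ) * ‖V (θ, t)‖ₑ) := lintegral_mono_ae (ht htm)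
      _ ≤ (∫⁻ θ, (ENNReal.ofReal (‖L (θ, t)‖ ^ 2 / (2 * ‖V (θ, t)‖ ^ 2)) ^ (1 / 2 : ℝ)) ^ 2)
            ^ (1 / 2 : ℝ) *
          (∫⁻ θ, ((2 : ℝ≥0∞) ^ (1 / 2 : ℝ) * ‖V (θ, t)‖ₑ) ^ 2) ^ (1 / 2 : ℝ) :=
          lintegral_mul_le_sqrt (by fun_prop) (by fun_prop)
      _ = H t ^ (1 / 2 : ℝ) * ((2 : ℝ≥0∞) ^ (1 / 2 : ℝ) * F t ^ (1 / 2 : ℝ)) := by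
          simp_rw [ENNReal_sqrt_sq, mul_pow, ENNReal_sqrt_sq]
          rw [lintegral_const_mul _ (by fun_prop), ENNReal.mul_rpow_of_nonneg _ _ (by norm_num)]
      _ ≤ H t ^ (1 / 2 : ℝ) * (2 * F t ^ (1 / 2 : ℝ)) := by
          gcongr
          calc (2 : ℝ≥0∞) ^ (1 / 2 : ℝ) ≤ (2 ^ 2 : ℝ≥0∞) ^ (1 / 2 : ℝ) :=
                ENNReal.rpow_le_rpow (by norm_num) (by norm_num)
            _ = 2 := ENNReal_sq_sqrt 2
      _ = _ := by ring
  · intro a b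
    unfold willmore
    have h1 : ∀ᵐ z ∂volume.restrict (closedCyl a b ∩ U),
        ENNReal.ofReal (‖meanCurv U f z‖ ^ 2 * gradSq U f z) =
        4 * ENNReal.ofReal (‖L z‖ ^ 2 / (2 * ‖V z‖ ^ 2)) := by
      filter_upwards [ae_mono (Measure.restrict_mono inter_subset_right le_rfl) hgrad,
        ae_mono (Measure.restrict_mono inter_subset_right le_rfl) hLeq] with z hz hzL
      rw [willmore_density_eq, hz, hzL, ENNReal.ofReal_mul (by norm_num)]
      simp
    rw [lintegral_congr_ae h1, lintegral_const_mul _ (by fun_prop), ← mul_assoc, hU,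
      restrict_closedCyl_inter, lintegral_prod_symm _ (by fun_prop)]
    have : (1 / 4 : ℝ≥0∞) * 4 = 1 := by
      rw [one_div]; exact ENNReal.inv_mul_cancel (by simp) (by simp)
    rw [this, one_mul]
  · filter_upwards [sL] with t h1 ht m
    refine (enorm_casCoeff_le _ _).trans (le_of_eq ?_)
    congr 1
    refine lintegral_congr_ae ?_
    filter_upwards [h1 ht] with θ hθ
    rw [hθ]
  · filter_upwards [sV, sC] with t h1 h2 ht m
    refine (enorm_casCoeff_le _ _).trans ?_
    refine le_trans (le_of_eq ?_) (coeffV t)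
    congr 1
    refine lintegral_congr_ae ?_
    filter_upwards [h1 ht, h2 ht] with θ h3 h4
    rw [← ofReal_norm, ← h4, h3, ofReal_norm]
  · intro a b ha hb
    have hsub : closedCyl a b ⊆ U := closedCyl_subset_openCyl ha hb
    have hlap : MemLp (laplacian U f) (ENNReal.ofReal p) (volume.restrict (closedCyl a b)) := by
      rw [lapEq]
      exact ((hw0 0).2 _ (isCompact_closedCyl a b) hsub).add
        ((hw1 1).2 _ (isCompact_closedCyl a b) hsub)
    have hLp : MemLp L (ENNReal.ofReal p) (volume.restrict (closedCyl a b)) :=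
      (memLp_congr_ae (ae_mono (Measure.restrict_mono hsub le_rfl) hLeq)).1 hlap
    have hp0 : 0 < p := by linarith
    have h1 := (eLpNorm_lt_top_iff_lintegral_rpow_enorm_lt_top (by simpa using hp0) (by simp)).1
      hLp.eLpNorm_lt_top
    rw [ENNReal.toReal_ofReal hp0.le] at h1
    have hres : (volume : Measure Cylinder).restrict (closedCyl a b) =
        (volume : Measure (AddCircle (2 * Real.pi))).prod (volume.restrict (Icc a b)) := by
      have h2 := restrict_closedCyl_inter a b (-T) T
      have h3 : Icc a b ⊆ Ioo (-T) T := fun t ht => ⟨ha.trans_le ht.1, ht.2.trans_lt hb⟩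
      rwa [inter_eq_left.2 hsub, inter_eq_left.2 h3] at h2
    rw [hres, lintegral_prod_symm _ (by fun_prop)] at h1
    -- Hölder on the circle, whose length is finite, passes from `L^p` on the cylinder to `L^p` in
    -- the height.
    have hJ : ∀ t, γ t ^ p ≤ ((volume : Measure (AddCircle (2 * Real.pi))) univ ^
        (1 / p.conjExponent)) ^ p * ∫⁻ θ, ‖L (θ, t)‖ₑ ^ p := by
      intro t
      have hc : p.HolderConjugate p.conjExponent := Real.HolderConjugate.conjExponent hp
      have h2 := ENNReal.lintegral_mul_le_Lp_mul_Lq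
        (volume : Measure (AddCircle (2 * Real.pi))) hc (f := fun θ => ‖L (θ, t)‖ₑ)
        (g := fun _ => 1) ((hLs t).enorm).aemeasurable aemeasurable_const
      simp only [Pi.mul_apply, mul_one, ENNReal.one_rpow, lintegral_const, one_mul] at h2
      calc γ t ^ p ≤ _ := ENNReal.rpow_le_rpow h2 hp0.le
        _ = _ := by
          rw [ENNReal.mul_rpow_of_nonneg _ _ hp0.le, mul_comm, ← ENNReal.rpow_mul _ (1 / p) p,
            one_div_mul_cancel hp0.ne', ENNReal.rpow_one]
    refine (lintegral_mono hJ).trans_lt ?_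
    have hfin : ((volume : Measure (AddCircle (2 * Real.pi))) univ ^
        (1 / p.conjExponent)) ^ p ≠ ⊤ := by
      have hc : p.HolderConjugate p.conjExponent := Real.HolderConjugate.conjExponent hp
      refine ENNReal.rpow_ne_top_of_nonneg hp0.le (ENNReal.rpow_ne_top_of_nonneg ?_
        (measure_ne_top _ _))
      exact one_div_nonneg.2 hc.symm.nonneg
    rw [lintegral_const_mul' _ _ hfin]
    exact ENNReal.mul_lt_top hfin.lt_top h1

end WillmoreNeck
end

noncomputable section
namespace WillmoreNeck
variable {n : ℕ}

/-! ### Cutoff functions and kernel inequalities -/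

/-- Cutoff functions equal to `1` on `[-(L - 1), L - 1]` and supported in `[-L, L]`, whose first two
derivatives are bounded by `M`. -/
structure IsCutoff (M L : ℝ) (χ : ℝ → ℝ) : Prop where
  smooth : ContDiff ℝ ∞ χ
  tsupport_subset : tsupport χ ⊆ Icc (-L) L
  nonneg : ∀ t, 0 ≤ χ t
  le_one : ∀ t, χ t ≤ 1
  eq_one : ∀ t, |t| ≤ L - 1 → χ t = 1
  deriv_le : ∀ t, |deriv χ t| ≤ M
  deriv_deriv_le : ∀ t, |deriv (deriv χ) t| ≤ M

theorem IsCutoff.hasCompactSupport {M L : ℝ} {χ : ℝ → ℝ} (h : IsCutoff M L χ) :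
    HasCompactSupport χ :=
  isCompact_Icc.of_isClosed_subset (isClosed_tsupport χ) h.tsupport_subset

theorem IsCutoff.deriv_eq_zero_of_lt {M L : ℝ} {χ : ℝ → ℝ} (h : IsCutoff M L χ) {t : ℝ}
    (ht : |t| < L - 1) : deriv χ t = 0 ∧ deriv (deriv χ) t = 0 := by
  have h1 : ∀ᶠ s in 𝓝 t, |s| < L - 1 := continuous_abs.continuousAt.eventually_lt_const ht
  have h2 : χ =ᶠ[𝓝 t] fun _ => 1 := h1.mono fun s hs => h.eq_one s hs.le
  have h3 : deriv χ =ᶠ[𝓝 t] fun _ => 0 := by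
    have := h2.deriv
    simpa using this
  exact ⟨h3.eq_of_nhds, by rw [h3.deriv_eq]; simp⟩

theorem IsCutoff.eq_zero_of_notMem {M L : ℝ} {χ : ℝ → ℝ} (h : IsCutoff M L χ) {t : ℝ}
    (ht : t ∉ Icc (-L) L) : χ t = 0 ∧ deriv χ t = 0 ∧ deriv (deriv χ) t = 0 := by
  have h1 : t ∉ tsupport χ := fun h' => ht (h.tsupport_subset h')
  refine ⟨image_eq_zero_of_notMem_tsupport h1, ?_, ?_⟩
  · by_contra h2
    exact h1 (support_deriv_subset h2)
  · by_contra h2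
    have h3 := support_deriv_subset h2
    exact h1 (closure_minimal support_deriv_subset (isClosed_tsupport χ) h3)

/-- The transition layers have length one whatever `L` is, so the derivative bounds are uniform over
arbitrarily long cylinders. -/
theorem exists_isCutoff : ∃ M : ℝ, 0 ≤ M ∧ ∀ L : ℝ, ∃ χ : ℝ → ℝ, IsCutoff M L χ := by
  let S := Real.smoothTransition
  have hS : ContDiff ℝ ∞ S := contDiff_smoothTransition
  have hS' : ContDiff ℝ ∞ (deriv S) := ((contDiff_infty_iff_deriv (𝕜 := ℝ)).1 hS).2
  obtain ⟨M₁, hM₁⟩ := continuous_deriv_smoothTransition.bounded_above_of_compact_support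
    hasCompactSupport_deriv_smoothTransition
  obtain ⟨M₂, hM₂⟩ := (hS'.continuous_deriv (by simp)).bounded_above_of_compact_support
    (hasCompactSupport_deriv_smoothTransition.deriv)
  have h1 : ∀ x, |deriv S x| ≤ M₁ := hM₁
  have h2 : ∀ x, |deriv (deriv S) x| ≤ M₂ := hM₂
  have hM₁0 : 0 ≤ M₁ := (abs_nonneg _).trans (h1 0)
  have hM₂0 : 0 ≤ M₂ := (abs_nonneg _).trans (h2 0)
  have hS1 : ∀ x, |S x| ≤ 1 := fun x => by
    rw [abs_of_nonneg (Real.smoothTransition.nonneg x)]; exact Real.smoothTransition.le_one x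
  refine ⟨2 * M₁ + 2 * M₂ + 2 * M₁ ^ 2, by positivity, fun L => ?_⟩
  let χ : ℝ → ℝ := fun t => S (t + L) * S (L - t)
  have dS : ∀ x, HasDerivAt S (deriv S x) x := fun x =>
    (hS.differentiable (by simp) x).hasDerivAt
  have dS' : ∀ x, HasDerivAt (deriv S) (deriv (deriv S) x) x := fun x =>
    (hS'.differentiable (by simp) x).hasDerivAt
  have ha : ∀ t, HasDerivAt (fun t => t + L) 1 t := fun t => (hasDerivAt_id t).add_const L
  have hb : ∀ t, HasDerivAt (fun t => L - t) (-1) t := fun t => (hasDerivAt_id t).const_sub L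
  have d1 : ∀ t, HasDerivAt χ (deriv S (t + L) * S (L - t) - S (t + L) * deriv S (L - t)) t := by
    intro t
    have := ((dS (t + L)).comp t (ha t)).mul ((dS (L - t)).comp t (hb t))
    refine this.congr_deriv ?_
    simp only [Function.comp_apply]; ring
  have e1 : deriv χ = fun t => deriv S (t + L) * S (L - t) - S (t + L) * deriv S (L - t) :=
    funext fun t => (d1 t).deriv
  have d2 : ∀ t, HasDerivAt (deriv χ) (deriv (deriv S) (t + L) * S (L - t) -
      2 * (deriv S (t + L) * deriv S (L - t)) + S (t + L) * deriv (deriv S) (L - t)) t := by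
    intro t
    rw [e1]
    have := (((dS' (t + L)).comp t (ha t)).mul ((dS (L - t)).comp t (hb t))).sub
      (((dS (t + L)).comp t (ha t)).mul ((dS' (L - t)).comp t (hb t)))
    refine this.congr_deriv ?_
    simp only [Function.comp_apply]; ring
  have hmul : ∀ {x y a b : ℝ}, |x| ≤ a → |y| ≤ b → |x * y| ≤ a * b := fun {x y a b} hx hy => by
    rw [abs_mul]; exact mul_le_mul hx hy (abs_nonneg _) ((abs_nonneg _).trans hx)
  refine ⟨χ, ?_, ?_, ?_, ?_, ?_, ?_, ?_⟩
  · exact (hS.comp (contDiff_id.add contDiff_const)).mul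
      (hS.comp (contDiff_const.sub contDiff_id))
  · refine closure_minimal (fun t ht => ?_) isClosed_Icc
    by_contra h
    rw [mem_Icc, not_and_or, not_le, not_le] at h
    apply ht
    rcases h with h | h
    · have : S (t + L) = 0 := Real.smoothTransition.zero_of_nonpos (by linarith)
      simp [χ, this]
    · have : S (L - t) = 0 := Real.smoothTransition.zero_of_nonpos (by linarith)
      simp [χ, this]
  · exact fun t => mul_nonneg (Real.smoothTransition.nonneg _) (Real.smoothTransition.nonneg _)
  · exact fun t => mul_le_one₀ (Real.smoothTransition.le_one _) (Real.smoothTransition.nonneg _)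
      (Real.smoothTransition.le_one _)
  · intro t ht
    obtain ⟨h3, h4⟩ := abs_le.1 ht
    have e2 : S (t + L) = 1 := Real.smoothTransition.one_of_one_le (by linarith)
    have e3 : S (L - t) = 1 := Real.smoothTransition.one_of_one_le (by linarith)
    simp [χ, e2, e3]
  · intro t
    rw [(d1 t).deriv]
    have h3 := hmul (h1 (t + L)) (hS1 (L - t))
    have h4 := hmul (hS1 (t + L)) (h1 (L - t))
    have h5 := abs_sub (deriv S (t + L) * S (L - t)) (S (t + L) * deriv S (L - t))
    nlinarith [sq_nonneg M₁]
  · intro t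
    rw [(d2 t).deriv]
    have h3 := abs_le.1 (hmul (h2 (t + L)) (hS1 (L - t)))
    have h4 := abs_le.1 (hmul (hS1 (t + L)) (h2 (L - t)))
    have h5 := abs_le.1 (hmul (h1 (t + L)) (h1 (L - t)))
    rw [abs_le]
    constructor <;> nlinarith [sq_nonneg M₁]

/-- With `y = μ|x|`, three quarters of the exponential are spent on `exp (-3y/4) ≤ 2 y^{-α}` and the
rest stays as decay. The extracted `μ^{-α}` is what later makes the modes summable. -/
theorem exp_neg_mul_le_kerP {α μ : ℝ} (h0 : 0 ≤ α) (h1 : α ≤ 1) (hμ : 1 ≤ μ) {x : ℝ} (hx : x ≠ 0) :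
    Real.exp (-μ * |x|) ≤ 2 * μ ^ (-α) * kerP α x := by
  have hx' : 0 < |x| := abs_pos.2 hx
  have hμ0 : 0 < μ := by linarith
  set y := μ * |x| with hy
  have hy0 : 0 < y := mul_pos hμ0 hx'
  have h2 : y ^ α ≤ 1 + y := by
    rcases le_total y 1 with h | h
    · exact (Real.rpow_le_one hy0.le h h0).trans (by linarith)
    · calc y ^ α ≤ y ^ (1 : ℝ) := Real.rpow_le_rpow_of_exponent_le h h1
        _ ≤ 1 + y := by rw [Real.rpow_one]; linarith
  have h3 : 1 + y ≤ 2 * Real.exp (3 / 4 * y) := by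
    linarith [Real.add_one_le_exp (3 / 4 * y)]
  have h4 : Real.exp (-y) = Real.exp (-(1 / 4) * y) * Real.exp (-(3 / 4 * y)) := by
    rw [← Real.exp_add]; congr 1; ring
  have h5 : Real.exp (-(1 / 4) * y) ≤ Real.exp (-(1 / 4) * |x|) := by
    rw [Real.exp_le_exp, hy]
    nlinarith
  have h6 : Real.exp (-(3 / 4 * y)) ≤ 2 * y ^ (-α) := by
    rw [Real.exp_neg, Real.rpow_neg hy0.le, ← div_eq_mul_inv, inv_le_comm₀ (Real.exp_pos _)
      (by positivity), inv_div, div_le_iff₀ (by norm_num)]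
    linarith
  have e1 : -μ * |x| = -y := by rw [hy]; ring
  rw [e1, h4]
  unfold kerP
  have e2 : y ^ (-α) = μ ^ (-α) * |x| ^ (-α) := Real.mul_rpow hμ0.le (abs_nonneg _)
  calc Real.exp (-(1 / 4) * y) * Real.exp (-(3 / 4 * y))
      ≤ Real.exp (-(1 / 4) * |x|) * (2 * y ^ (-α)) := by gcongr
    _ = _ := by rw [e2]; ring

/-- The geometric series equals `exp (-x) / (2 sinh x)`, and `x ≤ sinh x`. -/
theorem tsum_exp_neg_mul_le {x : ℝ} (hx : 0 < x) :
    ∑' m : ℕ, ENNReal.ofReal (Real.exp (-(2 * (m + 1)) * x)) ≤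
      ENNReal.ofReal (Real.exp (-(1 / 2) * x) / (2 * x)) := by
  set q := Real.exp (-(2 * x)) with hq
  have hq0 : 0 < q := Real.exp_pos _
  have hq1 : q < 1 := by rw [hq, Real.exp_lt_one_iff]; linarith
  have e1 : ∀ m : ℕ, Real.exp (-(2 * (m + 1)) * x) = q * q ^ m := by
    intro m
    rw [hq, ← Real.exp_nat_mul, ← Real.exp_add]; congr 1; ring
  simp_rw [e1]
  rw [← ENNReal.ofReal_tsum_of_nonneg (fun m => by positivity)
    ((summable_geometric_of_lt_one hq0.le hq1).mul_left q), tsum_mul_left,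
    tsum_geometric_of_lt_one hq0.le hq1]
  refine ENNReal.ofReal_le_ofReal ?_
  rw [← div_eq_mul_inv, div_le_div_iff₀ (by linarith) (by linarith)]
  have h1 : 2 * x ≤ Real.exp x - Real.exp (-x) := by
    have := Real.self_le_sinh_iff.2 hx.le
    rw [Real.sinh_eq] at this
    linarith
  have h2 : q = Real.exp (-x) * Real.exp (-x) := by rw [hq, ← Real.exp_add]; congr 1; ring
  have h3 : Real.exp x * Real.exp (-x) = 1 := by rw [← Real.exp_add]; simp
  have h4 : Real.exp (-x) ≤ Real.exp (-(1 / 2) * x) := by rw [Real.exp_le_exp]; linarith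
  have h5 : q * (2 * x) ≤ Real.exp (-x) * (1 - q) := by
    calc q * (2 * x) ≤ q * (Real.exp x - Real.exp (-x)) := by gcongr
      _ = Real.exp (-x) * (Real.exp x * Real.exp (-x) - Real.exp (-x) * Real.exp (-x)) := by
        rw [h2]; ring
      _ = _ := by rw [h3, ← h2]
  exact h5.trans (mul_le_mul_of_nonneg_right h4 (by linarith))

theorem tsum_int_exp_neg_mul_le {x : ℝ} (hx : x ≠ 0) :
    ∑' m : ℤ, (if m = 0 then 0 else ENNReal.ofReal (Real.exp (-(2 * |(m : ℝ)|) * |x|))) ≤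
      ENNReal.ofReal (Real.exp (-(1 / 2) * |x|) / |x|) := by
  have hx' : 0 < |x| := abs_pos.2 hx
  have h := tsum_exp_neg_mul_le hx'
  rw [tsum_of_add_one_of_neg_add_one ENNReal.summable ENNReal.summable]
  have e1 : ∀ m : ℕ, (if (m + 1 : ℤ) = 0 then (0 : ℝ≥0∞) else
      ENNReal.ofReal (Real.exp (-(2 * |((m + 1 : ℤ) : ℝ)|) * |x|))) =
      ENNReal.ofReal (Real.exp (-(2 * (m + 1)) * |x|)) := by
    intro m
    rw [if_neg (by omega)]
    push_cast
    rw [abs_of_nonneg (by positivity : (0 : ℝ) ≤ m + 1)]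
  have e2 : ∀ m : ℕ, (if -(m + 1 : ℤ) = 0 then (0 : ℝ≥0∞) else
      ENNReal.ofReal (Real.exp (-(2 * |((-(m + 1 : ℤ) : ℤ) : ℝ)|) * |x|))) =
      ENNReal.ofReal (Real.exp (-(2 * (m + 1)) * |x|)) := by
    intro m
    rw [if_neg (by omega)]
    push_cast
    rw [abs_neg, abs_of_nonneg (by positivity : (0 : ℝ) ≤ m + 1)]
  simp_rw [e1, e2]
  rw [if_pos trivial, add_zero]
  refine (add_le_add h h).trans ?_
  rw [← ENNReal.ofReal_add (by positivity) (by positivity)]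
  refine ENNReal.ofReal_le_ofReal (le_of_eq ?_)
  field_simp
  ring

theorem sq_lintegral_weight_le {a b w g : ℝ → ℝ≥0∞} (ha : Measurable a) (hb : Measurable b)
    (hg : Measurable g) (h : ∀ᵐ s, w s ^ 2 ≤ a s * b s) :
    (∫⁻ s, w s * g s) ^ 2 ≤ (∫⁻ s, a s * g s) * ∫⁻ s, b s * g s := by
  have h1 : ∫⁻ s, w s * g s ≤
      ∫⁻ s, (a s * g s) ^ (1 / 2 : ℝ) * (b s * g s) ^ (1 / 2 : ℝ) := by
    refine lintegral_mono_ae ?_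
    filter_upwards [h] with s hs
    rw [← ENNReal.mul_rpow_of_nonneg _ _ (by norm_num)]
    calc w s * g s = ((w s * g s) ^ 2) ^ (1 / 2 : ℝ) := (ENNReal_sq_sqrt _).symm
      _ ≤ _ := by
        refine ENNReal.rpow_le_rpow ?_ (by norm_num)
        calc (w s * g s) ^ 2 = w s ^ 2 * (g s * g s) := by ring
          _ ≤ a s * b s * (g s * g s) := by gcongr
          _ = _ := by ring
  refine (pow_le_pow_left' h1 2).trans ((sq_lintegral_mul_le (by fun_prop) (by fun_prop)).trans ?_)
  simp_rw [ENNReal_sqrt_sq]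
  exact le_rfl

/-- Summing the squares of the exponential potentials over all frequencies. -/
theorem tsum_sq_lintegral_exp_le {α : ℝ} {g : ℝ → ℝ≥0∞} (hg : Measurable g) (t : ℝ) :
    ∑' m : ℤ, (if m = 0 then 0 else
      (∫⁻ s, ENNReal.ofReal (Real.exp (-|(m : ℝ)| * |t - s|)) * g s) ^ 2) ≤
      pot (kerP α) g t * pot (kerQ α) g t := by
  -- `b m` is the squared exponential divided by `kerP`. Cauchy–Schwarz thus puts the factor `kerP`,
  -- independent of `m`, in one integral, and only `b` is summed; the sum is at most `kerQ`, with
  -- exponential rate `1/4 - 1/2 = -1/4`.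
  let b : ℤ → ℝ → ℝ≥0∞ := fun m s => if m = 0 then 0 else
    ENNReal.ofReal (|t - s| ^ α * Real.exp (1 / 4 * |t - s|)) *
      ENNReal.ofReal (Real.exp (-(2 * |(m : ℝ)|) * |t - s|))
  have hb : ∀ m, Measurable (b m) := by
    intro m
    simp only [b]
    split_ifs
    · exact measurable_const
    · fun_prop
  have hne : ∀ᵐ s : ℝ, s ≠ t := by
    rw [ae_iff]; simp
  have h1 : ∀ m : ℤ, (if m = 0 then 0 else
      (∫⁻ s, ENNReal.ofReal (Real.exp (-|(m : ℝ)| * |t - s|)) * g s) ^ 2) ≤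
      pot (kerP α) g t * ∫⁻ s, b m s * g s := by
    intro m
    split_ifs with hm
    · exact zero_le
    · unfold pot
      refine sq_lintegral_weight_le ((measurable_kerP α).comp (by fun_prop)).ennreal_ofReal
        (hb m) hg ?_
      filter_upwards [hne] with s hs
      have hx : 0 < |t - s| := abs_pos.2 (sub_ne_zero.2 hs.symm)
      simp only [b, if_neg hm]
      rw [← ENNReal.ofReal_pow (by positivity), ← ENNReal.ofReal_mul (by positivity),
        ← ENNReal.ofReal_mul (kerP_nonneg _ _)]
      refine ENNReal.ofReal_le_ofReal (le_of_eq ?_)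
      unfold kerP
      rw [Real.rpow_neg hx.le]
      have h2 : |t - s| ^ α ≠ 0 := (Real.rpow_pos_of_pos hx α).ne'
      have h3 : Real.exp (-(1 / 4) * |t - s|) * Real.exp (1 / 4 * |t - s|) = 1 := by
        rw [← Real.exp_add]; simp
      have h4 : Real.exp (-|(m : ℝ)| * |t - s|) ^ 2 = Real.exp (-(2 * |(m : ℝ)|) * |t - s|) := by
        rw [← Real.exp_nat_mul]; congr 1; push_cast; ring
      rw [h4]
      field_simp
      rw [← Real.exp_add]; simp
  refine (ENNReal.tsum_le_tsum h1).trans ?_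
  have h5 := lintegral_tsum (μ := volume) (f := fun m s => b m s * g s)
    fun m => ((hb m).mul hg).aemeasurable
  rw [ENNReal.tsum_mul_left, ← h5]
  gcongr
  unfold pot
  refine lintegral_mono_ae ?_
  filter_upwards [hne] with s hs
  have hx : 0 < |t - s| := abs_pos.2 (sub_ne_zero.2 hs.symm)
  rw [ENNReal.tsum_mul_right]
  gcongr
  have h2 : ∑' m : ℤ, b m s = ENNReal.ofReal (|t - s| ^ α * Real.exp (1 / 4 * |t - s|)) *
      ∑' m : ℤ, (if m = 0 then 0 else ENNReal.ofReal (Real.exp (-(2 * |(m : ℝ)|) * |t - s|))) := by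
    rw [← ENNReal.tsum_mul_left]
    refine tsum_congr fun m => ?_
    simp only [b]
    split_ifs <;> simp
  rw [h2]
  calc _ ≤ ENNReal.ofReal (|t - s| ^ α * Real.exp (1 / 4 * |t - s|)) *
        ENNReal.ofReal (Real.exp (-(1 / 2) * |t - s|) / |t - s|) := by
        gcongr
        exact tsum_int_exp_neg_mul_le (sub_ne_zero.2 hs.symm)
    _ = ENNReal.ofReal (kerQ α (t - s)) := by
        rw [← ENNReal.ofReal_mul (by positivity)]
        congr 1
        unfold kerQ
        rw [Real.rpow_sub_one hx.ne']
        have h3 : Real.exp (1 / 4 * |t - s|) * Real.exp (-(1 / 2) * |t - s|) =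
            Real.exp (-(1 / 4) * |t - s|) := by
          rw [← Real.exp_add]; congr 1; ring
        rw [← h3]; ring

end WillmoreNeck
end

noncomputable section
namespace WillmoreNeck
variable {n : ℕ}

/-! ### Estimates for a single map -/

/-- Hölder's inequality: the bound on `α` puts `kerP` in the dual space `L^q`, since `α q ≤ 1/2 <
1`. Only finiteness of `K` matters, as it feeds the absorption argument. -/
theorem exists_pot_kerP_le {p α : ℝ} (hp : 1 < p) (hα : α ≤ (1 - 1 / p) / 2)
    {g : ℝ → ℝ≥0∞} (hg : Measurable g) (h : ∫⁻ s, g s ^ p < ⊤) :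
    ∃ K : ℝ≥0∞, K ≠ ⊤ ∧ ∀ t, pot (kerP α) g t ≤ K := by
  have hc : p.HolderConjugate p.conjExponent := Real.HolderConjugate.conjExponent hp
  set q := p.conjExponent with hq
  have hq0 : 0 < q := hc.symm.pos
  have hαq : α * q ≤ 1 / 2 := by
    have h1 : q⁻¹ = 1 - p⁻¹ := by have := hc.inv_add_inv_eq_one; linarith
    have h2 : α ≤ q⁻¹ / 2 := by rw [h1]; simpa using hα
    calc α * q ≤ q⁻¹ / 2 * q := by gcongr
      _ = 1 / 2 := by field_simp
  have hJ := lintegral_abs_rpow_mul_exp_lt_top (b := -(α * q)) (c := 1 / 4 * q) (by linarith)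
    (by positivity)
  set J := ∫⁻ x : ℝ, ENNReal.ofReal (|x| ^ (-(α * q)) * Real.exp (-(1 / 4 * q) * |x|))
  have e1 : ∀ x, ENNReal.ofReal (kerP α x) ^ q =
      ENNReal.ofReal (|x| ^ (-(α * q)) * Real.exp (-(1 / 4 * q) * |x|)) := by
    intro x
    rw [ENNReal.ofReal_rpow_of_nonneg (kerP_nonneg _ _) hq0.le]
    unfold kerP
    rw [Real.mul_rpow (by positivity) (by positivity), ← Real.rpow_mul (abs_nonneg _),
      ← Real.exp_mul]
    congr 3 <;> ring
  refine ⟨J ^ (1 / q) * (∫⁻ s, g s ^ p) ^ (1 / p), ?_, fun t => ?_⟩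
  · exact ENNReal.mul_ne_top (ENNReal.rpow_ne_top_of_nonneg (by positivity) hJ.ne)
      (ENNReal.rpow_ne_top_of_nonneg (by positivity) h.ne)
  · have hk : Measurable fun s => ENNReal.ofReal (kerP α (t - s)) :=
      ((measurable_kerP α).comp (by fun_prop)).ennreal_ofReal
    have h2 := ENNReal.lintegral_mul_le_Lp_mul_Lq volume hc.symm hk.aemeasurable hg.aemeasurable
    have h3 : ∫⁻ s, ENNReal.ofReal (kerP α (t - s)) ^ q = J := by
      rw [lintegral_sub_left_eq_self (fun x => ENNReal.ofReal (kerP α x) ^ q) t]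
      exact lintegral_congr e1
    rw [h3] at h2
    exact h2

/-- The part of the source term carried by the derivatives of the cutoff function. -/
def layerTerm (M L : ℝ) (F : ℝ → ℝ≥0∞) : ℝ → ℝ≥0∞ :=
  {s : ℝ | L - 1 ≤ |s| ∧ |s| ≤ L}.indicator fun s => ENNReal.ofReal (16 * M) * F s ^ (1 / 2 : ℝ)

theorem measurableSet_layer (L : ℝ) : MeasurableSet {s : ℝ | L - 1 ≤ |s| ∧ |s| ≤ L} :=
  (measurableSet_le (f := fun _ : ℝ => L - 1) (g := fun s => |s|) measurable_const
    (by fun_prop)).inter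
    (measurableSet_le (f := fun s => |s|) (g := fun _ : ℝ => L) (by fun_prop) measurable_const)

theorem measurable_layerTerm {M L : ℝ} {F : ℝ → ℝ≥0∞} (hF : Measurable F) :
    Measurable (layerTerm M L F) := by
  unfold layerTerm
  exact Measurable.indicator (by fun_prop) (measurableSet_layer L)

theorem lintegral_layerTerm_sq_le {M L T : ℝ} {F : ℝ → ℝ≥0∞} (hLT : L < T) :
    ∫⁻ s, layerTerm M L F s ^ 2 ≤
      ENNReal.ofReal (16 * M) ^ 2 * ∫⁻ s in Ioo (-T) T, F s := by
  rw [← lintegral_const_mul' _ _ (ENNReal.pow_ne_top ENNReal.ofReal_ne_top),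
    ← lintegral_indicator measurableSet_Ioo]
  refine lintegral_mono fun s => ?_
  unfold layerTerm
  by_cases hs : L - 1 ≤ |s| ∧ |s| ≤ L
  · have hs' : s ∈ Ioo (-T) T := abs_lt.1 (hs.2.trans_lt hLT)
    rw [indicator_of_mem (mem_ofPred_eq ▸ hs), indicator_of_mem hs', mul_pow, ENNReal_sqrt_sq]
  · rw [indicator_of_notMem (by simpa using hs)]
    simp

/-- Pointwise bound of a Fourier mode by the exponential potential of the source. -/
theorem SliceData.mode_le {T p R M L : ℝ} {f : Cylinder → Target n} {F H γ : ℝ → ℝ≥0∞}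
    (hD : SliceData T p f F H γ) (hf : MemFpConf (openCyl (-T) T) p R f) (hLT : L < T)
    {χ : ℝ → ℝ} (hχ : IsCutoff M L χ) {m : ℤ} (hm : m ≠ 0) (t : ℝ) :
    ENNReal.ofReal |(m : ℝ)| * (ENNReal.ofReal (χ t) * ‖sliceCoeff m f t‖ₑ) ≤
      ∫⁻ s, ENNReal.ofReal (Real.exp (-|(m : ℝ)| * |t - s|)) *
        (ENNReal.ofReal (χ s) * (2 * γ s) + layerTerm M L F s) := by
  set μ := |(m : ℝ)| with hμd
  have hμ1 : 1 ≤ μ := by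
    have : (1 : ℤ) ≤ |m| := Int.one_le_abs hm
    rw [hμd, ← Int.cast_abs]; exact_mod_cast this
  have hμ0 : 0 < μ := by linarith
  have hM : 0 ≤ M := (abs_nonneg _).trans (hχ.deriv_le 0)
  have hs : tsupport χ ⊆ Ioo (-T) T := hχ.tsupport_subset.trans
    fun s hs => ⟨by linarith [hs.1], by linarith [hs.2]⟩
  have h1 := green_estimate hμ0 (continuousOn_sliceCoeff hf.continuousOn hf.bounded m)
    (g := sliceCoeff m (laplacian (openCyl (-T) T) f))
    (fun ζ h2 h3 h4 => by
      rw [hμd, sq_abs]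
      exact integral_sliceCoeff_laplacian hf.memW2pLoc m h2 h3 h4) hχ.smooth
    hχ.hasCompactSupport hs t
  rw [enorm_smul, ← ofReal_norm (χ t), Real.norm_eq_abs, abs_of_nonneg (hχ.nonneg t)] at h1
  calc ENNReal.ofReal μ * (ENNReal.ofReal (χ t) * ‖sliceCoeff m f t‖ₑ)
      ≤ ENNReal.ofReal μ * _ := mul_le_mul_right h1 _
    _ = ∫⁻ s, ENNReal.ofReal μ * (ENNReal.ofReal (Real.exp (-μ * |t - s|) / μ) *
          (ENNReal.ofReal (|deriv χ s| * μ + |deriv (deriv χ) s|) * ‖sliceCoeff m f s‖ₑ +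
          ENNReal.ofReal |χ s| * ‖sliceCoeff m (laplacian (openCyl (-T) T) f) s‖ₑ)) := by
        rw [lintegral_const_mul' _ _ (by simp)]
    _ ≤ _ := ?_
  refine lintegral_mono_ae ?_
  filter_upwards [hD.coeff_le, hD.laplacian_le] with s h2 h3
  have e1 : ∀ x : ℝ≥0∞, ENNReal.ofReal μ * (ENNReal.ofReal (Real.exp (-μ * |t - s|) / μ) * x) =
      ENNReal.ofReal (Real.exp (-μ * |t - s|)) * x := by
    intro x
    rw [← mul_assoc, ← ENNReal.ofReal_mul hμ0.le, mul_div_cancel₀ _ hμ0.ne']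
  rw [e1]
  refine mul_le_mul_right ?_ _
  rw [add_comm]
  by_cases hsL : s ∈ Icc (-L) L
  · have hsT : s ∈ Ioo (-T) T := ⟨by linarith [hsL.1], by linarith [hsL.2]⟩
    rw [abs_of_nonneg (hχ.nonneg s)]
    gcongr
    · exact h3 hsT m
    · unfold layerTerm
      by_cases hl : L - 1 ≤ |s|
      · rw [indicator_of_mem (mem_ofPred_eq ▸ ⟨hl, abs_le.2 hsL⟩)]
        -- Since `μ ≥ 1` the cutoff terms are at most `2Mμ`, and `μ` times the coefficient is at
        -- most `8 F^{1/2}`; this is the `16M` in `layerTerm`.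
        calc ENNReal.ofReal (|deriv χ s| * μ + |deriv (deriv χ) s|) * ‖sliceCoeff m f s‖ₑ
            ≤ ENNReal.ofReal (2 * M * μ) * ‖sliceCoeff m f s‖ₑ := by
              gcongr
              have a1 := hχ.deriv_le s
              have a2 := hχ.deriv_deriv_le s
              nlinarith
          _ = ENNReal.ofReal (2 * M) * (ENNReal.ofReal μ * ‖sliceCoeff m f s‖ₑ) := by
              rw [ENNReal.ofReal_mul (by positivity), mul_assoc]
          _ ≤ ENNReal.ofReal (2 * M) * (8 * F s ^ (1 / 2 : ℝ)) := by
              exact mul_le_mul_right (h2 hsT m) _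
          _ = _ := by
              rw [← mul_assoc]
              congr 1
              rw [show (16 : ℝ) * M = 2 * M * 8 by ring, ENNReal.ofReal_mul (p := 2 * M) (by positivity)]
              simp
      · obtain ⟨a1, a2⟩ := hχ.deriv_eq_zero_of_lt (not_le.1 hl)
        rw [a1, a2]
        simp
  · obtain ⟨a1, a2, a3⟩ := hχ.eq_zero_of_notMem hsL
    rw [a1, a2, a3]
    simp

/-- Decay of the Fourier modes and of the energy density on the part of the cylinder where the
Willmore energy of unit pieces is small. -/
theorem exists_slice_decay {p : ℝ} (hp : 1 < p) :
    ∃ α ε C : ℝ, 0 < α ∧ α ≤ 1 / 4 ∧ 0 < ε ∧ 0 < C ∧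
      ∀ (n : ℕ) (T R L : ℝ) (f : Cylinder → Target n) (F H γ : ℝ → ℝ≥0∞) (E : ℝ≥0∞),
      L < T → MemFpConf (openCyl (-T) T) p R f → SliceData T p f F H γ → E ≠ ⊤ →
      ∫⁻ t in Ioo (-T) T, F t ≤ E →
      (∀ v ∈ Icc (-L) L, ∫⁻ t in Icc v (v + 1) ∩ Ioo (-T) T, H t ≤ ENNReal.ofReal ε) →
      (∀ m : ℤ, m ≠ 0 → ∀ t, |t| ≤ L - 1 → ‖sliceCoeff m f t‖ₑ ≤
        ENNReal.ofReal (C * |(m : ℝ)| ^ (-(1 + α)) * wt L t) * E ^ (1 / 2 : ℝ)) ∧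
      ∀ r, ∫⁻ t in Icc (-(L - 1)) (L - 1), F t * ENNReal.ofReal (kerN α (t - r)) ≤
        ENNReal.ofReal (C * wt L r ^ 2) * E := by
  have hpinv : 1 / p < 1 := by rw [div_lt_one (by linarith)]; exact hp
  -- The bound `1/4` serves the kernel estimates; the other makes the potential of an `L^p` source
  -- finite.
  set α := min (1 / 4) ((1 - 1 / p) / 2) with hαd
  have hα0 : 0 < α := lt_min (by norm_num) (by linarith)
  have hα1 : α ≤ 1 / 4 := min_le_left _ _
  have hα2 : α ≤ (1 - 1 / p) / 2 := min_le_right _ _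
  obtain ⟨M, hM, hcut⟩ := exists_isCutoff
  obtain ⟨ε, C, hε, hC, core⟩ := exists_decay_of_integral_inequality hα0 hα1 one_pos
  -- The source is `2γ` and `γ ≤ 2 H^{1/2} F^{1/2}`; the factor `4 = √16` is absorbed into `H' = 16
  -- H`.
  refine ⟨α, ε / 16, 2 * C * (16 * M + 1) + C * (16 * M) ^ 2, hα0, hα1, by positivity,
    by positivity, ?_⟩
  intro n T R L f F H γ E hLT hf hD hEtop hE hH
  obtain ⟨χ, hχ⟩ := hcut L
  have hF := hD.measurable_F
  have hHm := hD.measurable_H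
  have hγ := hD.measurable_γ
  have hχm : Measurable χ := hχ.smooth.continuous.measurable
  have hLI : Icc (-L) L ⊆ Ioo (-T) T := fun s hs => ⟨by linarith [hs.1], by linarith [hs.2]⟩
  let b := layerTerm M L F
  have hb : Measurable b := measurable_layerTerm hF
  let g : ℝ → ℝ≥0∞ := fun s => ENNReal.ofReal (χ s) * (2 * γ s) + b s
  have hg : Measurable g := by fun_prop
  let A : ℝ → ℝ≥0∞ := fun s => ENNReal.ofReal (χ s) ^ 2 * F s
  have hA : Measurable A := by fun_prop
  -- Cut off to `[-L, L]`, where smallness is known, because the integral inequality asks for it on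
  -- all unit intervals of the line.
  let H' : ℝ → ℝ≥0∞ := (Icc (-L) L).indicator fun s => 16 * H s
  have hH' : Measurable H' := Measurable.indicator (by fun_prop) measurableSet_Icc
  let B : ℝ≥0∞ := ENNReal.ofReal (16 * M) ^ 2 * E
  have hmode : ∀ m : ℤ, m ≠ 0 → ∀ t,
      ENNReal.ofReal |(m : ℝ)| * (ENNReal.ofReal (χ t) * ‖sliceCoeff m f t‖ₑ) ≤
      ∫⁻ s, ENNReal.ofReal (Real.exp (-|(m : ℝ)| * |t - s|)) * g s :=
    fun m hm t => hD.mode_le hf hLT hχ hm t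
  have hAPQ : ∀ᵐ t, A t ≤ ENNReal.ofReal 1 * (pot (kerP α) g t * pot (kerQ α) g t) := by
    filter_upwards [hD.le_tsum] with t ht
    rw [ENNReal.ofReal_one, one_mul]
    by_cases htL : t ∈ Icc (-L) L
    · refine le_trans ?_ (tsum_sq_lintegral_exp_le hg t)
      calc A t ≤ ENNReal.ofReal (χ t) ^ 2 *
            ∑' m : ℤ, (ENNReal.ofReal |(m : ℝ)| * ‖sliceCoeff m f t‖ₑ) ^ 2 := by
            simp only [A]
            gcongr
            exact ht (hLI htL)
        _ = ∑' m : ℤ, (ENNReal.ofReal |(m : ℝ)| * (ENNReal.ofReal (χ t) *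
            ‖sliceCoeff m f t‖ₑ)) ^ 2 := by
            rw [← ENNReal.tsum_mul_left]
            exact tsum_congr fun m => by ring
        _ ≤ _ := by
            refine ENNReal.tsum_le_tsum fun m => ?_
            split_ifs with hm
            · simp [hm]
            · exact pow_le_pow_left' (hmode m hm t) 2
    · simp [A, (hχ.eq_zero_of_notMem htL).1]
  have hgle : ∀ᵐ s, g s ≤ H' s ^ (1 / 2 : ℝ) * A s ^ (1 / 2 : ℝ) + b s := by
    filter_upwards [hD.γ_le] with s hs
    simp only [g]
    refine add_le_add_left ?_ _
    by_cases hsL : s ∈ Icc (-L) L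
    · have e1 : H' s ^ (1 / 2 : ℝ) = 4 * H s ^ (1 / 2 : ℝ) := by
        simp only [H']
        rw [indicator_of_mem hsL, ENNReal.mul_rpow_of_nonneg _ _ (by norm_num),
          show (16 : ℝ≥0∞) = 4 ^ 2 by norm_num, ENNReal_sq_sqrt]
      have e2 : A s ^ (1 / 2 : ℝ) = ENNReal.ofReal (χ s) * F s ^ (1 / 2 : ℝ) := by
        simp only [A]
        rw [ENNReal.mul_rpow_of_nonneg _ _ (by norm_num), ENNReal_sq_sqrt]
      rw [e1, e2]
      calc ENNReal.ofReal (χ s) * (2 * γ s)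
          ≤ ENNReal.ofReal (χ s) * (2 * (2 * (H s ^ (1 / 2 : ℝ) * F s ^ (1 / 2 : ℝ)))) := by
            gcongr
            exact hs (hLI hsL)
        _ = _ := by ring
    · simp [(hχ.eq_zero_of_notMem hsL).1]
  have hb0 : ∀ s, |s| < L - 1 → b s = 0 := by
    intro s hs
    simp only [b, layerTerm]
    rw [indicator_of_notMem]
    simp only [mem_ofPred_eq, not_and]
    intro h; linarith
  have hB : ∫⁻ s, b s ^ 2 ≤ B := (lintegral_layerTerm_sq_le hLT).trans (by simp only [B]; gcongr)
  have hHε : ∀ v, ∫⁻ s in Icc v (v + 1), H' s ≤ ENNReal.ofReal ε := by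
    intro v
    have e1 : ∫⁻ s in Icc v (v + 1), H' s = 16 * ∫⁻ s in Icc (-L) L ∩ Icc v (v + 1), H s := by
      simp only [H']
      rw [lintegral_indicator measurableSet_Icc, Measure.restrict_restrict measurableSet_Icc,
        lintegral_const_mul _ hHm]
    have e2 : ∀ w ∈ Icc (-L) L, Icc (-L) L ∩ Icc v (v + 1) ⊆ Icc w (w + 1) →
        16 * ∫⁻ s in Icc (-L) L ∩ Icc v (v + 1), H s ≤ ENNReal.ofReal ε := by
      intro w hw hsub
      calc 16 * ∫⁻ s in Icc (-L) L ∩ Icc v (v + 1), H s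
          ≤ 16 * ENNReal.ofReal (ε / 16) := by
            gcongr
            exact (lintegral_mono_set (subset_inter hsub (inter_subset_left.trans hLI))).trans
              (hH w hw)
        _ = ENNReal.ofReal ε := by
            rw [show (16 : ℝ≥0∞) = ENNReal.ofReal 16 by simp, ← ENNReal.ofReal_mul (by norm_num)]
            congr 1; ring
    rw [e1]
    by_cases hv1 : v ≤ L
    · by_cases hv2 : -L ≤ v
      · exact e2 v ⟨hv2, hv1⟩ inter_subset_right
      -- A window starting before `-L` meets `[-L, L]` inside the window starting at `-L`.
      · by_cases hL0 : -L ≤ L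
        · refine e2 (-L) ⟨le_rfl, hL0⟩ fun s hs => ⟨hs.1.1, ?_⟩
          linarith [hs.2.2, not_le.1 hv2]
        · rw [Icc_eq_empty hL0]; simp
    · have : Icc (-L) L ∩ Icc v (v + 1) = ∅ := by
        rw [eq_empty_iff_forall_notMem]
        intro s hs
        linarith [hs.1.2, hs.2.1, not_le.1 hv1]
      rw [this]; simp
  -- A priori finiteness: the cut-off source lies in `L^p` because `Δf ∈ L^p_loc`, and the layer
  -- term lies in `L²` by the energy bound.
  have hfin : ∃ K : ℝ≥0∞, K ≠ ⊤ ∧ ∀ t, pot (kerP α) g t ≤ K := by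
    have h1 : ∫⁻ s, (ENNReal.ofReal (χ s) * (2 * γ s)) ^ p < ⊤ := by
      have h2 := hD.γ_rpow (-L) L (by linarith) hLT
      have hp0 : 0 ≤ p := by linarith
      calc ∫⁻ s, (ENNReal.ofReal (χ s) * (2 * γ s)) ^ p
          ≤ ∫⁻ s in Icc (-L) L, 2 ^ p * γ s ^ p := by
            rw [← lintegral_indicator measurableSet_Icc]
            refine lintegral_mono fun s => ?_
            by_cases hsL : s ∈ Icc (-L) L
            · rw [indicator_of_mem hsL, ← ENNReal.mul_rpow_of_nonneg _ _ hp0]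
              refine ENNReal.rpow_le_rpow (mul_le_of_le_one_left zero_le ?_) hp0
              rw [← ENNReal.ofReal_one]
              exact ENNReal.ofReal_le_ofReal (hχ.le_one s)
            · rw [indicator_of_notMem hsL, (hχ.eq_zero_of_notMem hsL).1]
              simp [show (0 : ℝ) < p by linarith]
        _ = 2 ^ p * ∫⁻ s in Icc (-L) L, γ s ^ p := by
            rw [lintegral_const_mul _ (by fun_prop)]
        _ < ⊤ := ENNReal.mul_lt_top (ENNReal.rpow_lt_top_of_nonneg hp0 (by simp)) h2
    obtain ⟨K₁, hK₁, h3⟩ := exists_pot_kerP_le hp hα2 (by fun_prop) h1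
    have h2 : ∫⁻ s, b s ^ (2 : ℝ) < ⊤ := by
      simp only [ENNReal.rpow_two]
      exact hB.trans_lt (ENNReal.mul_lt_top (ENNReal.pow_lt_top ENNReal.ofReal_lt_top) hEtop.lt_top)
    obtain ⟨K₂, hK₂, h4⟩ := exists_pot_kerP_le (α := α) one_lt_two (by linarith) hb h2
    refine ⟨K₁ + K₂, ENNReal.add_ne_top.2 ⟨hK₁, hK₂⟩, fun t => ?_⟩
    have h5 : pot (kerP α) g t = pot (kerP α) (fun s => ENNReal.ofReal (χ s) * (2 * γ s)) t +
        pot (kerP α) b t := by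
      unfold pot
      have hk : Measurable fun s => ENNReal.ofReal (kerP α (t - s)) :=
        ((measurable_kerP α).comp (by fun_prop)).ennreal_ofReal
      rw [← lintegral_add_left (by fun_prop)]
      refine lintegral_congr fun s => ?_
      simp only [g]
      rw [mul_add]
    rw [h5]
    exact add_le_add (h3 t) (h4 t)
  obtain ⟨c1, c2⟩ := core L g A H' b B hg hA hH' hb hAPQ hgle hb0 hB hHε hfin
  have hBs : B ^ (1 / 2 : ℝ) = ENNReal.ofReal (16 * M) * E ^ (1 / 2 : ℝ) := by
    simp only [B]
    rw [ENNReal.mul_rpow_of_nonneg _ _ (by norm_num), ENNReal_sq_sqrt]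
  refine ⟨fun m hm t ht => ?_, fun r => ?_⟩
  · set μ := |(m : ℝ)| with hμd
    have hμ1 : 1 ≤ μ := by
      have : (1 : ℤ) ≤ |m| := Int.one_le_abs hm
      rw [hμd, ← Int.cast_abs]; exact_mod_cast this
    have hμ0 : 0 < μ := by linarith
    have h1 := hmode m hm t
    rw [hχ.eq_one t ht, ENNReal.ofReal_one, one_mul] at h1
    have h2 : ∫⁻ s, ENNReal.ofReal (Real.exp (-μ * |t - s|)) * g s ≤
        ENNReal.ofReal (2 * μ ^ (-α)) * pot (kerP α) g t := by
      unfold pot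
      rw [← lintegral_const_mul' _ _ ENNReal.ofReal_ne_top]
      have hne : ∀ᵐ s : ℝ, s ≠ t := by rw [ae_iff]; simp
      refine lintegral_mono_ae ?_
      filter_upwards [hne] with s hs
      rw [← mul_assoc, ← ENNReal.ofReal_mul (by positivity)]
      gcongr
      exact exp_neg_mul_le_kerP hα0.le (by linarith) hμ1 (sub_ne_zero.2 hs.symm)
    have h3 : ENNReal.ofReal μ * ‖sliceCoeff m f t‖ₑ ≤ ENNReal.ofReal (2 * μ ^ (-α)) *
        (ENNReal.ofReal (C * wt L t) * (ENNReal.ofReal (16 * M) * E ^ (1 / 2 : ℝ))) := by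
      rw [← hBs]
      exact h1.trans (h2.trans (by gcongr; exact c1 t))
    have hw := wt_pos L t
    calc ‖sliceCoeff m f t‖ₑ = ENNReal.ofReal μ⁻¹ * (ENNReal.ofReal μ * ‖sliceCoeff m f t‖ₑ) := by
          rw [← mul_assoc, ← ENNReal.ofReal_mul (by positivity), inv_mul_cancel₀ hμ0.ne']
          simp
      _ ≤ ENNReal.ofReal μ⁻¹ * (ENNReal.ofReal (2 * μ ^ (-α)) *
        (ENNReal.ofReal (C * wt L t) * (ENNReal.ofReal (16 * M) * E ^ (1 / 2 : ℝ)))) := by gcongr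
      _ = ENNReal.ofReal (μ⁻¹ * (2 * μ ^ (-α) * (C * wt L t * (16 * M)))) * E ^ (1 / 2 : ℝ) := by
          rw [ENNReal.ofReal_mul (p := μ⁻¹) (by positivity), ENNReal.ofReal_mul (p := 2 * μ ^ (-α))
            (by positivity), ENNReal.ofReal_mul (p := C * wt L t) (by positivity)]
          ring
      _ ≤ _ := by
          refine mul_le_mul_left (ENNReal.ofReal_le_ofReal ?_) _
          have e1 : μ ^ (-(1 + α)) = μ⁻¹ * μ ^ (-α) := by
            rw [neg_add, Real.rpow_add hμ0, Real.rpow_neg_one]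
          rw [e1]
          have h4 : 0 ≤ μ⁻¹ * μ ^ (-α) * wt L t := by positivity
          have h5 : 2 * C * (16 * M) ≤ 2 * C * (16 * M + 1) + C * (16 * M) ^ 2 := by
            nlinarith [sq_nonneg (16 * M)]
          calc _ = 2 * C * (16 * M) * (μ⁻¹ * μ ^ (-α) * wt L t) := by ring
            _ ≤ (2 * C * (16 * M + 1) + C * (16 * M) ^ 2) * (μ⁻¹ * μ ^ (-α) * wt L t) := by gcongr
            _ = _ := by ring
  · calc ∫⁻ t in Icc (-(L - 1)) (L - 1), F t * ENNReal.ofReal (kerN α (t - r))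
        ≤ ∫⁻ t, A t * ENNReal.ofReal (kerN α (t - r)) := by
          rw [← lintegral_indicator measurableSet_Icc]
          refine lintegral_mono fun t => ?_
          by_cases ht : t ∈ Icc (-(L - 1)) (L - 1)
          · rw [indicator_of_mem ht]
            simp only [A]
            rw [hχ.eq_one t (abs_le.2 ht)]
            simp
          · rw [indicator_of_notMem ht]; exact zero_le
      _ ≤ ENNReal.ofReal (C * wt L r ^ 2) * B := c2 r
      _ = ENNReal.ofReal (C * (16 * M) ^ 2 * wt L r ^ 2) * E := by
          simp only [B]
          rw [← mul_assoc, ← ENNReal.ofReal_pow (by positivity), ← ENNReal.ofReal_mul (by positivity)]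
          congr 2; ring
      _ ≤ _ := by
          gcongr
          have : 0 ≤ 2 * C * (16 * M + 1) := by positivity
          linarith

end WillmoreNeck
end

/-! ### Energy and mode bounds on a long cylinder -/

noncomputable section
namespace WillmoreNeck
variable {n : ℕ}

/-- Average over the starting points `v` of unit windows. Those meeting `[-a, a]` satisfy `|v| ≤ a +
1`, whence the loss of `1` in the exponent; the two exponentials centred at `±(a + 1)` account for
the two ends. -/
theorem lintegral_Icc_le_of_unit_decay {G : ℝ → ℝ≥0∞} (hG : Measurable G) {a b c L : ℝ}
    (hab : a ≤ b) {D : ℝ≥0∞}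
    (h : ∀ v, ∫⁻ t in Icc v (v + 1) ∩ Icc (-b) b, G t ≤
      D * ENNReal.ofReal (Real.exp (-c * (L - |v|)))) :
    ∫⁻ t in Icc (-a) a, G t ≤ D * ENNReal.ofReal (Real.exp (-c * (L - a - 1))) *
      (2 * ∫⁻ x : ℝ, ENNReal.ofReal (Real.exp (-c * |x|))) := by
  have h1 := lintegral_mul_le_lintegral_unit (g := (Icc (-a) a).indicator G) (w := fun _ => 1)
    (w' := fun _ => 1) (hG.indicator measurableSet_Icc) measurable_const (fun _ _ _ _ => le_rfl)
  simp only [mul_one] at h1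
  rw [lintegral_indicator measurableSet_Icc] at h1
  have hm : Measurable fun x : ℝ => ENNReal.ofReal (Real.exp (-c * |x|)) := by fun_prop
  have e1 : ∫⁻ v : ℝ, ENNReal.ofReal (Real.exp (-c * |a + 1 - v|)) =
      ∫⁻ x : ℝ, ENNReal.ofReal (Real.exp (-c * |x|)) :=
    lintegral_sub_left_eq_self (fun x => ENNReal.ofReal (Real.exp (-c * |x|))) (a + 1)
  have e2 : ∫⁻ v : ℝ, ENNReal.ofReal (Real.exp (-c * |a + 1 + v|)) =
      ∫⁻ x : ℝ, ENNReal.ofReal (Real.exp (-c * |x|)) :=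
    lintegral_add_left_eq_self (fun x => ENNReal.ofReal (Real.exp (-c * |x|))) (a + 1)
  refine h1.trans ?_
  calc ∫⁻ v, ∫⁻ t in Icc v (v + 1), (Icc (-a) a).indicator G t
      ≤ ∫⁻ v, D * ENNReal.ofReal (Real.exp (-c * (L - a - 1))) *
        (ENNReal.ofReal (Real.exp (-c * |a + 1 - v|)) +
          ENNReal.ofReal (Real.exp (-c * |a + 1 + v|))) := by
        refine lintegral_mono fun v => ?_
        rw [lintegral_indicator measurableSet_Icc, Measure.restrict_restrict measurableSet_Icc]
        by_cases hv : |v| ≤ a + 1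
        · have h2 : ∫⁻ t in Icc (-a) a ∩ Icc v (v + 1), G t ≤
              ∫⁻ t in Icc v (v + 1) ∩ Icc (-b) b, G t :=
            lintegral_mono_set fun t ht => ⟨ht.2, by linarith [ht.1.1], by linarith [ht.1.2]⟩
          refine h2.trans ((h v).trans ?_)
          rw [mul_assoc]
          gcongr
          rw [← ENNReal.ofReal_add (by positivity) (by positivity),
            ← ENNReal.ofReal_mul (by positivity)]
          refine ENNReal.ofReal_le_ofReal ?_
          have h3 : Real.exp (-c * (L - |v|)) =
              Real.exp (-c * (L - a - 1)) * Real.exp (-c * (a + 1 - |v|)) := by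
            rw [← Real.exp_add]; congr 1; ring
          rw [h3]
          gcongr
          obtain ⟨hv1, hv2⟩ := abs_le.1 hv
          rcases le_total 0 v with h0 | h0
          · rw [abs_of_nonneg h0, abs_of_nonneg (by linarith : 0 ≤ a + 1 - v)]
            linarith [Real.exp_pos (-c * |a + 1 + v|)]
          · rw [abs_of_nonpos h0, abs_of_nonneg (by linarith : 0 ≤ a + 1 + v), sub_neg_eq_add]
            linarith [Real.exp_pos (-c * |a + 1 - v|)]
        · have h2 : Icc (-a) a ∩ Icc v (v + 1) = ∅ := by
            rw [eq_empty_iff_forall_notMem]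
            intro t ht
            apply hv
            rw [abs_le]
            exact ⟨by linarith [ht.1.1, ht.2.2], by linarith [ht.1.2, ht.2.1]⟩
          rw [h2]; simp
    _ = _ := by
        rw [lintegral_const_mul _ (by fun_prop), lintegral_add_left (by fun_prop), e1, e2, two_mul]

/-- Within distance `δ` of `r` the kernel is at least `exp (-3/8) δ^{-2α}`. Its singularity thus
buys a power of the length, the source of the Hölder continuity of the energy in the height. -/
theorem lintegral_local_le_of_kerN {α δ r : ℝ} (h0 : 0 ≤ α) (hδ : 0 < δ) (hδ1 : δ ≤ 1)
    (F : ℝ → ℝ≥0∞) {J K : Set ℝ} (hJ : J ⊆ Icc (r - δ) (r + δ)) (hJK : J ⊆ K)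
    (hJm : MeasurableSet J) :
    ∫⁻ t in J, F t ≤ ENNReal.ofReal (Real.exp (3 / 8) * δ ^ (2 * α)) *
      ∫⁻ t in K, F t * ENNReal.ofReal (kerN α (t - r)) := by
  rw [← lintegral_const_mul' _ _ ENNReal.ofReal_ne_top]
  refine le_trans ?_ (lintegral_mono_set hJK)
  have hne : ∀ᵐ s : ℝ, s ≠ r := by rw [ae_iff]; simp
  refine lintegral_mono_ae ((ae_restrict_iff' hJm).2 ?_)
  filter_upwards [hne] with t ht htJ
  have hx : 0 < |t - r| := abs_pos.2 (sub_ne_zero.2 ht)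
  have hxδ : |t - r| ≤ δ := by
    rw [abs_le]; exact ⟨by linarith [(hJ htJ).1], by linarith [(hJ htJ).2]⟩
  rw [mul_comm (F t), ← mul_assoc, ← ENNReal.ofReal_mul (by positivity)]
  refine le_mul_of_one_le_left zero_le ?_
  rw [← ENNReal.ofReal_one]
  refine ENNReal.ofReal_le_ofReal ?_
  unfold kerN
  have h1 : |t - r| ^ (2 * α) ≤ δ ^ (2 * α) := Real.rpow_le_rpow hx.le hxδ (by linarith)
  have h2 : Real.exp (-(3 / 8)) ≤ Real.exp (-(3 / 8) * |t - r|) := by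
    rw [Real.exp_le_exp]; nlinarith
  have h3 : |t - r| ^ (2 * α) * |t - r| ^ (-(2 * α)) = 1 := by
    rw [← Real.rpow_add hx]; simp
  have h4 : Real.exp (3 / 8) * Real.exp (-(3 / 8)) = 1 := by rw [← Real.exp_add]; simp
  calc (1 : ℝ) = Real.exp (3 / 8) * |t - r| ^ (2 * α) *
        (|t - r| ^ (-(2 * α)) * Real.exp (-(3 / 8))) := by
        rw [show Real.exp (3 / 8) * |t - r| ^ (2 * α) *
          (|t - r| ^ (-(2 * α)) * Real.exp (-(3 / 8))) = (Real.exp (3 / 8) * Real.exp (-(3 / 8))) *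
          (|t - r| ^ (2 * α) * |t - r| ^ (-(2 * α))) by ring, h3, h4, one_mul]
    _ ≤ _ := by gcongr

theorem norm_le_of_enorm_le {x : Target n} {a : ℝ} (ha : 0 ≤ a) (h : ‖x‖ₑ ≤ ENNReal.ofReal a) :
    ‖x‖ ≤ a := by
  rwa [← ofReal_norm, ENNReal.ofReal_le_ofReal_iff ha] at h

theorem ENNReal_ofReal_sq_sqrt {E : ℝ} (hE : 0 ≤ E) :
    ENNReal.ofReal (E ^ 2) ^ (1 / 2 : ℝ) = ENNReal.ofReal E := by
  rw [ENNReal.ofReal_pow hE, ENNReal_sq_sqrt]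

/-- The quantitative estimates on a long cylinder used in the compactness argument. -/
structure NeckBounds (α C E T S₀ : ℝ) (f : Cylinder → Target n) : Prop where
  mode_le : ∀ m : ℤ, m ≠ 0 → ∀ t, |t| ≤ T - S₀ - 1 →
    ‖sliceCoeff m f t‖ ≤ C * E * |(m : ℝ)| ^ (-(1 + α)) * wt (T - S₀) t
  energy_le : ∀ S, S₀ + 1 ≤ S → energy (openCyl (-T) T) f (closedCyl (-T + S) (T - S)) ≤
    ENNReal.ofReal (C * E ^ 2 * Real.exp (-(1 / 4) * (S - S₀)))
  energy_sub_le : ∀ S S', S₀ + 1 ≤ S → S ≤ S' → S' ≤ S + 1 →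
    energy (openCyl (-T) T) f (closedCyl (-T + S) (T - S)) ≤
      energy (openCyl (-T) T) f (closedCyl (-T + S') (T - S')) +
        ENNReal.ofReal (C * E ^ 2 * (S' - S) ^ (2 * α))
  mode_sub_le : ∀ (m : ℤ) t₁ t₂, -T < t₁ → t₁ ≤ t₂ → t₂ < T →
    ‖sliceCoeff m f t₁ - sliceCoeff m f t₂‖ ≤ C * E * (t₂ - t₁) ^ (1 / 2 : ℝ)
  mode_sub_le_exp : ∀ (m : ℤ) S t₁ t₂, S₀ + 1 ≤ S → -(T - S) ≤ t₁ → t₁ ≤ t₂ → t₂ ≤ T - S →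
    ‖sliceCoeff m f t₁ - sliceCoeff m f t₂‖ ≤ C * E * Real.exp (-(1 / 8) * (S - S₀))

/-- Here `m = 0` is included: the Green estimate says nothing about the mean, and conformality,
through `deriv_le`, replaces it. -/
theorem SliceData.enorm_sub_le {T p R : ℝ} {f : Cylinder → Target n} {F H γ : ℝ → ℝ≥0∞}
    (hD : SliceData T p f F H γ) (hf : MemFpConf (openCyl (-T) T) p R f) (m : ℤ) {t₁ t₂ : ℝ}
    (h1 : -T < t₁) (h12 : t₁ ≤ t₂) (h2 : t₂ < T) :
    ‖sliceCoeff m f t₁ - sliceCoeff m f t₂‖ₑ ≤ 8 * ∫⁻ t in Icc t₁ t₂, F t ^ (1 / 2 : ℝ) := by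
  have h3 := enorm_sub_le_lintegral_weakDeriv
    (continuousOn_sliceCoeff hf.continuousOn hf.bounded m)
    (d := sliceCoeff m (weakPartial (openCyl (-T) T) 1 f))
    (fun ζ k1 k2 k3 => (hf.memW2pLoc.weakPartial_spec 1).1.slice_one m k1 k2 k3) h1 h12 h2
  refine h3.trans ?_
  rw [← lintegral_const_mul' _ _ (by simp)]
  refine lintegral_mono_ae ((ae_restrict_iff' measurableSet_Icc).2 ?_)
  filter_upwards [hD.deriv_le] with t ht ht'
  exact ht ⟨h1.trans_le ht'.1, ht'.2.trans_lt h2⟩ m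

theorem lintegral_sqrt_le {F : ℝ → ℝ≥0∞} (hF : Measurable F) (J : Set ℝ) :
    ∫⁻ t in J, F t ^ (1 / 2 : ℝ) ≤ volume J ^ (1 / 2 : ℝ) * (∫⁻ t in J, F t) ^ (1 / 2 : ℝ) := by
  have h := lintegral_mul_le_sqrt (μ := volume.restrict J) (f := fun _ => 1)
    (g := fun t => F t ^ (1 / 2 : ℝ)) aemeasurable_const (by fun_prop)
  simpa only [one_mul, one_pow, lintegral_const, ENNReal_sqrt_sq, Measure.restrict_apply_univ]
    using h

theorem exists_neckBounds {p : ℝ} (hp : 1 < p) :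
    ∃ α ε C : ℝ, 0 < α ∧ 0 < ε ∧ 0 < C ∧
      ∀ (n : ℕ) (T R S₀ E : ℝ) (f : Cylinder → Target n), 0 < S₀ → 0 ≤ E →
      MemFpConf (openCyl (-T) T) p R f → energy (openCyl (-T) T) f univ ≤ ENNReal.ofReal (E ^ 2) →
      (∀ v ∈ Icc (-T + S₀) (T - S₀), willmore (openCyl (-T) T) f (closedCyl v (v + 1)) ≤
        ENNReal.ofReal ε) →
      NeckBounds α C E T S₀ f := by
  obtain ⟨α, ε, C, hα, hα1, hε, hC, key⟩ := exists_slice_decay hp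
  have hK₁ : ∫⁻ x : ℝ, ENNReal.ofReal (Real.exp (-(1 / 4) * |x|)) ≠ ⊤ := by
    have := lintegral_abs_rpow_mul_exp_lt_top (b := 0) (c := 1 / 4) (by norm_num) (by norm_num)
    simpa using this.ne
  have hK₂ : ∫⁻ x : ℝ, ENNReal.ofReal (Real.exp (-(1 / 8) * |x|)) ≠ ⊤ := by
    have := lintegral_abs_rpow_mul_exp_lt_top (b := 0) (c := 1 / 8) (by norm_num) (by norm_num)
    simpa using this.ne
  obtain ⟨K₁, hK₁0, hK₁e⟩ : ∃ K : ℝ, 0 ≤ K ∧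
      ∫⁻ x : ℝ, ENNReal.ofReal (Real.exp (-(1 / 4) * |x|)) = ENNReal.ofReal K :=
    ⟨_, ENNReal.toReal_nonneg, (ENNReal.ofReal_toReal hK₁).symm⟩
  obtain ⟨K₂, hK₂0, hK₂e⟩ : ∃ K : ℝ, 0 ≤ K ∧
      ∫⁻ x : ℝ, ENNReal.ofReal (Real.exp (-(1 / 8) * |x|)) = ENNReal.ofReal K :=
    ⟨_, ENNReal.toReal_nonneg, (ENNReal.ofReal_toReal hK₂).symm⟩
  let D : ℝ := Real.exp (3 / 8) * C
  have hD0 : 0 < D := by positivity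
  let B₁ : ℝ := 2 * (D * Real.exp (1 / 4) * (2 * K₁))
  let B₂ : ℝ := 4 * D
  let B₃ : ℝ := 8 * ((D + 1) * Real.exp (1 / 8) * (2 * K₂))
  have hB₁ : 0 ≤ B₁ := by positivity
  have hB₂ : 0 ≤ B₂ := by positivity
  have hB₃ : 0 ≤ B₃ := by positivity
  refine ⟨α, ε, C + B₁ + B₂ + B₃ + 8, hα, hε, by positivity, ?_⟩
  intro n T R S₀ E f hS₀ hE hf hEn hW
  have hEtop : energy (openCyl (-T) T) f univ ≠ ⊤ := (hEn.trans_lt ENNReal.ofReal_lt_top).ne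
  obtain ⟨F, H, γ, hD⟩ := exists_sliceData hp hf hEtop
  have hF := hD.measurable_F
  set L := T - S₀ with hLd
  have hFE : ∫⁻ t in Ioo (-T) T, F t ≤ ENNReal.ofReal (E ^ 2) := by
    have h1 := hD.energy_eq (-T) T
    rw [inter_eq_right.2 Ioo_subset_Icc_self] at h1
    calc ∫⁻ t in Ioo (-T) T, F t ≤ 2 * ∫⁻ t in Ioo (-T) T, F t :=
          le_mul_of_one_le_left zero_le (by norm_num)
      _ = energy (openCyl (-T) T) f (closedCyl (-T) T) := h1.symm
      _ ≤ energy (openCyl (-T) T) f univ := lintegral_mono' (Measure.restrict_mono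
          (inter_subset_inter_left _ (subset_univ _)) le_rfl) le_rfl
      _ ≤ _ := hEn
  obtain ⟨k1, k2⟩ := key n T R L f F H γ (ENNReal.ofReal (E ^ 2)) (by linarith) hf hD
    ENNReal.ofReal_ne_top hFE (fun v hv => by
      rw [← hD.willmore_eq]
      exact hW v ⟨by linarith [hv.1], hv.2⟩)
  have hloc : ∀ (r δ : ℝ) (J : Set ℝ), 0 < δ → δ ≤ 1 → MeasurableSet J →
      J ⊆ Icc (r - δ) (r + δ) → J ⊆ Icc (-(L - 1)) (L - 1) →
      ∫⁻ t in J, F t ≤ ENNReal.ofReal (D * E ^ 2 * δ ^ (2 * α) * wt L r ^ 2) := by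
    intro r δ J hδ hδ1 hJm hJ1 hJ2
    refine (lintegral_local_le_of_kerN hα.le hδ hδ1 F hJ1 hJ2 hJm).trans ?_
    calc _ ≤ ENNReal.ofReal (Real.exp (3 / 8) * δ ^ (2 * α)) *
          (ENNReal.ofReal (C * wt L r ^ 2) * ENNReal.ofReal (E ^ 2)) := by
          gcongr
          exact k2 r
      _ = _ := by
          rw [← ENNReal.ofReal_mul (by positivity), ← ENNReal.ofReal_mul (by positivity)]
          congr 1
          simp only [D]; ring
  -- The local bound with `δ = 1` around `v`; squaring the weight doubles the rate `1/8`.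
  have hunit : ∀ v, ∫⁻ t in Icc v (v + 1) ∩ Icc (-(L - 1)) (L - 1), F t ≤
      ENNReal.ofReal (D * E ^ 2) * ENNReal.ofReal (Real.exp (-(1 / 4) * (L - |v|))) := by
    intro v
    refine (hloc v 1 _ one_pos le_rfl (measurableSet_Icc.inter measurableSet_Icc)
      (inter_subset_left.trans (Icc_subset_Icc (by linarith) le_rfl)) inter_subset_right).trans ?_
    rw [← ENNReal.ofReal_mul (by positivity)]
    refine ENNReal.ofReal_le_ofReal (le_of_eq ?_)
    unfold wt
    rw [Real.one_rpow, mul_one, ← Real.exp_nat_mul]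
    congr 2; push_cast; ring
  -- The factor `D + 1` comes from `D ≤ (D + 1)²`, which avoids a square root of `D`.
  have hunit' : ∀ v, ∫⁻ t in Icc v (v + 1) ∩ Icc (-(L - 1)) (L - 1), F t ^ (1 / 2 : ℝ) ≤
      ENNReal.ofReal ((D + 1) * E) * ENNReal.ofReal (Real.exp (-(1 / 8) * (L - |v|))) := by
    intro v
    refine (lintegral_sqrt_le hF _).trans ?_
    have h1 : volume (Icc v (v + 1) ∩ Icc (-(L - 1)) (L - 1)) ≤ 1 := by
      refine (measure_mono inter_subset_left).trans ?_
      rw [Real.volume_Icc]; simp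
    calc _ ≤ 1 ^ (1 / 2 : ℝ) * ENNReal.ofReal (((D + 1) * E *
          Real.exp (-(1 / 8) * (L - |v|))) ^ 2) ^ (1 / 2 : ℝ) := by
          gcongr
          refine (hunit v).trans ?_
          rw [← ENNReal.ofReal_mul (by positivity)]
          refine ENNReal.ofReal_le_ofReal ?_
          rw [mul_pow, mul_pow, ← Real.exp_nat_mul]
          have h2 : ((2 : ℕ) : ℝ) * (-(1 / 8) * (L - |v|)) = -(1 / 4) * (L - |v|) := by
            push_cast; ring
          rw [h2]
          gcongr
          nlinarith
      _ = _ := by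
          rw [ENNReal.one_rpow, one_mul, ENNReal_ofReal_sq_sqrt (by positivity),
            ENNReal.ofReal_mul (by positivity)]
  have hint : ∀ a b : ℝ, -T < a → b < T → Icc a b ∩ Ioo (-T) T = Icc a b := fun a b ha hb =>
    inter_eq_left.2 fun t ht => ⟨ha.trans_le ht.1, ht.2.trans_lt hb⟩
  refine ⟨?_, ?_, ?_, ?_, ?_⟩
  · intro m hm t ht
    have hw := wt_pos L t
    refine norm_le_of_enorm_le (by positivity) ((k1 m hm t ht).trans ?_)
    rw [ENNReal_ofReal_sq_sqrt hE, ← ENNReal.ofReal_mul (by positivity)]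
    refine ENNReal.ofReal_le_ofReal ?_
    calc C * |(m : ℝ)| ^ (-(1 + α)) * wt L t * E = C * E * |(m : ℝ)| ^ (-(1 + α)) * wt L t := by ring
      _ ≤ _ := by gcongr; linarith
  · intro S hS
    rw [hD.energy_eq, hint _ _ (by linarith) (by linarith)]
    have h1 := lintegral_Icc_le_of_unit_decay hF (a := T - S) (b := L - 1) (c := 1 / 4) (L := L)
      (by linarith) hunit
    rw [show -T + S = -(T - S) by ring]
    calc _ ≤ 2 * _ := mul_le_mul_right h1 2
      _ = ENNReal.ofReal (2 * (D * E ^ 2 * Real.exp (-(1 / 4) * (L - (T - S) - 1)) * (2 * K₁))) := by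
        rw [hK₁e, ENNReal.ofReal_mul (p := 2) (by norm_num), ENNReal.ofReal_mul (q := 2 * K₁)
          (by positivity), ENNReal.ofReal_mul (p := D * E ^ 2) (by positivity),
          ENNReal.ofReal_mul (p := 2) (q := K₁) (by norm_num)]
        simp
      _ ≤ _ := by
        refine ENNReal.ofReal_le_ofReal ?_
        have e1 : Real.exp (-(1 / 4) * (L - (T - S) - 1)) =
            Real.exp (1 / 4) * Real.exp (-(1 / 4) * (S - S₀)) := by
          rw [← Real.exp_add, hLd]; congr 1; ring
        rw [e1]
        calc _ = B₁ * E ^ 2 * Real.exp (-(1 / 4) * (S - S₀)) := by simp only [B₁]; ring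
          _ ≤ _ := by gcongr; linarith
  · intro S S' hS hSS' hS'
    rcases hSS'.eq_or_lt with rfl | hlt
    · exact le_self_add
    rw [hD.energy_eq, hD.energy_eq, hint _ _ (by linarith) (by linarith),
      hint _ _ (by linarith) (by linarith)]
    by_cases hne : T - S < -T + S
    · rw [Icc_eq_empty (not_le.2 hne)]; simp
    rw [not_lt] at hne
    set J₁ := Icc (-T + S) (T - S) ∩ Icc (-T + S) (-T + S')
    set J₂ := Icc (-T + S) (T - S) ∩ Icc (T - S') (T - S)
    -- Passing from `S` to `S'` removes two end pieces of length at most `S' - S`, each controlled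
    -- by the local bound with `δ = S' - S`.
    have hcov : Icc (-T + S) (T - S) ⊆ Icc (-T + S') (T - S') ∪ (J₁ ∪ J₂) := by
      intro t ht
      by_cases h1 : t ≤ -T + S'
      · exact Or.inr (Or.inl ⟨ht, ht.1, h1⟩)
      · by_cases h2 : T - S' ≤ t
        · exact Or.inr (Or.inr ⟨ht, h2, ht.2⟩)
        · exact Or.inl ⟨(not_le.1 h1).le, (not_le.1 h2).le⟩
    have hwt : wt L (T - S) ^ 2 ≤ 1 := by
      have h1 : |T - S| = T - S := abs_of_nonneg (by linarith)
      have h2 : wt L (T - S) ≤ 1 := by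
        unfold wt
        rw [Real.exp_le_one_iff, h1]
        nlinarith
      exact pow_le_one₀ (wt_pos _ _).le h2
    have hwt' : wt L (-T + S) = wt L (T - S) := by
      unfold wt
      rw [show -T + S = -(T - S) by ring, abs_neg]
    have hsub : Icc (-T + S) (T - S) ⊆ Icc (-(L - 1)) (L - 1) :=
      Icc_subset_Icc (by linarith) (by linarith)
    have hδ : (0 : ℝ) < S' - S := by linarith
    have b1 := hloc (-T + S) (S' - S) J₁ hδ (by linarith)
      (measurableSet_Icc.inter measurableSet_Icc)
      (inter_subset_right.trans (Icc_subset_Icc (by linarith) (by linarith)))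
      (inter_subset_left.trans hsub)
    have b2 := hloc (T - S) (S' - S) J₂ hδ (by linarith)
      (measurableSet_Icc.inter measurableSet_Icc)
      (inter_subset_right.trans (Icc_subset_Icc (by linarith) (by linarith)))
      (inter_subset_left.trans hsub)
    rw [hwt'] at b1
    have b3 : ENNReal.ofReal (D * E ^ 2 * (S' - S) ^ (2 * α) * wt L (T - S) ^ 2) ≤
        ENNReal.ofReal (D * E ^ 2 * (S' - S) ^ (2 * α)) :=
      ENNReal.ofReal_le_ofReal (mul_le_of_le_one_right (by positivity) hwt)
    calc 2 * ∫⁻ t in Icc (-T + S) (T - S), F t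
        ≤ 2 * ((∫⁻ t in Icc (-T + S') (T - S'), F t) + ((∫⁻ t in J₁, F t) + ∫⁻ t in J₂, F t)) := by
          refine mul_le_mul_right ?_ 2
          refine (lintegral_mono_set hcov).trans ((lintegral_union_le _ _ _).trans ?_)
          exact add_le_add_right (lintegral_union_le _ _ _) _
      _ ≤ 2 * ((∫⁻ t in Icc (-T + S') (T - S'), F t) +
          (ENNReal.ofReal (D * E ^ 2 * (S' - S) ^ (2 * α)) +
            ENNReal.ofReal (D * E ^ 2 * (S' - S) ^ (2 * α)))) := by
          refine mul_le_mul_right (add_le_add_right (add_le_add (b1.trans b3) (b2.trans b3)) _) 2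
      _ = 2 * (∫⁻ t in Icc (-T + S') (T - S'), F t) +
          ENNReal.ofReal (4 * (D * E ^ 2 * (S' - S) ^ (2 * α))) := by
          rw [ENNReal.ofReal_mul (p := 4) (by norm_num)]
          simp only [ENNReal.ofReal_ofNat]
          ring
      _ ≤ _ := by
          refine add_le_add_right (ENNReal.ofReal_le_ofReal ?_) _
          calc 4 * (D * E ^ 2 * (S' - S) ^ (2 * α)) = B₂ * E ^ 2 * (S' - S) ^ (2 * α) := by
                simp only [B₂]; ring
            _ ≤ _ := by gcongr; linarith
  · intro m t₁ t₂ h1 h12 h2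
    have h0 : 0 ≤ t₂ - t₁ := by linarith
    refine norm_le_of_enorm_le (by positivity) ((hD.enorm_sub_le hf m h1 h12 h2).trans ?_)
    calc 8 * ∫⁻ t in Icc t₁ t₂, F t ^ (1 / 2 : ℝ)
        ≤ 8 * (volume (Icc t₁ t₂) ^ (1 / 2 : ℝ) * (∫⁻ t in Icc t₁ t₂, F t) ^ (1 / 2 : ℝ)) :=
          mul_le_mul_right (lintegral_sqrt_le hF _) _
      _ ≤ 8 * (ENNReal.ofReal ((t₂ - t₁) ^ (1 / 2 : ℝ)) * ENNReal.ofReal E) := by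
          rw [Real.volume_Icc, ENNReal.ofReal_rpow_of_nonneg h0 (by norm_num),
            ← ENNReal_ofReal_sq_sqrt hE]
          gcongr
          refine (lintegral_mono_set fun t ht => ?_).trans hFE
          exact ⟨h1.trans_le ht.1, ht.2.trans_lt h2⟩
      _ = ENNReal.ofReal (8 * ((t₂ - t₁) ^ (1 / 2 : ℝ) * E)) := by
          rw [ENNReal.ofReal_mul (p := 8) (by norm_num), ENNReal.ofReal_mul (by positivity)]
          simp
      _ ≤ _ := by
          refine ENNReal.ofReal_le_ofReal ?_
          calc 8 * ((t₂ - t₁) ^ (1 / 2 : ℝ) * E) = 8 * E * (t₂ - t₁) ^ (1 / 2 : ℝ) := by ring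
            _ ≤ _ := by gcongr; linarith
  · intro m S t₁ t₂ hS h1 h12 h2
    refine norm_le_of_enorm_le (by positivity) ((hD.enorm_sub_le hf m (by linarith) h12
      (by linarith)).trans ?_)
    have h3 := lintegral_Icc_le_of_unit_decay (G := fun t => F t ^ (1 / 2 : ℝ)) (by fun_prop)
      (a := T - S) (b := L - 1) (c := 1 / 8) (L := L) (by linarith) hunit'
    calc 8 * ∫⁻ t in Icc t₁ t₂, F t ^ (1 / 2 : ℝ)
        ≤ 8 * _ := mul_le_mul_right ((lintegral_mono_set (Icc_subset_Icc h1 h2)).trans h3) _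
      _ = ENNReal.ofReal (8 * ((D + 1) * E * Real.exp (-(1 / 8) * (L - (T - S) - 1)) * (2 * K₂))) := by
        rw [hK₂e, ENNReal.ofReal_mul (p := 8) (by norm_num), ENNReal.ofReal_mul (q := 2 * K₂)
          (by positivity), ENNReal.ofReal_mul (p := (D + 1) * E) (by positivity),
          ENNReal.ofReal_mul (p := 2) (q := K₂) (by norm_num)]
        simp
      _ ≤ _ := by
        refine ENNReal.ofReal_le_ofReal ?_
        have e1 : Real.exp (-(1 / 8) * (L - (T - S) - 1)) =
            Real.exp (1 / 8) * Real.exp (-(1 / 8) * (S - S₀)) := by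
          rw [← Real.exp_add, hLd]; congr 1; ring
        rw [e1]
        calc _ = B₃ * E * Real.exp (-(1 / 8) * (S - S₀)) := by simp only [B₃]; ring
          _ ≤ _ := by gcongr; linarith

end WillmoreNeck
end

noncomputable section
namespace WillmoreNeck
variable {n : ℕ}

/-! ### Compactness -/

theorem cauchySeq_of_eventually_dist_lt {X : Type*} [PseudoMetricSpace X] {x : ℕ → X}
    (h : ∀ ε > 0, ∃ y, ∀ᶠ k in atTop, dist (x k) y < ε) : CauchySeq x := by
  rw [Metric.cauchySeq_iff']
  intro ε hε
  obtain ⟨y, hy⟩ := h (ε / 2) (half_pos hε)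
  obtain ⟨N, hN⟩ := eventually_atTop.1 hy
  refine ⟨N, fun k hk => ?_⟩
  calc dist (x k) (x N) ≤ dist (x k) y + dist (x N) y := dist_triangle_right _ _ _
    _ < ε := by linarith [hN k hk, hN N le_rfl]

/-- A countable family of eventually bounded and eventually equi-Hölder sequences of functions on
`[a, ∞)` has a common pointwise convergent subsequence. -/
theorem exists_subseq_tendsto_of_holder {X ι : Type*} [NormedAddCommGroup X] [ProperSpace X]
    [Countable ι] (g : ℕ → ι → ℝ → X) {a M C β : ℝ} (hβ : 0 < β)
    (hb : ∀ i t, a ≤ t → ∀ᶠ k in atTop, ‖g k i t‖ ≤ M)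
    (he : ∀ i t s, a ≤ t → t ≤ s → s ≤ t + 1 →
      ∀ᶠ k in atTop, ‖g k i t - g k i s‖ ≤ C * (s - t) ^ β) :
    ∃ σ : ℕ → ℕ, StrictMono σ ∧ ∀ i t, a ≤ t → ∃ l, Tendsto (fun k => g (σ k) i t) atTop (𝓝 l) := by
  classical
  -- The bounds hold only eventually in `k`, at a stage depending on the point. Replacing offending
  -- values by `0` places all sequences in one compact product of balls over the countable set `ι ×
  -- ℚ` without changing limits.
  let x : ℕ → ι × ℚ → X := fun k j => if ‖g k j.1 j.2‖ ≤ M then g k j.1 j.2 else 0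
  have hx : ∀ k, x k ∈ univ.pi fun _ : ι × ℚ => Metric.closedBall (0 : X) |M| := by
    intro k j _
    simp only [x, mem_closedBall_zero_iff]
    split_ifs with h
    · exact h.trans (le_abs_self M)
    · simp
  obtain ⟨φ, -, σ, hσ, hlim⟩ := (isCompact_univ_pi fun _ : ι × ℚ =>
    isCompact_closedBall (0 : X) |M|).tendsto_subseq hx
  refine ⟨σ, hσ, fun i t ht => ?_⟩
  have hq : ∀ q : ℚ, a ≤ q → Tendsto (fun k => g (σ k) i q) atTop (𝓝 (φ (i, q))) := by
    intro q hq
    have h1 : Tendsto (fun k => x (σ k) (i, q)) atTop (𝓝 (φ (i, q))) :=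
      (tendsto_pi_nhds.1 hlim) (i, q)
    refine h1.congr' ?_
    filter_upwards [hσ.tendsto_atTop.eventually (hb i q hq)] with k hk
    simp only [x]
    rw [if_pos hk]
  refine cauchySeq_tendsto_of_complete (cauchySeq_of_eventually_dist_lt fun ε hε => ?_)
  have hcont : Tendsto (fun δ : ℝ => C * δ ^ β) (𝓝[>] 0) (𝓝 0) := by
    have h1 : Tendsto (fun δ : ℝ => C * δ ^ β) (𝓝 0) (𝓝 (C * 0 ^ β)) :=
      ((Real.continuous_rpow_const hβ.le).tendsto 0).const_mul C
    rw [Real.zero_rpow hβ.ne', mul_zero] at h1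
    exact h1.mono_left nhdsWithin_le_nhds
  have hev : ∀ᶠ δ : ℝ in 𝓝[>] 0, C * δ ^ β < ε / 2 ∧ δ ≤ 1 :=
    (hcont.eventually (gt_mem_nhds (half_pos hε))).and
      (nhdsWithin_le_nhds (Iic_mem_nhds one_pos))
  obtain ⟨δ₀, hδ₀, hδ⟩ := mem_nhdsGT_iff_exists_Ioo_subset.1 hev
  -- A rational point slightly above `t`, close enough that the Hölder bound transfers its limit to
  -- `t` up to `ε / 2`.
  obtain ⟨q, hq1, hq2⟩ := exists_rat_btwn (show t < t + δ₀ by linarith [mem_Ioi.1 hδ₀])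
  have hmem : (q : ℝ) - t ∈ Ioo 0 δ₀ := ⟨by linarith, by linarith⟩
  obtain ⟨h1, h2⟩ := hδ hmem
  refine ⟨φ (i, q), ?_⟩
  filter_upwards [hσ.tendsto_atTop.eventually (he i t q ht hq1.le (by linarith)),
    (hq q (ht.trans hq1.le)).eventually (Metric.ball_mem_nhds _ (half_pos hε))] with k hk1 hk2
  calc dist (g (σ k) i t) (φ (i, q)) ≤ dist (g (σ k) i t) (g (σ k) i q) +
        dist (g (σ k) i q) (φ (i, q)) := dist_triangle _ _ _
    _ < ε := by
      have h3 : dist (g (σ k) i q) (φ (i, q)) < ε / 2 := hk2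
      rw [dist_eq_norm]
      linarith

theorem norm_le_tsum_of_casCoeff_le {x : AddCircle (2 * Real.pi) → Target n} (hx : Continuous x)
    {b : ℤ → ℝ} (hb : Summable b) (h : ∀ m, ‖casCoeff m x‖ ≤ b m) (θ : AddCircle (2 * Real.pi)) :
    ‖x θ‖ ≤ n * ∑' m, b m := by
  have hb0 : ∀ m, 0 ≤ b m := fun m => (norm_nonneg _).trans (h m)
  have h1 := enorm_le_tsum_casCoeff hx θ
  refine norm_le_of_enorm_le (mul_nonneg (Nat.cast_nonneg _) (tsum_nonneg hb0)) (h1.trans ?_)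
  rw [ENNReal.ofReal_mul (Nat.cast_nonneg _), ENNReal.ofReal_natCast,
    ENNReal.ofReal_tsum_of_nonneg hb0 hb]
  gcongr with m
  rw [← ofReal_norm]
  exact ENNReal.ofReal_le_ofReal (h m)

theorem casCoeff_sub {x y : AddCircle (2 * Real.pi) → Target n} (hx : Continuous x)
    (hy : Continuous y) (m : ℤ) :
    casCoeff m (fun θ => x θ - y θ) = casCoeff m x - casCoeff m y := by
  unfold casCoeff
  simp_rw [smul_sub]
  refine integral_sub ?_ ?_
  · exact ((continuous_cas m).smul hx).integrable_of_hasCompactSupport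
      (HasCompactSupport.of_compactSpace _)
  · exact ((continuous_cas m).smul hy).integrable_of_hasCompactSupport
      (HasCompactSupport.of_compactSpace _)

/-- Dominated convergence for the sum over `m`, along pairs of indices, makes the sequence uniformly
Cauchy, since the sup norm is bounded by the sum of the coefficients. -/
theorem exists_tendstoUniformly_of_casCoeff {x : ℕ → AddCircle (2 * Real.pi) → Target n}
    {α D : ℝ} (hα : 0 < α) (hx : ∀ᶠ k in atTop, Continuous (x k))
    (hlim : ∀ m, ∃ l, Tendsto (fun k => casCoeff m (x k)) atTop (𝓝 l))
    (hb : ∀ᶠ k in atTop, ∀ m : ℤ, m ≠ 0 → ‖casCoeff m (x k)‖ ≤ D * |(m : ℝ)| ^ (-(1 + α))) :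
    ∃ y, TendstoUniformly x y atTop := by
  let d : ℕ × ℕ → ℤ → ℝ := fun j m => ‖casCoeff m (x j.1) - casCoeff m (x j.2)‖
  -- The zero mode has no assumed bound; as it converges, its differences are eventually below `1`,
  -- the extra term. The power of `|0|` is `0` by convention.
  let B : ℤ → ℝ := fun m => (if m = 0 then 1 else 0) + 2 * D * |(m : ℝ)| ^ (-(1 + α))
  have hB : Summable B := by
    refine Summable.add ?_ ((Real.summable_abs_int_rpow (by linarith)).mul_left _)
    exact (hasSum_ite_eq 0 1).summable
  have hd0 : ∀ m, Tendsto (fun j => d j m) (atTop ×ˢ atTop) (𝓝 0) := by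
    intro m
    obtain ⟨l, hl⟩ := hlim m
    have h1 : Tendsto (fun j : ℕ × ℕ => casCoeff m (x j.1) - casCoeff m (x j.2)) (atTop ×ˢ atTop)
        (𝓝 (l - l)) := (hl.comp tendsto_fst).sub (hl.comp tendsto_snd)
    rw [sub_self] at h1
    simpa using h1.norm
  have hdB : ∀ᶠ j in atTop ×ˢ atTop, ∀ m, d j m ≤ B m := by
    filter_upwards [(hb.prod_inl atTop), (hb.prod_inr atTop),
      (hd0 0).eventually (gt_mem_nhds one_pos)] with j h1 h2 h3 m
    by_cases hm : m = 0
    · subst hm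
      simp only [B]
      rw [if_pos trivial, Int.cast_zero, abs_zero, Real.zero_rpow (by linarith)]
      linarith
    · simp only [B, d, if_neg hm]
      have := norm_sub_le (casCoeff m (x j.1)) (casCoeff m (x j.2))
      linarith [h1 m hm, h2 m hm]
  have hsum : Tendsto (fun j => ∑' m, d j m) (atTop ×ˢ atTop) (𝓝 0) := by
    have := tendsto_tsum_of_dominated_convergence hB hd0 (hdB.mono fun j hj m => by
      rw [Real.norm_of_nonneg (norm_nonneg _)]; exact hj m)
    simpa using this
  have hC : UniformCauchySeqOn x atTop univ := by
    rw [Metric.uniformCauchySeqOn_iff]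
    intro ε hε
    have h1 : ∀ᶠ j in (atTop : Filter ℕ) ×ˢ (atTop : Filter ℕ), ∀ θ, dist (x j.1 θ) (x j.2 θ) < ε := by
      have h2 : Tendsto (fun j => (n : ℝ) * ∑' m, d j m) (atTop ×ˢ atTop) (𝓝 0) := by
        simpa using hsum.const_mul (n : ℝ)
      filter_upwards [h2.eventually (gt_mem_nhds hε), hdB, hx.prod_inl atTop, hx.prod_inr atTop]
        with j h3 h4 h5 h6 θ
      rw [dist_eq_norm]
      refine lt_of_le_of_lt ?_ h3
      refine norm_le_tsum_of_casCoeff_le (x := fun θ => x j.1 θ - x j.2 θ) (h5.sub h6)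
        (hB.of_nonneg_of_le (fun m => norm_nonneg _) h4) (fun m => ?_) θ
      rw [casCoeff_sub h5 h6]
    rw [prod_atTop_atTop_eq, eventually_atTop] at h1
    obtain ⟨⟨N₁, N₂⟩, hN⟩ := h1
    refine ⟨max N₁ N₂, fun i hi j hj θ _ => hN (i, j) ⟨?_, ?_⟩ θ⟩
    · exact (le_max_left _ _).trans hi
    · exact (le_max_right _ _).trans hj
  have hpt : ∀ θ, ∃ y, Tendsto (fun k => x k θ) atTop (𝓝 y) := fun θ =>
    cauchySeq_tendsto_of_complete (hC.cauchySeq (mem_univ θ))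
  choose y hy using hpt
  exact ⟨y, tendstoUniformlyOn_univ.1 (hC.tendstoUniformlyOn_of_tendsto fun θ _ => hy θ)⟩

/-- Translation by half a period `π / m` changes the sign of the integrand. -/
theorem integral_cas {m : ℤ} (hm : m ≠ 0) : ∫ θ, cas m θ = 0 := by
  have h1 : ∀ θ, cas m (θ + ((2 * Real.pi / 2 / m : ℝ) : AddCircle (2 * Real.pi))) = -cas m θ := by
    intro θ
    unfold cas
    rw [fourier_add_half_inv_index hm Real.two_pi_pos θ, Complex.neg_re, Complex.neg_im]
    ring
  have h2 := integral_add_right_eq_self (μ := (volume : Measure (AddCircle (2 * Real.pi)))) (cas m)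
    ((2 * Real.pi / 2 / m : ℝ) : AddCircle (2 * Real.pi))
  simp_rw [h1] at h2
  rw [integral_neg] at h2
  linarith

theorem casCoeff_const (m : ℤ) (c : Target n) :
    casCoeff m (fun _ => c) = if m = 0 then (2 * Real.pi) • c else 0 := by
  unfold casCoeff
  rw [integral_smul_const]
  split_ifs with hm
  · subst hm
    simp only [cas_zero, integral_const, smul_eq_mul, mul_one]
    rw [measureReal_def, AddCircle.measure_univ, ENNReal.toReal_ofReal Real.two_pi_pos.le]
  · rw [integral_cas hm, zero_smul]

end WillmoreNeck
end

noncomputable section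
namespace WillmoreNeck
variable {n : ℕ}

/-! ### Passing to the limit along a sequence of maps -/

theorem continuous_slice {T t : ℝ} {f : Cylinder → Target n}
    (hf : ContinuousOn f (openCyl (-T) T)) (ht : t ∈ Ioo (-T) T) :
    Continuous fun θ => f (θ, t) :=
  hf.comp_continuous (by fun_prop) fun _ => ht

theorem norm_sliceCoeff_le {T t R : ℝ} {f : Cylinder → Target n} (hR : 0 ≤ R)
    (hf : ∀ z ∈ openCyl (-T) T, ‖f z‖ ≤ R) (ht : t ∈ Ioo (-T) T) (m : ℤ) :
    ‖sliceCoeff m f t‖ ≤ 32 * R := by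
  refine norm_le_of_enorm_le (by positivity) ((enorm_casCoeff_le _ _).trans ?_)
  calc 2 * ∫⁻ θ, ‖f (θ, t)‖ₑ ≤ 2 * ∫⁻ _ : AddCircle (2 * Real.pi), ENNReal.ofReal R := by
        gcongr with θ
        rw [← ofReal_norm]
        exact ENNReal.ofReal_le_ofReal (hf (θ, t) ht)
    _ ≤ 2 * (ENNReal.ofReal R * 16) := by
        rw [lintegral_const]
        gcongr
        exact volume_circle_le
    _ = ENNReal.ofReal (32 * R) := by
        rw [ENNReal.ofReal_mul (by norm_num), mul_comm (ENNReal.ofReal R), ← mul_assoc]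
        norm_num

theorem wt_le_exp {T S₀ t s : ℝ} (hs : |s| ≤ T - t) :
    wt (T - S₀) s ≤ Real.exp (-(1 / 8) * (t - S₀)) := by
  unfold wt
  rw [Real.exp_le_exp]
  linarith

/-- Subtract the mean over the middle circle and sum the coefficients: the zero mode hardly moves
between height `0` and height `s`, and the others decay. Since the same centre serves both ends,
both limits are the same point. -/
theorem NeckBounds.norm_sub_mean_le {α C E T S₀ : ℝ} {f : Cylinder → Target n} (hα : 0 < α)
    (hC : 0 ≤ C) (hE : 0 ≤ E) (h : NeckBounds α C E T S₀ f)
    (hf : ContinuousOn f (openCyl (-T) T)) {t s : ℝ} (ht : S₀ + 1 ≤ t) (ht0 : 0 < t)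
    (hs : |s| ≤ T - t) (θ : AddCircle (2 * Real.pi)) :
    ‖f (θ, s) - (2 * Real.pi)⁻¹ • sliceCoeff 0 f 0‖ ≤
      n * (C * E * (1 + ∑' m : ℤ, |(m : ℝ)| ^ (-(1 + α)))) * Real.exp (-(1 / 8) * (t - S₀)) := by
  set c := (2 * Real.pi)⁻¹ • sliceCoeff 0 f 0 with hc
  set e := Real.exp (-(1 / 8) * (t - S₀))
  obtain ⟨hs1, hs2⟩ := abs_le.1 hs
  have hcont : Continuous fun θ => f (θ, s) := continuous_slice hf ⟨by linarith, by linarith⟩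
  have hsum := Real.summable_abs_int_rpow (b := 1 + α) (by linarith)
  have hone : HasSum (fun m : ℤ => if m = 0 then (1 : ℝ) else 0) 1 := hasSum_ite_eq 0 1
  have hpi : (2 * Real.pi) ≠ 0 := Real.two_pi_pos.ne'
  have hb : HasSum (fun m : ℤ => C * E * e * ((if m = 0 then 1 else 0) + |(m : ℝ)| ^ (-(1 + α))))
      (C * E * e * (1 + ∑' m : ℤ, |(m : ℝ)| ^ (-(1 + α)))) :=
    (hone.add hsum.hasSum).mul_left _
  have h1 := norm_le_tsum_of_casCoeff_le (x := fun θ => f (θ, s) - c)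
    (hcont.sub continuous_const) hb.summable (fun m => by
      rw [casCoeff_sub hcont continuous_const, casCoeff_const]
      change ‖sliceCoeff m f s - _‖ ≤ _
      by_cases hm : m = 0
      · subst hm
        rw [if_pos rfl, if_pos rfl, hc, smul_smul, mul_inv_cancel₀ hpi, one_smul, Int.cast_zero,
          abs_zero, Real.zero_rpow (by linarith), add_zero, mul_one]
        rcases le_total s 0 with h0 | h0
        · exact h.mode_sub_le_exp 0 t s 0 ht hs1 h0 (by linarith)
        · rw [norm_sub_rev]
          exact h.mode_sub_le_exp 0 t 0 s ht (by linarith) h0 hs2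
      · rw [if_neg hm, if_neg hm, sub_zero, zero_add]
        refine (h.mode_le m hm s (by linarith)).trans ?_
        calc C * E * |(m : ℝ)| ^ (-(1 + α)) * wt (T - S₀) s ≤ C * E * |(m : ℝ)| ^ (-(1 + α)) * e := by
              gcongr
              exact wt_le_exp hs
          _ = _ := by ring) θ
  rw [hb.tsum_eq] at h1
  refine h1.trans (le_of_eq ?_)
  ring

theorem tendsto_exp_neg_mul_sub_atTop {c : ℝ} (hc : 0 < c) (S₀ : ℝ) :
    Tendsto (fun t : ℝ => Real.exp (-c * (t - S₀))) atTop (𝓝 0) := by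
  refine Real.tendsto_exp_atBot.comp ?_
  have h1 : Tendsto (fun t : ℝ => t - S₀) atTop atTop := tendsto_atTop_add_const_right _ _ tendsto_id
  exact h1.const_mul_atTop_of_neg (by linarith)

theorem energy_mono (U : Set Cylinder) (f : Cylinder → Target n) {A B : Set Cylinder} (h : A ⊆ B) :
    energy U f A ≤ energy U f B :=
  lintegral_mono' (Measure.restrict_mono (inter_subset_inter_left _ h) le_rfl) le_rfl

theorem closedCyl_mono {a b a' b' : ℝ} (ha : a' ≤ a) (hb : b ≤ b') :
    closedCyl a b ⊆ closedCyl a' b' := fun _ hz => Icc_subset_Icc ha hb hz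

/-- The bounds hold uniformly along a sequence of maps on longer and longer cylinders. -/
structure NeckSequence (α C E R S₀ : ℝ) (T : ℕ → ℝ) (f : ℕ → Cylinder → Target n) : Prop where
  α_pos : 0 < α
  C_nonneg : 0 ≤ C
  E_nonneg : 0 ≤ E
  R_nonneg : 0 ≤ R
  S₀_pos : 0 < S₀
  tendsto : Tendsto T atTop atTop
  continuousOn : ∀ k, ContinuousOn (f k) (openCyl (-T k) (T k))
  bounded : ∀ k, ∀ z ∈ openCyl (-T k) (T k), ‖f k z‖ ≤ R
  bounds : ∀ k, NeckBounds α C E (T k) S₀ (f k)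

theorem NeckSequence.comp {α C E R S₀ : ℝ} {T : ℕ → ℝ} {f : ℕ → Cylinder → Target n}
    (h : NeckSequence α C E R S₀ T f) {σ : ℕ → ℕ} (hσ : StrictMono σ) :
    NeckSequence α C E R S₀ (T ∘ σ) (f ∘ σ) where
  α_pos := h.α_pos
  C_nonneg := h.C_nonneg
  E_nonneg := h.E_nonneg
  R_nonneg := h.R_nonneg
  S₀_pos := h.S₀_pos
  tendsto := h.tendsto.comp hσ.tendsto_atTop
  continuousOn k := h.continuousOn (σ k)
  bounded k := h.bounded (σ k)
  bounds k := h.bounds (σ k)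

theorem NeckSequence.energy_ne_top {α C E R S₀ : ℝ} {T : ℕ → ℝ} {f : ℕ → Cylinder → Target n}
    (h : NeckSequence α C E R S₀ T f) (k : ℕ) {S : ℝ} (hS : S₀ + 1 ≤ S) :
    energy (openCyl (-T k) (T k)) (f k) (closedCyl (-T k + S) (T k - S)) ≠ ⊤ :=
  (((h.bounds k).energy_le S hS).trans_lt ENNReal.ofReal_lt_top).ne

/-- A diagonal argument handles countably many `S`; the Hölder bound in `S` extends convergence to
all large `S` along one subsequence. Decay of the limit is inherited from the uniform exponential
bound. -/
theorem NeckSequence.exists_subseq_noEnergyLoss {α C E R S₀ : ℝ} {T : ℕ → ℝ}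
    {f : ℕ → Cylinder → Target n} (h : NeckSequence α C E R S₀ T f) :
    ∃ σ : ℕ → ℕ, StrictMono σ ∧ NoEnergyLoss (T ∘ σ) (f ∘ σ) := by
  have hα := h.α_pos
  have hC := h.C_nonneg
  have hE := h.E_nonneg
  let en : ℕ → ℝ → ℝ≥0∞ := fun k S =>
    energy (openCyl (-T k) (T k)) (f k) (closedCyl (-T k + S) (T k - S))
  have hfin : ∀ k S, S₀ + 1 ≤ S → en k S ≠ ⊤ := fun k S hS => h.energy_ne_top k hS
  obtain ⟨σ, hσ, hlim⟩ := exists_subseq_tendsto_of_holder (X := ℝ) (ι := Unit)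
    (fun k _ S => (en k S).toReal) (a := S₀ + 1) (M := C * E ^ 2) (C := C * E ^ 2) (β := 2 * α)
    (by linarith)
    (fun _ S hS => Eventually.of_forall fun k => by
      rw [Real.norm_of_nonneg ENNReal.toReal_nonneg]
      refine ENNReal.toReal_le_of_le_ofReal (by positivity) (((h.bounds k).energy_le S hS).trans ?_)
      refine ENNReal.ofReal_le_ofReal (mul_le_of_le_one_right (by positivity) ?_)
      rw [Real.exp_le_one_iff]
      linarith)
    (fun _ S S' hS hSS' hS' => Eventually.of_forall fun k => by
      have h1 : en k S' ≤ en k S := energy_mono _ _ (closedCyl_mono (by linarith) (by linarith))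
      have h2 := (h.bounds k).energy_sub_le S S' hS hSS' hS'
      have h0 : 0 ≤ S' - S := by linarith
      have h3 := ENNReal.toReal_mono (hfin k S hS) h1
      have h4 := ENNReal.toReal_mono
        (ENNReal.add_ne_top.2 ⟨hfin k S' (hS.trans hSS'), ENNReal.ofReal_ne_top⟩) h2
      rw [ENNReal.toReal_add (hfin k S' (hS.trans hSS')) ENNReal.ofReal_ne_top,
        ENNReal.toReal_ofReal (by positivity)] at h4
      rw [Real.norm_of_nonneg (by linarith)]
      linarith)
  have hlim' : ∀ S, ∃ l : ℝ≥0∞, S₀ + 1 ≤ S → Tendsto (fun k => en (σ k) S) atTop (𝓝 l) := by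
    intro S
    by_cases hS : S₀ + 1 ≤ S
    · obtain ⟨l, hl⟩ := hlim () S hS
      refine ⟨ENNReal.ofReal l, fun _ => ?_⟩
      refine (ENNReal.tendsto_ofReal hl).congr fun k => ?_
      exact ENNReal.ofReal_toReal (hfin _ S hS)
    · exact ⟨0, fun h => absurd h hS⟩
  choose e he using hlim'
  refine ⟨σ, hσ, e, ?_, ?_⟩
  · filter_upwards [eventually_ge_atTop (S₀ + 1)] with S hS using he S hS
  · have h1 : Tendsto (fun S => ENNReal.ofReal (C * E ^ 2 * Real.exp (-(1 / 4) * (S - S₀)))) atTop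
        (𝓝 0) := by
      have h2 := ENNReal.tendsto_ofReal
        ((tendsto_exp_neg_mul_sub_atTop (c := 1 / 4) (by norm_num) S₀).const_mul (C * E ^ 2))
      simpa using h2
    refine tendsto_of_tendsto_of_tendsto_of_le_of_le' tendsto_const_nhds h1
      (Eventually.of_forall fun _ => zero_le) ?_
    filter_upwards [eventually_ge_atTop (S₀ + 1)] with S hS
    exact le_of_tendsto (he S hS) (Eventually.of_forall fun k => (h.bounds (σ k)).energy_le S hS)

/-- The three families of points on which the modes are compared: near the left end, near the right
end and the middle. -/
def neckPoint (T : ℝ) (j : Fin 3) (t : ℝ) : ℝ :=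
  if j = 0 then -T + t else if j = 1 then T - t else 0

theorem NeckSequence.exists_subseq_modes {α C E R S₀ : ℝ} {T : ℕ → ℝ}
    {f : ℕ → Cylinder → Target n} (h : NeckSequence α C E R S₀ T f) :
    ∃ σ : ℕ → ℕ, StrictMono σ ∧ ∀ (m : ℤ) (j : Fin 3) t, S₀ + 1 ≤ t →
      ∃ l, Tendsto (fun k => sliceCoeff m (f (σ k)) (neckPoint (T (σ k)) j t)) atTop (𝓝 l) := by
  have hC := h.C_nonneg
  have hE := h.E_nonneg
  have hS₀ := h.S₀_pos
  have key := exists_subseq_tendsto_of_holder (ι := ℤ × Fin 3)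
    (fun k i t => sliceCoeff i.1 (f k) (neckPoint (T k) i.2 t)) (a := S₀ + 1) (M := 32 * R)
    (C := C * E) (β := 1 / 2) (by norm_num) ?_ ?_
  · obtain ⟨σ, hσ, hlim⟩ := key
    exact ⟨σ, hσ, fun m j t ht => hlim (m, j) t ht⟩
  · rintro ⟨m, j⟩ t ht
    filter_upwards [h.tendsto.eventually_gt_atTop t] with k hk
    refine norm_sliceCoeff_le h.R_nonneg (h.bounded k) ?_ m
    unfold neckPoint
    split_ifs <;> constructor <;> linarith
  · rintro ⟨m, j⟩ t s ht hts -
    filter_upwards [h.tendsto.eventually_gt_atTop s] with k hk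
    have h0 : 0 ≤ s - t := by linarith
    simp only [neckPoint]
    split_ifs
    · have := (h.bounds k).mode_sub_le m (-T k + t) (-T k + s) (by linarith) (by linarith)
        (by linarith)
      rwa [show -T k + s - (-T k + t) = s - t by ring] at this
    · rw [norm_sub_rev]
      have := (h.bounds k).mode_sub_le m (T k - s) (T k - t) (by linarith) (by linarith)
        (by linarith)
      rwa [show T k - t - (T k - s) = s - t by ring] at this
    · rw [sub_self, norm_zero]; positivity

/-- Convergence of each mode together with the summable bound gives uniform convergence on every
circle at fixed distance from an end. -/
theorem NeckSequence.exists_subseq_noNeck {α C E R S₀ : ℝ} {T : ℕ → ℝ}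
    {f : ℕ → Cylinder → Target n} (h : NeckSequence α C E R S₀ T f) :
    ∃ σ : ℕ → ℕ, StrictMono σ ∧ NoNeck (T ∘ σ) (f ∘ σ) := by
  have hα := h.α_pos
  have hC := h.C_nonneg
  have hE := h.E_nonneg
  have hS₀ := h.S₀_pos
  obtain ⟨σ, hσ, hlim⟩ := h.exists_subseq_modes
  have hT := h.tendsto.comp hσ.tendsto_atTop
  -- The index `j = 2` of `neckPoint` is the middle circle; the limit `q` of its zero mode
  -- determines the common point.
  obtain ⟨q, hq⟩ : ∃ q, Tendsto (fun k => sliceCoeff 0 (f (σ k)) 0) atTop (𝓝 q) := by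
    simpa [neckPoint] using hlim 0 2 (S₀ + 1) le_rfl
  have habs : ∀ (j : Fin 3) t k, t ≤ T k → j ≠ 2 → |neckPoint (T k) j t| ≤ T k - t := by
    intro j t k hk hj
    fin_cases j
    · simp only [neckPoint, Fin.zero_eta, if_pos]
      rw [show -T k + t = -(T k - t) by ring, abs_neg, abs_of_nonneg (by linarith)]
    · simp only [neckPoint, Fin.mk_one, one_ne_zero, if_false, if_true]
      rw [abs_of_nonneg (by linarith)]
    · exact absurd rfl hj
  have hunif : ∀ (j : Fin 3), j ≠ 2 → ∀ t, ∃ y, S₀ + 1 ≤ t →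
      TendstoUniformly (fun k θ => f (σ k) (θ, neckPoint (T (σ k)) j t)) y atTop := by
    intro j hj t
    by_cases ht : S₀ + 1 ≤ t
    · have key := exists_tendstoUniformly_of_casCoeff
        (x := fun k θ => f (σ k) (θ, neckPoint (T (σ k)) j t)) (D := C * E) hα ?_
        (fun m => hlim m j t ht) ?_
      · obtain ⟨y, hy⟩ := key
        exact ⟨y, fun _ => hy⟩
      · filter_upwards [hT.eventually_gt_atTop t] with k hk
        have h1 := abs_le.1 (habs j t (σ k) (le_of_lt hk) hj)
        exact continuous_slice (h.continuousOn (σ k)) ⟨by linarith [h1.1], by linarith [h1.2]⟩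
      · filter_upwards [hT.eventually_gt_atTop t] with k hk m hm
        have h1 := habs j t (σ k) (le_of_lt hk) hj
        refine ((h.bounds (σ k)).mode_le m hm _ (by linarith)).trans ?_
        refine mul_le_of_le_one_right (by positivity) ?_
        refine (wt_le_exp h1).trans ?_
        rw [Real.exp_le_one_iff]
        linarith
    · exact ⟨0, fun h => absurd h ht⟩
  -- Letting `k → ∞` in the distance to the middle mean leaves a bound that is exponentially small
  -- in `t` and independent of `θ`.
  have hfar : ∀ (j : Fin 3), j ≠ 2 → ∀ (y : ℝ → AddCircle (2 * Real.pi) → Target n),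
      (∀ t, S₀ + 1 ≤ t →
        TendstoUniformly (fun k θ => f (σ k) (θ, neckPoint (T (σ k)) j t)) (y t) atTop) →
      TendstoUniformly y (fun _ => (2 * Real.pi)⁻¹ • q) atTop := by
    intro j hj y hy
    rw [Metric.tendstoUniformly_iff]
    intro ε hε
    have h1 : Tendsto (fun t => n * (C * E * (1 + ∑' m : ℤ, |(m : ℝ)| ^ (-(1 + α)))) *
        Real.exp (-(1 / 8) * (t - S₀))) atTop (𝓝 0) := by
      simpa using (tendsto_exp_neg_mul_sub_atTop (c := 1 / 8) (by norm_num) S₀).const_mul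
        (n * (C * E * (1 + ∑' m : ℤ, |(m : ℝ)| ^ (-(1 + α)))))
    filter_upwards [h1.eventually (gt_mem_nhds hε), eventually_ge_atTop (S₀ + 1)] with t ht1 ht θ
    rw [dist_comm, dist_eq_norm]
    refine lt_of_le_of_lt ?_ ht1
    have h2 : Tendsto (fun k => ‖f (σ k) (θ, neckPoint (T (σ k)) j t) -
        (2 * Real.pi)⁻¹ • sliceCoeff 0 (f (σ k)) 0‖) atTop (𝓝 ‖y t θ - (2 * Real.pi)⁻¹ • q‖) :=
      (((hy t ht).tendsto_at θ).sub (hq.const_smul _)).norm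
    refine le_of_tendsto h2 ?_
    filter_upwards [hT.eventually_gt_atTop t] with k hk
    exact (h.bounds (σ k)).norm_sub_mean_le hα hC hE (h.continuousOn _) ht (by linarith)
      (habs j t (σ k) (le_of_lt hk) hj) θ
  choose y₀ hy₀ using hunif 0 (by decide)
  choose y₁ hy₁ using hunif 1 (by decide)
  refine ⟨σ, hσ, y₀, y₁, (2 * Real.pi)⁻¹ • q, ?_, ?_, hfar 0 (by decide) y₀ hy₀,
    hfar 1 (by decide) y₁ hy₁⟩
  · filter_upwards [eventually_ge_atTop (S₀ + 1)] with t ht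
    simpa [neckPoint] using hy₀ t ht
  · filter_upwards [eventually_ge_atTop (S₀ + 1)] with t ht
    simpa [neckPoint] using hy₁ t ht

theorem NoEnergyLoss.comp {T : ℕ → ℝ} {f : ℕ → Cylinder → Target n} (h : NoEnergyLoss T f)
    {σ : ℕ → ℕ} (hσ : StrictMono σ) : NoEnergyLoss (T ∘ σ) (f ∘ σ) := by
  obtain ⟨e, h1, h2⟩ := h
  exact ⟨e, h1.mono fun S hS => hS.comp hσ.tendsto_atTop, h2⟩

end WillmoreNeck
end

noncomputable section
namespace WillmoreNeck
variable {n : ℕ}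

/-! ### Translation invariance -/

/-- Translation of the cylinder by `s` in the axial direction. -/
def axialShift (s : ℝ) : Cylinder ≃ₜ Cylinder := Homeomorph.addRight ((0, s) : Cylinder)

theorem axialShift_apply (s : ℝ) (z : Cylinder) : axialShift s z = (z.1, z.2 + s) := by
  ext <;> simp [axialShift]

theorem axialShift_symm_apply (s : ℝ) (z : Cylinder) : (axialShift s).symm z = (z.1, z.2 - s) := by
  rw [Homeomorph.symm_apply_eq, axialShift_apply]
  simp

theorem shiftedMap_eq_comp (f : Cylinder → Target n) (s : ℝ) :
    shiftedMap f s = f ∘ axialShift s := by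
  funext z; simp [shiftedMap, axialShift_apply]

theorem measurePreserving_axialShift (s : ℝ) : MeasurePreserving (axialShift s) := by
  have h1 : MeasurePreserving (Prod.map id fun t : ℝ => t + s)
      ((volume : Measure (AddCircle (2 * Real.pi))).prod (volume : Measure ℝ))
      ((volume : Measure (AddCircle (2 * Real.pi))).prod (volume : Measure ℝ)) :=
    (MeasurePreserving.id _).prod (measurePreserving_add_right volume s)
  have h2 : (axialShift s : Cylinder → Cylinder) = Prod.map id fun t : ℝ => t + s :=
    funext fun z => axialShift_apply s z
  rw [h2]
  exact h1

theorem axialShift_preimage_openCyl (a b s : ℝ) :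
    axialShift s ⁻¹' openCyl a b = openCyl (a - s) (b - s) := by
  ext z
  simp [axialShift_apply, openCyl, sub_lt_iff_lt_add, lt_sub_iff_add_lt]

theorem LocallyIntegrableOn.comp_axialShift {a b : ℝ} {u : Cylinder → Target n}
    (h : LocallyIntegrableOn u (openCyl a b)) (s : ℝ) :
    LocallyIntegrableOn (shiftedMap u s) (openCyl (a - s) (b - s)) := by
  rw [locallyIntegrableOn_iff (isOpen_openCyl _ _).isLocallyClosed]
  intro K hK hKc
  rw [locallyIntegrableOn_iff (isOpen_openCyl _ _).isLocallyClosed] at h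
  have h1 : axialShift s '' K ⊆ openCyl a b := by
    rw [image_subset_iff, axialShift_preimage_openCyl]; exact hK
  have h2 := h _ h1 (hKc.image (axialShift s).continuous)
  rw [← (measurePreserving_axialShift s).integrableOn_comp_preimage
    (axialShift s).measurableEmbedding, preimage_image_eq _ (axialShift s).injective] at h2
  rwa [shiftedMap_eq_comp]

theorem classicalPartial_comp_axialShift_symm (i : Fin 2) (φ : Cylinder → ℝ) (s : ℝ) (z : Cylinder) :
    classicalPartial i (φ ∘ (axialShift s).symm) z =
      classicalPartial i φ ((axialShift s).symm z) := by
  unfold classicalPartial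
  congr 1
  funext r
  simp only [Function.comp_apply]
  congr 1
  ext <;> simp [axialShift_symm_apply, add_sub_right_comm]

theorem IsTestFunction.comp_axialShift_symm {a b s : ℝ} {φ : Cylinder → ℝ}
    (h : IsTestFunction (openCyl (a - s) (b - s)) φ) :
    IsTestFunction (openCyl a b) (φ ∘ (axialShift s).symm) where
  smooth := by
    have : (fun x : ℝ × ℝ => (φ ∘ (axialShift s).symm) ((x.1 : AddCircle (2 * Real.pi)), x.2)) =
        (fun x : ℝ × ℝ => φ ((x.1 : AddCircle (2 * Real.pi)), x.2)) ∘
          fun x : ℝ × ℝ => (x.1, x.2 - s) := by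
      funext x; simp [axialShift_symm_apply]
    rw [this]
    exact h.smooth.comp (by fun_prop)
  compact := h.compact.comp_homeomorph _
  support_subset := by
    have h1 : tsupport (φ ∘ (axialShift s).symm) = (axialShift s).symm ⁻¹' tsupport φ := by
      unfold tsupport
      rw [Function.support_comp_eq_preimage, (axialShift s).symm.preimage_closure]
    rw [h1]
    intro z hz
    have h2 := h.support_subset hz
    rw [← axialShift_preimage_openCyl] at h2
    simpa using h2

theorem HasWeakPartial.shift {a b : ℝ} {i : Fin 2} {u v : Cylinder → Target n}
    (h : HasWeakPartial (openCyl a b) i u v) (s : ℝ) :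
    HasWeakPartial (openCyl (a - s) (b - s)) i (shiftedMap u s) (shiftedMap v s) where
  locInt_left := LocallyIntegrableOn.comp_axialShift h.locInt_left s
  locInt_right := LocallyIntegrableOn.comp_axialShift h.locInt_right s
  integral_eq φ hφ := by
    have h1 := h.integral_eq _ hφ.comp_axialShift_symm
    have h2 := (measurePreserving_axialShift s).integral_comp (axialShift s).measurableEmbedding
      (fun z => classicalPartial i (φ ∘ (axialShift s).symm) z • u z)
    have h3 := (measurePreserving_axialShift s).integral_comp (axialShift s).measurableEmbedding
      (fun z => (φ ∘ (axialShift s).symm) z • v z)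
    rw [← h2, ← h3] at h1
    simp only [classicalPartial_comp_axialShift_symm, Function.comp_apply,
      Homeomorph.symm_apply_apply] at h1
    rw [shiftedMap_eq_comp, shiftedMap_eq_comp]
    exact h1

/-- The weak derivatives on the two domains are chosen independently, so invariance holds only
almost everywhere and rests on uniqueness. -/
theorem HasWeakPartial.weakPartial_shift {a b : ℝ} {i : Fin 2} {u v : Cylinder → Target n}
    (h : HasWeakPartial (openCyl a b) i u v) (s : ℝ) :
    weakPartial (openCyl (a - s) (b - s)) i (shiftedMap u s)
      =ᵐ[volume.restrict (openCyl (a - s) (b - s))] shiftedMap (weakPartial (openCyl a b) i u) s :=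
  (hasWeakPartial_weakPartial (h.shift s)).ae_unique ((hasWeakPartial_weakPartial h).shift s)

theorem MemW2pLoc.gradSq_shift {a b p : ℝ} {f : Cylinder → Target n}
    (h : MemW2pLoc (openCyl a b) p f) (s : ℝ) :
    ∀ᵐ z ∂volume.restrict (openCyl (a - s) (b - s)),
      gradSq (openCyl (a - s) (b - s)) (shiftedMap f s) z =
        gradSq (openCyl a b) f (axialShift s z) := by
  filter_upwards [(h.weakPartial_spec 0).1.weakPartial_shift s,
    (h.weakPartial_spec 1).1.weakPartial_shift s] with z h0 h1
  unfold gradSq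
  simp only [Fin.sum_univ_two]
  rw [h0, h1, shiftedMap_eq_comp, shiftedMap_eq_comp]
  rfl

theorem MemW2pLoc.laplacian_shift {a b p : ℝ} {f : Cylinder → Target n}
    (h : MemW2pLoc (openCyl a b) p f) (s : ℝ) :
    ∀ᵐ z ∂volume.restrict (openCyl (a - s) (b - s)),
      laplacian (openCyl (a - s) (b - s)) (shiftedMap f s) z =
        laplacian (openCyl a b) f (axialShift s z) := by
  have key : ∀ i : Fin 2, ∀ᵐ z ∂volume.restrict (openCyl (a - s) (b - s)),
      weakPartial (openCyl (a - s) (b - s)) i (weakPartial (openCyl (a - s) (b - s)) i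
        (shiftedMap f s)) z =
      weakPartial (openCyl a b) i (weakPartial (openCyl a b) i f) (axialShift s z) := by
    intro i
    obtain ⟨h1, -, h2⟩ := h.weakPartial_spec i
    have h3 := (h2 i).1.shift s
    -- The inner derivative is exchanged for the chosen one on the shifted domain, almost everywhere
    -- equal to it, before uniqueness is applied to the outer derivative.
    have h4 := h3.congr (isOpen_openCyl _ _).measurableSet (h1.weakPartial_shift s).symm
      (ae_eq_refl _)
    have h5 := (hasWeakPartial_weakPartial h4).ae_unique h4
    filter_upwards [h5] with z hz
    rw [hz, shiftedMap_eq_comp]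
    rfl
  filter_upwards [key 0, key 1] with z h0 h1
  unfold laplacian
  simp only [Fin.sum_univ_two]
  rw [h0, h1]

theorem lintegral_preimage_axialShift (s a b : ℝ) (S : Set Cylinder) (G : Cylinder → ℝ≥0∞) :
    ∫⁻ z in axialShift s ⁻¹' S ∩ openCyl (a - s) (b - s), G (axialShift s z) =
      ∫⁻ z in S ∩ openCyl a b, G z := by
  rw [← axialShift_preimage_openCyl, ← preimage_inter]
  exact (measurePreserving_axialShift s).setLIntegral_comp_preimage_emb
    (axialShift s).measurableEmbedding G _

theorem MemW2pLoc.energy_shift {a b p : ℝ} {f : Cylinder → Target n}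
    (h : MemW2pLoc (openCyl a b) p f) (s : ℝ) (S : Set Cylinder) :
    energy (openCyl (a - s) (b - s)) (shiftedMap f s) (axialShift s ⁻¹' S) =
      energy (openCyl a b) f S := by
  unfold energy
  rw [← lintegral_preimage_axialShift s a b S]
  refine lintegral_congr_ae ?_
  filter_upwards [ae_mono (Measure.restrict_mono inter_subset_right le_rfl) (h.gradSq_shift s)]
    with z hz
  rw [hz]

theorem MemW2pLoc.willmore_shift {a b p : ℝ} {f : Cylinder → Target n}
    (h : MemW2pLoc (openCyl a b) p f) (s : ℝ) (S : Set Cylinder) :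
    willmore (openCyl (a - s) (b - s)) (shiftedMap f s) (axialShift s ⁻¹' S) =
      willmore (openCyl a b) f S := by
  unfold willmore
  rw [← lintegral_preimage_axialShift s a b S]
  congr 1
  refine lintegral_congr_ae ?_
  filter_upwards [ae_mono (Measure.restrict_mono inter_subset_right le_rfl) (h.gradSq_shift s),
    ae_mono (Measure.restrict_mono inter_subset_right le_rfl) (h.laplacian_shift s)] with z h1 h2
  unfold meanCurv
  rw [h1, h2]

theorem willmore_mono (U : Set Cylinder) (f : Cylinder → Target n) {A B : Set Cylinder}
    (h : A ⊆ B) : willmore U f A ≤ willmore U f B :=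
  mul_le_mul_right (lintegral_mono' (Measure.restrict_mono (inter_subset_inter_left _ h) le_rfl)
    le_rfl) _

/-! ### Absence of bubbles -/

theorem disk_subset_preimage_closedCyl (z : Cylinder) (s : ℝ) :
    disk z (1 / 2) ⊆ axialShift s ⁻¹' closedCyl (z.2 + s - 1 / 2) (z.2 + s - 1 / 2 + 1) := by
  rintro w ⟨x, y, hxy, rfl⟩
  have h1 : y ^ 2 < (1 / 2) ^ 2 := by nlinarith [sq_nonneg x]
  have h2 := abs_lt.1 (abs_lt_of_sq_lt_sq h1 (by norm_num))
  simp only [mem_preimage, axialShift_apply, closedCyl, mem_ofPred_eq, mem_Icc, Prod.snd_add]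
  constructor <;> linarith [h2.1, h2.2]

theorem axialShift_preimage_closedCyl (a b s : ℝ) :
    axialShift s ⁻¹' closedCyl a b = closedCyl (a - s) (b - s) := by
  ext z
  simp [axialShift_apply, closedCyl, le_sub_iff_add_le]

/-- A weak limit of maps whose energy on compact sets tends to zero has zero energy. -/
theorem WeakConvW2pLoc.energy_eq_zero {p : ℝ} {U : ℕ → Set Cylinder}
    {g : ℕ → Cylinder → Target n} {g₀ : Cylinder → Target n}
    (h : WeakConvW2pLoc p univ U g g₀)
    (hmeas : ∀ k i, AEStronglyMeasurable (weakPartial (U k) i (g k)) (volume.restrict (U k)))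
    (hE : ∀ N : ℕ, Tendsto (fun k => energy (U k) (g k) (closedCyl (-N) N)) atTop (𝓝 0)) :
    energy univ g₀ univ = 0 := by
  have hloc : ∀ i, LocallyIntegrable (weakPartial univ i g₀) := by
    intro i
    obtain ⟨v, hv, -⟩ := h.mem_limit.2 i
    exact locallyIntegrableOn_univ.1 (hasWeakPartial_weakPartial hv).locInt_right
  have hK : ∀ (i : Fin 2) (N : ℕ), ∀ᵐ z ∂volume.restrict (closedCyl (-N) N),
      weakPartial univ i g₀ z = 0 := by
    intro i N
    set K := closedCyl (-N) N with hKd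
    have hKc : IsCompact K := isCompact_closedCyl _ _
    have hKm : MeasurableSet K := measurableSet_closedCyl _ _
    have hKfin : volume K ≠ ⊤ := hKc.measure_lt_top.ne
    have hint : IntegrableOn (weakPartial univ i g₀) K := (hloc i).integrableOn_isCompact hKc
    refine Integrable.ae_eq_zero_of_forall_setIntegral_eq_zero hint fun A hA _ => ?_
    rw [Measure.restrict_restrict hA]
    set c := ∫ z in A ∩ K, weakPartial univ i g₀ z with hc
    -- Testing with the integral `c` itself makes the limiting pairing equal to `‖c‖²`.
    let η : Cylinder → Target n := (A ∩ K).indicator fun _ => c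
    have hη : MemLp η (ENNReal.ofReal (p / (p - 1))) volume :=
      memLp_indicator_const _ (hA.inter hKm) c
        (Or.inr ((measure_mono inter_subset_right).trans_lt hKc.measure_lt_top).ne)
    have hsupp : Function.support η ⊆ K :=
      (support_indicator_subset).trans inter_subset_right
    have hconv := (h.conv K hKc (subset_univ _) η hη hsupp).2.1 i
    have hlim : ∫ z, inner ℝ (weakPartial univ i g₀ z) (η z) = ‖c‖ ^ 2 := by
      have h1 : ∀ z, inner ℝ (weakPartial univ i g₀ z) (η z) =
          (A ∩ K).indicator (fun z => inner ℝ c (weakPartial univ i g₀ z)) z := by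
        intro z
        by_cases hz : z ∈ A ∩ K
        · simp only [η, indicator_of_mem hz, real_inner_comm]
        · simp only [η, indicator_of_notMem hz, inner_zero_right]
      simp_rw [h1]
      rw [integral_indicator (hA.inter hKm), integral_inner (hint.mono_set inter_subset_right),
        ← hc, real_inner_self_eq_norm_sq]
    rw [hlim] at hconv
    -- By Cauchy–Schwarz on `K` the pairings are bounded by the square root of the energy, which
    -- tends to zero; hence `c = 0`.
    have hbd : ∀ᶠ k in atTop, ‖∫ z, inner ℝ (weakPartial (U k) i (g k) z) (η z)‖ₑ ≤
        ‖c‖ₑ * (volume K ^ (1 / 2 : ℝ) * energy (U k) (g k) K ^ (1 / 2 : ℝ)) := by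
      filter_upwards [h.exhaust K hKc (subset_univ _)] with k hk
      refine (enorm_integral_le_lintegral_enorm _).trans ?_
      have h1 : ∀ z, ‖inner ℝ (weakPartial (U k) i (g k) z) (η z)‖ₑ ≤
          K.indicator (fun z => ‖c‖ₑ * ‖weakPartial (U k) i (g k) z‖ₑ) z := by
        intro z
        by_cases hz : z ∈ A ∩ K
        · rw [indicator_of_mem hz.2]
          simp only [η, indicator_of_mem hz]
          rw [← ofReal_norm, ← ofReal_norm, ← ofReal_norm, ← ENNReal.ofReal_mul (norm_nonneg _),
            mul_comm]
          exact ENNReal.ofReal_le_ofReal (norm_inner_le_norm _ _)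
        · simp only [η, indicator_of_notMem hz, inner_zero_right, enorm_zero]
          exact zero_le
      refine (lintegral_mono h1).trans ?_
      rw [lintegral_indicator hKm, lintegral_const_mul' _ _ enorm_ne_top]
      refine mul_le_mul_right ?_ _
      have hm : AEStronglyMeasurable (weakPartial (U k) i (g k)) (volume.restrict K) :=
        (hmeas k i).mono_measure (Measure.restrict_mono hk le_rfl)
      have h2 := lintegral_mul_le_sqrt (μ := volume.restrict K) (f := fun _ => 1)
        (g := fun z => ‖weakPartial (U k) i (g k) z‖ₑ) aemeasurable_const hm.enorm
      simp only [one_mul, one_pow, lintegral_const, Measure.restrict_apply_univ] at h2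
      refine h2.trans ?_
      gcongr
      unfold energy
      rw [inter_eq_left.2 hk]
      refine lintegral_mono fun z => ?_
      simp only
      rw [← ofReal_norm, ← ENNReal.ofReal_pow (norm_nonneg _)]
      refine ENNReal.ofReal_le_ofReal ?_
      exact Finset.single_le_sum (f := fun j => ‖weakPartial (U k) j (g k) z‖ ^ 2)
        (fun j _ => sq_nonneg _) (Finset.mem_univ i)
    have hto : Tendsto (fun k => ‖c‖ₑ * (volume K ^ (1 / 2 : ℝ) *
        energy (U k) (g k) K ^ (1 / 2 : ℝ))) atTop (𝓝 0) := by
      have h1 : Tendsto (fun k => energy (U k) (g k) K ^ (1 / 2 : ℝ)) atTop (𝓝 0) := by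
        have := (ENNReal.continuous_rpow_const (y := 1 / 2)).tendsto 0 |>.comp (hE N)
        simpa [Function.comp_def] using this
      have h2 := ENNReal.Tendsto.const_mul h1 (Or.inr
        (ENNReal.rpow_ne_top_of_nonneg (y := 1 / 2) (by norm_num) hKfin))
      have h3 := ENNReal.Tendsto.const_mul h2 (Or.inr (enorm_ne_top (x := c)))
      simpa using h3
    have h4 := le_of_tendsto_of_tendsto hconv.enorm hto hbd
    have h5 : ‖c‖ ^ 2 = 0 := by simpa using h4
    simpa using h5
  have hall : ∀ i, ∀ᵐ z, weakPartial univ i g₀ z = 0 := by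
    intro i
    have h1 : (⋃ N : ℕ, closedCyl (-N) N) = univ := by
      rw [eq_univ_iff_forall]
      intro z
      obtain ⟨N, hN⟩ := exists_nat_ge |z.2|
      exact mem_iUnion.2 ⟨N, abs_le.1 hN⟩
    have h2 := (ae_restrict_iUnion_iff (μ := volume) (fun N : ℕ => closedCyl (-N) N)
      (fun z => weakPartial univ i g₀ z = 0)).2 (hK i)
    rwa [h1, Measure.restrict_univ] at h2
  unfold energy
  rw [univ_inter, Measure.restrict_univ]
  rw [lintegral_eq_zero_of_ae_eq_zero]
  filter_upwards [hall 0, hall 1] with z h0 h1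
  simp [gradSq, Fin.sum_univ_two, h0, h1]

/-- Translates centred far from both ends carry Willmore energy at most `ε²` in unit bands, so the
blowup set is empty and convergence takes place on the whole cylinder. There the energy decay forces
the limit to have zero energy. -/
theorem NeckSequence.not_isBubble {α C E R S₀ p ε : ℝ} {T : ℕ → ℝ} {f : ℕ → Cylinder → Target n}
    (h : NeckSequence α C E R S₀ T f)
    (hf : ∀ k, MemW2pLoc (openCyl (-T k) (T k)) p (f k))
    (hW : ∀ k, ∀ v ∈ Icc (-T k + S₀) (T k - S₀),
      willmore (openCyl (-T k) (T k)) (f k) (closedCyl v (v + 1)) ≤ ENNReal.ofReal (ε ^ 2))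
    (g₀ : Cylinder → Target n) : ¬ IsBubble p ε T f g₀ := by
  rintro ⟨t, ψ, hψ, ht1, ht2, hconv, hpos⟩
  have ht1' := ht1.comp hψ.tendsto_atTop
  have ht2' := ht2.comp hψ.tendsto_atTop
  have hempty : blowupSet ε (fun k => shiftedDomain (T (ψ k)) (t (ψ k)))
      (fun k => shiftedMap (f (ψ k)) (t (ψ k))) = ∅ := by
    rw [eq_empty_iff_forall_notMem]
    intro z hz
    rw [blowupSet, mem_ofPred_eq] at hz
    -- A disk of radius `1/2` lies in a band of height one, and the strict inequality in `blowupSet`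
    -- makes the bound `≤ ε²` sufficient.
    refine absurd hz (not_lt.2 ?_)
    refine (iInf₂_le (1 / 2 : ℝ) (by norm_num)).trans ?_
    have hev : ∀ᶠ k in atTop, willmore (shiftedDomain (T (ψ k)) (t (ψ k)))
        (shiftedMap (f (ψ k)) (t (ψ k))) (disk z (1 / 2)) ≤ ENNReal.ofReal (ε ^ 2) := by
      filter_upwards [ht1'.eventually_ge_atTop (z.2 - 1 / 2 + S₀),
        ht2'.eventually_ge_atTop (-(z.2 - 1 / 2) + S₀)] with k h1 h2
      simp only [Function.comp_apply] at h1 h2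
      refine (willmore_mono _ _ (disk_subset_preimage_closedCyl z (t (ψ k)))).trans ?_
      unfold shiftedDomain
      rw [(hf (ψ k)).willmore_shift]
      exact hW _ _ ⟨by linarith, by linarith⟩
    exact (liminf_le_liminf hev).trans (liminf_const _).le
  rw [hempty, compl_empty] at hconv hpos
  refine hpos.ne' (hconv.energy_eq_zero ?_ ?_)
  · intro k i
    have h1 := hconv.mem k
    exact (h1.weakPartial_spec i).1.locInt_right.aestronglyMeasurable
  · intro N
    rw [ENNReal.tendsto_nhds_zero]
    intro δ hδ
    have h1 : Tendsto (fun S => ENNReal.ofReal (C * E ^ 2 * Real.exp (-(1 / 4) * (S - S₀)))) atTop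
        (𝓝 0) := by
      have h2 := ENNReal.tendsto_ofReal
        ((tendsto_exp_neg_mul_sub_atTop (c := 1 / 4) (by norm_num) S₀).const_mul (C * E ^ 2))
      simpa using h2
    obtain ⟨S, hS1, hS2⟩ := ((ENNReal.tendsto_nhds_zero.1 h1 δ hδ).and
      (eventually_ge_atTop (S₀ + 1))).exists
    filter_upwards [ht1'.eventually_ge_atTop (N + S), ht2'.eventually_ge_atTop (N + S)]
      with k h3 h4
    simp only [Function.comp_apply] at h3 h4
    -- Translated back, the band `|t| ≤ N` lies within `[-T + S, T - S]`, because the centre is at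
    -- distance at least `N + S` from both ends.
    refine le_trans ?_ (((h.bounds (ψ k)).energy_le S hS2).trans hS1)
    rw [← (hf (ψ k)).energy_shift (t (ψ k)), axialShift_preimage_closedCyl]
    exact energy_mono _ _ (closedCyl_mono (by linarith) (by linarith))

end WillmoreNeck
end

/-! ### Conclusion -/

theorem mainTheorem7 (n : ℕ) (p : ℝ) (hp : 1 < p) :
    ∃ ε₂ : ℝ, 0 < ε₂ ∧
      ∀ (R : ℝ) (_ : 0 < R) (T : ℕ → ℝ) (_ : Tendsto T atTop atTop)
        (f : ℕ → WillmoreNeck.Cylinder → WillmoreNeck.Target n)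
        (_ : ∀ k, WillmoreNeck.MemFpConf (WillmoreNeck.openCyl (-T k) (T k)) p R (f k))
        (_ : (⨆ k, (WillmoreNeck.energy (WillmoreNeck.openCyl (-T k) (T k)) (f k) univ +
          WillmoreNeck.willmore (WillmoreNeck.openCyl (-T k) (T k)) (f k) univ)) < ⊤)
        (L : ℝ≥0∞)
        (_ : Tendsto (fun S : ℝ => liminf (fun k => ⨆ t ∈ Icc (-T k + S) (T k - S),
            WillmoreNeck.willmore (WillmoreNeck.openCyl (-T k) (T k)) (f k)
              (WillmoreNeck.closedCyl t (t + 1))) atTop) atTop (𝓝 L))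
        (_ : L < ENNReal.ofReal (ε₂ ^ 2)),
        ∃ σ : ℕ → ℕ, StrictMono σ ∧
          (¬ ∃ g₀, WillmoreNeck.IsBubble p ε₂ (T ∘ σ) (f ∘ σ) g₀) ∧
          WillmoreNeck.NoEnergyLoss (T ∘ σ) (f ∘ σ) ∧
          WillmoreNeck.NoNeck (T ∘ σ) (f ∘ σ) := by
  obtain ⟨α, ε, C, hα, hε, hC, key⟩ := WillmoreNeck.exists_neckBounds hp
  -- The threshold enters squared. It depends on `p` alone, since `exists_neckBounds` fixes its
  -- constants before the dimension.
  refine ⟨√ε, Real.sqrt_pos.2 hε, ?_⟩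
  intro R hR T hT f hf hsup L hL hLε
  rw [Real.sq_sqrt hε.le] at hLε
  -- A single margin `S₀` with lower limit below the threshold suffices; all later bounds are
  -- measured from it.
  obtain ⟨S₀, hS, hS₀⟩ := ((hL.eventually (gt_mem_nhds hLε)).and (eventually_gt_atTop 0)).exists
  -- A lower limit gives smallness only for infinitely many `k`, so a first subsequence is taken
  -- along which it holds for every `k`.
  obtain ⟨σ₀, hσ₀, hW⟩ := extraction_of_frequently_atTop (frequently_lt_of_liminf_lt (by isBoundedDefault) hS)
  have hW' : ∀ k, ∀ v ∈ Icc (-T (σ₀ k) + S₀) (T (σ₀ k) - S₀),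
      WillmoreNeck.willmore (WillmoreNeck.openCyl (-T (σ₀ k)) (T (σ₀ k))) (f (σ₀ k))
        (WillmoreNeck.closedCyl v (v + 1)) ≤ ENNReal.ofReal ε := fun k v hv =>
    (le_iSup₂_of_le v hv le_rfl).trans (hW k).le
  set M := ⨆ k, (WillmoreNeck.energy (WillmoreNeck.openCyl (-T k) (T k)) (f k) univ +
    WillmoreNeck.willmore (WillmoreNeck.openCyl (-T k) (T k)) (f k) univ) with hM
  have hE : ∀ k, WillmoreNeck.energy (WillmoreNeck.openCyl (-T k) (T k)) (f k) univ ≤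
      ENNReal.ofReal (√M.toReal ^ 2) := by
    intro k
    rw [Real.sq_sqrt ENNReal.toReal_nonneg, ENNReal.ofReal_toReal hsup.ne]
    exact le_self_add.trans (le_iSup (fun k =>
      WillmoreNeck.energy (WillmoreNeck.openCyl (-T k) (T k)) (f k) univ +
      WillmoreNeck.willmore (WillmoreNeck.openCyl (-T k) (T k)) (f k) univ) k)
  have seq₀ : WillmoreNeck.NeckSequence α C (√M.toReal) R S₀ (T ∘ σ₀) (f ∘ σ₀) :=
    { α_pos := hα
      C_nonneg := hC.le
      E_nonneg := Real.sqrt_nonneg _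
      R_nonneg := hR.le
      S₀_pos := hS₀
      tendsto := hT.comp hσ₀.tendsto_atTop
      continuousOn := fun k => (hf (σ₀ k)).continuousOn
      bounded := fun k => (hf (σ₀ k)).bounded
      bounds := fun k => key n (T (σ₀ k)) R S₀ (√M.toReal) (f (σ₀ k)) hS₀ (Real.sqrt_nonneg _)
        (hf (σ₀ k)) (hE (σ₀ k)) (hW' k) }
  obtain ⟨σ₁, hσ₁, hloss⟩ := seq₀.exists_subseq_noEnergyLoss
  have seq₁ := seq₀.comp hσ₁
  obtain ⟨σ₂, hσ₂, hneck⟩ := seq₁.exists_subseq_noNeck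
  have seq₂ := seq₁.comp hσ₂
  refine ⟨σ₀ ∘ σ₁ ∘ σ₂, hσ₀.comp (hσ₁.comp hσ₂), ?_, hloss.comp hσ₂, hneck⟩
  rintro ⟨g₀, hg₀⟩
  refine seq₂.not_isBubble (p := p) (fun k => (hf _).memW2pLoc) (ε := √ε) ?_ g₀ hg₀
  intro k v hv
  rw [Real.sq_sqrt hε.le]
  exact hW' _ v hv
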